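/- Let $P$ be a simple polygon in the Euclidean plane with $n \ge 3$ vertices (a closed polygonal chain with pairwise distinct vertices in which two different sides meet only in common endpoints), regarded as a closed set that includes its boundary. A triangulation $T$ of $P$ is a maximal crossing-free straight-line graph whose vertices are the vertices of $P$ and whose edges lie inside $P$; no edge may pass through a vertex other than its endpoints. The dual graph of $T$ has a vertex for each bounded face of $T$, and two different faces are adjacent if and only if they share an edge of $T$; the dual diameter of $T$ is the diameter of its dual graph, that is, the largest graph distance between two of its vertices. Let $m \ge 1$ be an integer such that $n \in \{3\cdot 2^{m-1}+1, \dots, 3\cdot 2^m\}$. Then the dual diameter of every triangulation of $P$ is at least $2\lceil \log_2(n/3)\rceil - 1$ if $n \in \{3\cdot 2^{m-1}+1, \dots, 4\cdot 2^{m-1}\}$, and at least $2\lceil \log_2(n/3)\rceil$ if $n \in \{4\cdot 2^{m-1}+1, \dots, 3\cdot 2^m\}$. -/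

import Mathlib

namespace PolygonTriangulation

/-- The Euclidean plane. -/
abbrev Plane : Type := EuclideanSpace ℝ (Fin 2)

variable {n : ℕ}

/-- A polygon is simple if its vertices are pairwise distinct and any two different sides meet
only in common endpoints. (A vertex with a straight angle is allowed.) -/
def IsSimple (P : Polygon Plane n) : Prop :=
  Function.Injective P.vertices ∧
  ∀ i j : Fin n, i ≠ j →
    P.edgeSet ℝ i ∩ P.edgeSet ℝ j ⊆
      ({P i, P (finRotate n i)} ∩ {P j, P (finRotate n j)} : Set Plane)

/-- The interior of the polygon: the points off the boundary curve whose connected component in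
the complement of that curve is bounded. -/
def inside (P : Polygon Plane n) : Set Plane :=
  {x | x ∉ P.boundary ℝ ∧ Bornology.IsBounded (connectedComponentIn (P.boundary ℝ)ᶜ x)}

/-- The polygon as a closed two-dimensional subset of the plane, with its boundary. -/
def region (P : Polygon Plane n) : Set Plane :=
  P.boundary ℝ ∪ inside P

/-- A graph on the vertices of the polygon, drawn with straight-line edges, is a crossing-free
geometric graph whose edges lie inside the (closed) polygon. -/
structure IsCrossingFreeIn (P : Polygon Plane n) (T : SimpleGraph (Fin n)) : Prop where
  /-- every edge lies in the closed polygon -/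
  edge_subset : ∀ a b, T.Adj a b → segment ℝ (P a) (P b) ⊆ region P
  /-- no edge passes through a vertex other than its endpoints -/
  vertex_mem : ∀ a b c, T.Adj a b → P c ∈ segment ℝ (P a) (P b) → c = a ∨ c = b
  /-- two different edges meet only in common endpoints -/
  inter_subset : ∀ a b c d, T.Adj a b → T.Adj c d → s(a, b) ≠ s(c, d) →
    segment ℝ (P a) (P b) ∩ segment ℝ (P c) (P d) ⊆ ({P a, P b} ∩ {P c, P d} : Set Plane)

/-- A triangulation of the polygon: a maximal (with respect to inclusion of edges) crossing-free
geometric graph on the vertices of the polygon with edges inside the polygon. -/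
def IsTriangulation (P : Polygon Plane n) (T : SimpleGraph (Fin n)) : Prop :=
  Maximal (IsCrossingFreeIn P) T

/-- The point set of the drawing: all vertices and all edges. -/
def drawing (P : Polygon Plane n) (T : SimpleGraph (Fin n)) : Set Plane :=
  Set.range P.vertices ∪ {x | ∃ a b, T.Adj a b ∧ x ∈ segment ℝ (P a) (P b)}

/-- The bounded faces of the drawing: the bounded connected components of its complement. -/
def IsBoundedFace (P : Polygon Plane n) (T : SimpleGraph (Fin n)) (F : Set Plane) : Prop :=
  Bornology.IsBounded F ∧
    ∃ x ∈ (drawing P T)ᶜ, F = connectedComponentIn (drawing P T)ᶜ x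

/-- The dual graph: its vertices are the bounded faces of the drawing, and two different faces
are adjacent if they share an edge of the drawing. -/
def dualGraph (P : Polygon Plane n) (T : SimpleGraph (Fin n)) :
    SimpleGraph {F : Set Plane // IsBoundedFace P T F} where
  Adj F G := F ≠ G ∧ ∃ a b, T.Adj a b ∧
    segment ℝ (P a) (P b) ⊆ closure (F : Set Plane) ∧
    segment ℝ (P a) (P b) ⊆ closure (G : Set Plane)
  symm := ⟨fun _ _ ⟨h, a, b, hab, h₁, h₂⟩ => ⟨h.symm, a, b, hab, h₂, h₁⟩⟩
  loopless := ⟨fun _ h => h.1 rfl⟩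

/-- The dual diameter: the largest graph distance between two vertices of the dual graph.
(A dual graph that is disconnected or of infinite diameter would get the value `0`, so a positive
lower bound also says that this does not happen.) -/
noncomputable def dualDiameter (P : Polygon Plane n) (T : SimpleGraph (Fin n)) : ℕ :=
  (dualGraph P T).diam

end PolygonTriangulation

/-! The dual graph of a triangulation is a finite tree of maximum degree three with at least `n - 2`
vertices. If its diameter is `D`, cut a diametral path at its middle edge. Every vertex lies on one
side of this edge, at distance at most `D / 2`, respectively `D - D / 2 - 1`, from the end on that
side. Behind the edge the tree branches at most in two at each step, so it has at most `(2 ^ (D / 2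
+ 1) - 1) + (2 ^ (D - D / 2) - 1)` vertices (`card_add_two_le_of_isAcyclic`). Hence `n ≤ 2 ^ (D / 2
+ 1) + 2 ^ (D - D / 2)` (`IsTriangulation.le_pow_dualDiameter`). With `D ≤ 2 * (m - 1)` this gives
`n ≤ 3 * 2 ^ (m - 1)`, with `D ≤ 2 * m - 1` it gives `n ≤ 4 * 2 ^ (m - 1)`, and the rounded
logarithm equals `m` on the given range.

The work lies in extracting this tree from the topology. The winding angle of a closed family of
directed segments is a multiple of `2π`, constant on connected sets off the family and zero far
away, so nonzero winding certifies a bounded component. For a simple polygon the converse holds too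
(`IsSimple.wind_ne_zero`): every component of the complement accumulates at the whole boundary, and
the angle of a side jumps by `2π` across it.

Maximality puts all sides of the polygon into `T`. Splitting the polygon along a chord splits its
winding, whence chords do not interleave (`IsTriangulation.not_interleaved`). Existence of diagonals
(`IsSimple.exists_diagonal`), applied to a shortest increasing path closed by a chord, puts a
triangle on every chord (`IsTriangulation.exists_apex`). Thus `T` is combinatorially a triangulation
of a convex polygon, whose triangles form a tree, and additivity of winding identifies these
triangles with the bounded faces (`IsTriangulation.exists_iso_dualGraph`). -/

namespace PolygonTriangulation

/-! ### Cross products, segments and viewing angles -/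

/-- The cross product of two vectors of the plane. -/
def cr (u v : Plane) : ℝ := u 0 * v 1 - u 1 * v 0

/-- The dot product of two vectors of the plane. -/
def dt (u v : Plane) : ℝ := u 0 * v 0 + u 1 * v 1

theorem plane_ext {u v : Plane} (h0 : u 0 = v 0) (h1 : u 1 = v 1) : u = v := by
  ext i
  fin_cases i
  exacts [h0, h1]

theorem continuous_cr {X : Type*} [TopologicalSpace X] {f g : X → Plane} (hf : Continuous f)
    (hg : Continuous g) : Continuous fun x => cr (f x) (g x) := by
  unfold cr
  fun_prop

theorem continuous_dt {X : Type*} [TopologicalSpace X] {f g : X → Plane} (hf : Continuous f)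
    (hg : Continuous g) : Continuous fun x => dt (f x) (g x) := by
  unfold dt
  fun_prop

/-- From a point of the segment the two ends are seen in opposite directions. In this form, which
covers degenerate segments, membership becomes polynomial arithmetic. -/
theorem mem_segment_iff {p q x : Plane} :
    x ∈ segment ℝ p q ↔ cr (p - x) (q - x) = 0 ∧ dt (p - x) (q - x) ≤ 0 := by
  constructor
  · rintro ⟨a, b, ha, hb, hab, rfl⟩
    obtain rfl : b = 1 - a := by linarith
    simp only [cr, dt, PiLp.sub_apply, PiLp.add_apply, PiLp.smul_apply, smul_eq_mul]
    constructor
    · ring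
    · nlinarith [mul_nonneg (mul_nonneg ha hb) (add_nonneg (sq_nonneg (p 0 - q 0))
        (sq_nonneg (p 1 - q 1)))]
  · rintro ⟨hc, hd⟩
    simp only [cr, dt, PiLp.sub_apply] at hc hd
    set D : ℝ := (p 0 - q 0) ^ 2 + (p 1 - q 1) ^ 2 with hD
    rcases (show 0 ≤ D by positivity).eq_or_lt with h0 | hpos
    · have h1 : p 0 = q 0 := by nlinarith [sq_nonneg (p 0 - q 0), sq_nonneg (p 1 - q 1)]
      have h2 : p 1 = q 1 := by nlinarith [sq_nonneg (p 0 - q 0), sq_nonneg (p 1 - q 1)]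
      rw [h1, h2] at hd
      have h3 : x = p := plane_ext
        (by nlinarith [sq_nonneg (q 0 - x 0), sq_nonneg (q 1 - x 1)])
        (by nlinarith [sq_nonneg (q 0 - x 0), sq_nonneg (q 1 - x 1)])
      rw [h3]
      exact left_mem_segment ℝ p q
    -- The weights are the coefficients of the orthogonal projection of `x` to the line: the
    -- numerators are `dt (q - x) (q - p)` and `dt (p - x) (p - q)`.
    · refine ⟨((q 0 - x 0) ^ 2 + (q 1 - x 1) ^ 2 -
          ((p 0 - x 0) * (q 0 - x 0) + (p 1 - x 1) * (q 1 - x 1))) / D,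
        ((p 0 - x 0) ^ 2 + (p 1 - x 1) ^ 2 -
          ((p 0 - x 0) * (q 0 - x 0) + (p 1 - x 1) * (q 1 - x 1))) / D, ?_, ?_, ?_, ?_⟩
      · apply div_nonneg _ hpos.le
        nlinarith [sq_nonneg (q 0 - x 0), sq_nonneg (q 1 - x 1)]
      · apply div_nonneg _ hpos.le
        nlinarith [sq_nonneg (p 0 - x 0), sq_nonneg (p 1 - x 1)]
      · rw [← add_div, div_eq_one_iff_eq hpos.ne', hD]
        ring
      · apply plane_ext <;>
          simp only [PiLp.add_apply, PiLp.smul_apply, smul_eq_mul] <;>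
          rw [div_mul_eq_mul_div, div_mul_eq_mul_div, ← add_div, div_eq_iff hpos.ne', hD]
        · linear_combination (q 1 - p 1) * hc
        · linear_combination (p 0 - q 0) * hc

/-- The angle under which the directed segment from `p` to `q` is seen from `x`. -/
noncomputable def ang (x p q : Plane) : ℝ :=
  Complex.arg ⟨dt (p - x) (q - x), cr (p - x) (q - x)⟩

/-- The branch cut of `arg`, with zero included, corresponds exactly to the segment; this makes the
angle continuous and odd off it. -/
theorem mem_slitPlane_of_notMem_segment {x p q : Plane} (h : x ∉ segment ℝ p q) :
    (⟨dt (p - x) (q - x), cr (p - x) (q - x)⟩ : ℂ) ∈ Complex.slitPlane := by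
  rw [mem_segment_iff, not_and_or, not_le] at h
  rw [Complex.mem_slitPlane_iff]
  exact h.symm

theorem ang_swap {x p q : Plane} (h : x ∉ segment ℝ p q) : ang x q p = -ang x p q := by
  have h1 := Complex.mem_slitPlane_iff_arg.1 (mem_slitPlane_of_notMem_segment h)
  have h2 := Complex.arg_conj ⟨dt (p - x) (q - x), cr (p - x) (q - x)⟩
  rw [if_neg h1.1] at h2
  rw [ang, ang, ← h2]
  congr 1
  apply Complex.ext
  · simp [dt, mul_comm]
  · simp [cr]
    ring

theorem continuousAt_ang {x p q : Plane} (h : x ∉ segment ℝ p q) :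
    ContinuousAt (fun y => ang y p q) x := by
  refine (Complex.continuousAt_arg (mem_slitPlane_of_notMem_segment h)).comp
    (f := fun y : Plane => (⟨dt (p - y) (q - y), cr (p - y) (q - y)⟩ : ℂ)) ?_
  have h1 : Continuous fun y : Plane => dt (p - y) (q - y) :=
    continuous_dt (by fun_prop) (by fun_prop)
  have h2 : Continuous fun y : Plane => cr (p - y) (q - y) :=
    continuous_cr (by fun_prop) (by fun_prop)
  have h3 : (fun y : Plane => (⟨dt (p - y) (q - y), cr (p - y) (q - y)⟩ : ℂ)) =
      fun y => (dt (p - y) (q - y) : ℂ) + (cr (p - y) (q - y) : ℂ) * Complex.I := by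
    ext y
    exact (Complex.mk_eq_add_mul_I _ _)
  rw [h3]
  exact ((Complex.continuous_ofReal.comp h1).add
    ((Complex.continuous_ofReal.comp h2).mul continuous_const)).continuousAt

/-- A vector of the plane as a complex number. -/
def toC (u : Plane) : ℂ := ⟨u 0, u 1⟩

theorem toC_ne_zero {u : Plane} (h : u ≠ 0) : toC u ≠ 0 := by
  intro h0
  apply h
  exact plane_ext (congrArg Complex.re h0) (congrArg Complex.im h0)

theorem mk_dt_cr (u v : Plane) : (⟨dt u v, cr u v⟩ : ℂ) = (starRingEnd ℂ) (toC u) * toC v := by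
  apply Complex.ext
  · simp [toC, dt]
  · simp [toC, cr]
    ring

/-- Modulo `2π` the angle is a function of the end minus the same function of the start, so it
telescopes along closed curves. -/
theorem coe_ang {x p q : Plane} (hp : p ≠ x) (hq : q ≠ x) :
    (ang x p q : Real.Angle) = (Complex.arg (toC (q - x)) : Real.Angle) -
      (Complex.arg (toC (p - x)) : Real.Angle) := by
  have h1 := toC_ne_zero (sub_ne_zero.2 hp)
  have h2 := toC_ne_zero (sub_ne_zero.2 hq)
  rw [ang, mk_dt_cr, Complex.arg_mul_coe_angle (by simpa using h1) h2, Complex.arg_conj_coe_angle]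
  abel

/-- Measured from `d`, both arguments lie strictly between `-π/2` and `π/2`, so their difference
does not wrap around and the telescoping is exact. -/
theorem ang_eq_sub {x p q d : Plane} (hp : 0 < dt d (p - x)) (hq : 0 < dt d (q - x)) :
    ang x p q = Complex.arg ((starRingEnd ℂ) (toC d) * toC (q - x)) -
      Complex.arg ((starRingEnd ℂ) (toC d) * toC (p - x)) := by
  have hre : ∀ {u : Plane}, 0 < dt d u → 0 < ((starRingEnd ℂ) (toC d) * toC u).re := by
    intro u hu
    rwa [← mk_dt_cr]
  have hp' := hre hp
  have hq' := hre hq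
  set a := (starRingEnd ℂ) (toC d) * toC (p - x) with ha
  set b := (starRingEnd ℂ) (toC d) * toC (q - x) with hb
  have ha0 : a ≠ 0 := by
    rintro h
    simp [h] at hp'
  have hb0 : b ≠ 0 := by
    rintro h
    simp [h] at hq'
  have hd0 : toC d ≠ 0 := by
    rintro h
    simp [ha, h] at ha0
  have h1 := Complex.abs_arg_lt_pi_div_two_iff.2 (Or.inl hp')
  have h2 := Complex.abs_arg_lt_pi_div_two_iff.2 (Or.inl hq')
  rw [abs_lt] at h1 h2
  have h3 : Complex.arg ((starRingEnd ℂ) a) = -Complex.arg a := by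
    rw [Complex.arg_conj, if_neg]
    have := Real.pi_pos
    linarith
  have h4 := Complex.arg_mul (x := (starRingEnd ℂ) a) (y := b) (by simpa using ha0) hb0
    (by rw [h3]; constructor <;> linarith)
  rw [h3] at h4
  have h5 : (starRingEnd ℂ) a * b =
      ((Complex.normSq (toC d) : ℝ) : ℂ) * ((starRingEnd ℂ) (toC (p - x)) * toC (q - x)) := by
    rw [ha, hb, Complex.normSq_eq_conj_mul_self]
    simp only [map_mul, Complex.conj_conj]
    ring
  rw [h5, Complex.arg_real_mul _ (Complex.normSq_pos.2 hd0)] at h4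
  rw [ang, mk_dt_cr, h4]
  ring

end PolygonTriangulation

/-! ### Winding angles of closed families of segments -/

namespace PolygonTriangulation
open Filter Topology

theorem dt_eq_inner (u v : Plane) : dt u v = inner ℝ u v := by
  simp [dt, PiLp.inner_apply, Fin.sum_univ_two, mul_comm]

/-- The points off `K` whose component in the complement of `K` is bounded. -/
def insideSet (K : Set Plane) : Set Plane :=
  {x | x ∉ K ∧ Bornology.IsBounded (connectedComponentIn Kᶜ x)}

theorem inside_eq_insideSet {n : ℕ} (P : Polygon Plane n) :
    inside P = insideSet (P.boundary ℝ) := rfl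

/-- The point set of a finite family of directed segments. -/
def trace (E : Multiset (Plane × Plane)) : Set Plane :=
  {x | ∃ e ∈ E, x ∈ segment ℝ e.1 e.2}

/-- A family of directed segments in which every point is as often a start as an end. -/
def Balanced (E : Multiset (Plane × Plane)) : Prop :=
  E.map Prod.fst = E.map Prod.snd

/-- The total angle under which a family of directed segments is seen from a point. -/
noncomputable def wind (E : Multiset (Plane × Plane)) (x : Plane) : ℝ :=
  (E.map fun e => ang x e.1 e.2).sum

theorem trace_add (E F : Multiset (Plane × Plane)) : trace (E + F) = trace E ∪ trace F := by
  ext x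
  simp only [trace, Multiset.mem_add, Set.mem_union, Set.mem_ofPred_eq]
  constructor
  · rintro ⟨e, he | he, hx⟩
    exacts [Or.inl ⟨e, he, hx⟩, Or.inr ⟨e, he, hx⟩]
  · rintro (⟨e, he, hx⟩ | ⟨e, he, hx⟩)
    exacts [⟨e, Or.inl he, hx⟩, ⟨e, Or.inr he, hx⟩]

theorem wind_add (E F : Multiset (Plane × Plane)) (x : Plane) :
    wind (E + F) x = wind E x + wind F x := by
  simp [wind]

theorem wind_cons (e : Plane × Plane) (E : Multiset (Plane × Plane)) (x : Plane) :
    wind (e ::ₘ E) x = ang x e.1 e.2 + wind E x := by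
  simp [wind]

theorem continuousAt_wind {E : Multiset (Plane × Plane)} {x : Plane} (h : x ∉ trace E) :
    ContinuousAt (wind E) x := by
  induction E using Multiset.induction with
  | empty =>
    have : wind 0 = fun _ => 0 := by
      ext x
      simp [wind]
    rw [this]
    exact continuousAt_const
  | cons e E ih =>
    have h1 : wind (e ::ₘ E) = fun y => ang y e.1 e.2 + wind E y := funext fun y => wind_cons e E y
    rw [h1]
    refine (continuousAt_ang fun hx => h ⟨e, by simp, hx⟩).add (ih ?_)
    rintro ⟨f, hf, hx⟩
    exact h ⟨f, by simp [hf], hx⟩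

theorem exists_int_of_balanced {E : Multiset (Plane × Plane)} (hE : Balanced E) {x : Plane}
    (hx : ∀ e ∈ E, e.1 ≠ x ∧ e.2 ≠ x) : ∃ k : ℤ, wind E x = k * (2 * Real.pi) := by
  have h0 : ((wind E x : ℝ) : Real.Angle) = 0 := by
    have h1 : ((wind E x : ℝ) : Real.Angle) =
        (E.map fun e => ((ang x e.1 e.2 : ℝ) : Real.Angle)).sum := by
      rw [wind, ← Real.Angle.coe_coeHom, map_multiset_sum, Multiset.map_map]
      rfl
    rw [h1, Multiset.map_congr rfl fun e he => coe_ang (hx e he).1 (hx e he).2,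
      Multiset.sum_map_sub]
    have h2 := congrArg (fun M : Multiset Plane =>
      (M.map fun p => ((Complex.arg (toC (p - x)) : ℝ) : Real.Angle)).sum) hE
    simp only [Multiset.map_map, Function.comp_def] at h2
    rw [h2, sub_self]
  obtain ⟨k, hk⟩ := Real.Angle.coe_eq_zero_iff.1 h0
  exact ⟨k, by rw [← hk, zsmul_eq_mul]⟩

theorem ne_of_notMem_trace {E : Multiset (Plane × Plane)} {x : Plane} (hx : x ∉ trace E)
    (e : Plane × Plane) (he : e ∈ E) : e.1 ≠ x ∧ e.2 ≠ x := by
  constructor <;> rintro rfl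
  · exact hx ⟨e, he, left_mem_segment ℝ _ _⟩
  · exact hx ⟨e, he, right_mem_segment ℝ _ _⟩

/-- Divided by `2π`, the winding angle is continuous off the trace and takes integer values. -/
theorem wind_eq_of_isPreconnected {E : Multiset (Plane × Plane)} (hE : Balanced E)
    {A : Set Plane} (hA : IsPreconnected A) (hAE : ∀ x ∈ A, x ∉ trace E) {x y : Plane}
    (hx : x ∈ A) (hy : y ∈ A) : wind E x = wind E y := by
  have h1 : ContinuousOn (fun z => wind E z / (2 * Real.pi)) A := fun z hz =>
    ((continuousAt_wind (hAE z hz)).div_const _).continuousWithinAt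
  have h2 : Set.MapsTo (fun z => wind E z / (2 * Real.pi)) A (Set.range ((↑) : ℤ → ℝ)) := by
    intro z hz
    obtain ⟨k, hk⟩ := exists_int_of_balanced hE (ne_of_notMem_trace (hAE z hz))
    refine ⟨k, ?_⟩
    simp only [hk]
    field_simp
  have hdisc : IsDiscrete (Set.range ((↑) : ℤ → ℝ)) := by
    rw [← Set.image_univ]
    exact IsDiscrete.univ.image Int.isClosedEmbedding_coe_real.isInducing
  have h3 := hA.constant_of_mapsTo hdisc h1 h2 hx hy
  have := Real.pi_pos
  field_simp at h3
  exact h3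

theorem wind_eq_zero_of_half_plane {E : Multiset (Plane × Plane)} (hE : Balanced E) {x : Plane}
    (d : Plane) (hd : ∀ e ∈ E, 0 < dt d (e.1 - x) ∧ 0 < dt d (e.2 - x)) : wind E x = 0 := by
  rw [wind, Multiset.map_congr rfl fun e he => ang_eq_sub (hd e he).1 (hd e he).2,
    Multiset.sum_map_sub]
  have h2 := congrArg (fun M : Multiset Plane =>
    (M.map fun p => Complex.arg ((starRingEnd ℂ) (toC d) * toC (p - x))).sum) hE
  simp only [Multiset.map_map, Function.comp_def] at h2
  rw [h2, sub_self]

theorem exists_wind_eq_zero_of_lt_norm {E : Multiset (Plane × Plane)} (hE : Balanced E) :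
    ∃ R : ℝ, ∀ x : Plane, R < ‖x‖ → wind E x = 0 := by
  obtain ⟨R, hR⟩ : ∃ R : ℝ, ∀ e ∈ E, ‖e.1‖ ≤ R ∧ ‖e.2‖ ≤ R := by
    clear hE
    induction E using Multiset.induction with
    | empty => exact ⟨0, by simp⟩
    | cons e E ih =>
      obtain ⟨R, hR⟩ := ih
      refine ⟨max R (max ‖e.1‖ ‖e.2‖), fun f hf => ?_⟩
      rcases Multiset.mem_cons.1 hf with rfl | hf
      · simp
      · exact ⟨le_max_of_le_left (hR f hf).1, le_max_of_le_left (hR f hf).2⟩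
  -- By Cauchy–Schwarz, from a far point `x` the whole family lies in the half plane of direction
  -- `-x`.
  have key : ∀ x q : Plane, ‖q‖ ≤ R → R < ‖x‖ → 0 < dt (-x) (q - x) := by
    intro x q hq hx
    rw [dt_eq_inner, inner_neg_left, inner_sub_right, real_inner_self_eq_norm_sq]
    have := real_inner_le_norm x q
    nlinarith [norm_nonneg q, norm_nonneg x]
  exact ⟨R, fun x hx => wind_eq_zero_of_half_plane hE (-x) fun e he =>
    ⟨key x _ (hR e he).1 hx, key x _ (hR e he).2 hx⟩⟩

/-- The winding angle is constant on the component of `x` and vanishes outside a large disc, so the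
component stays within that disc. -/
theorem mem_insideSet_of_wind_ne_zero {E : Multiset (Plane × Plane)} (hE : Balanced E) {x : Plane}
    (hx : x ∉ trace E) (h : wind E x ≠ 0) : x ∈ insideSet (trace E) := by
  refine ⟨hx, ?_⟩
  obtain ⟨R, hR⟩ := exists_wind_eq_zero_of_lt_norm hE
  refine (Metric.isBounded_closedBall (x := (0 : Plane)) (r := R)).subset fun y hy => ?_
  by_contra hy'
  rw [mem_closedBall_zero_iff, not_le] at hy'
  apply h
  rw [← hR y hy']
  exact wind_eq_of_isPreconnected hE isPreconnected_connectedComponentIn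
    (fun z hz => connectedComponentIn_subset _ _ hz) (mem_connectedComponentIn hx) hy

theorem isClosed_segment (p q : Plane) : IsClosed (segment ℝ p q) := by
  have h1 : segment ℝ p q = {x | cr (p - x) (q - x) = 0} ∩ {x | dt (p - x) (q - x) ≤ 0} := by
    ext x
    exact mem_segment_iff
  rw [h1]
  exact (isClosed_eq (continuous_cr (by fun_prop) (by fun_prop)) continuous_const).inter
    (isClosed_le (continuous_dt (by fun_prop) (by fun_prop)) continuous_const)

theorem isClosed_trace (E : Multiset (Plane × Plane)) : IsClosed (trace E) := by
  induction E using Multiset.induction with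
  | empty =>
    have : trace 0 = ∅ := by
      ext x
      simp [trace]
    rw [this]
    exact isClosed_empty
  | cons e E ih =>
    have : trace (e ::ₘ E) = segment ℝ e.1 e.2 ∪ trace E := by
      ext x
      simp [trace]
    rw [this]
    exact (isClosed_segment _ _).union ih

/-! ### Winding angles of triangles -/

/-- The signed double area of a triangle. -/
def orient (a b c : Plane) : ℝ := cr (b - a) (c - a)

/-- The interior of a nondegenerate triangle. -/
def openTri (a b c : Plane) : Set Plane :=
  {x | 0 < orient a b c * cr (a - x) (b - x) ∧ 0 < orient a b c * cr (b - x) (c - x) ∧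
    0 < orient a b c * cr (c - x) (a - x)}

/-- The directed sides of a triangle. -/
def triEdges (a b c : Plane) : Multiset (Plane × Plane) := {(a, b), (b, c), (c, a)}

theorem mem_trace_triEdges {a b c x : Plane} : x ∈ trace (triEdges a b c) ↔
    x ∈ segment ℝ a b ∨ x ∈ segment ℝ b c ∨ x ∈ segment ℝ c a := by
  simp [trace, triEdges]

theorem balanced_triEdges (a b c : Plane) : Balanced (triEdges a b c) := by
  simp only [Balanced, triEdges, Multiset.insert_eq_cons, Multiset.map_cons,
    Multiset.map_singleton]
  rw [Multiset.cons_swap b c]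
  rw [← Multiset.singleton_add, ← Multiset.singleton_add, ← Multiset.singleton_add,
    ← Multiset.singleton_add]
  abel

theorem wind_triEdges (a b c x : Plane) :
    wind (triEdges a b c) x = ang x a b + ang x b c + ang x c a := by
  simp [wind, triEdges, add_assoc]

/-- The three summands are the barycentric coordinates of `x`, scaled by the signed double area. -/
theorem cr_sum (a b c x : Plane) :
    cr (a - x) (b - x) + cr (b - x) (c - x) + cr (c - x) (a - x) = orient a b c := by
  simp only [cr, orient, PiLp.sub_apply]
  ring

theorem orient_rotate (a b c : Plane) : orient b c a = orient a b c := by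
  simp only [cr, orient, PiLp.sub_apply]
  ring

theorem openTri_rotate (a b c : Plane) : openTri b c a = openTri a b c := by
  ext x
  simp only [openTri, orient_rotate, Set.mem_ofPred_eq]
  tauto

theorem ang_pos {x p q : Plane} (h : 0 < cr (p - x) (q - x)) : 0 < ang x p q := by
  unfold ang
  exact lt_of_le_of_ne (Complex.arg_nonneg_iff.2 h.le) (fun h0 => by
    have := (Complex.arg_eq_zero_iff.1 h0.symm).2
    simp at this
    linarith)

theorem ang_neg {x p q : Plane} (h : cr (p - x) (q - x) < 0) : ang x p q < 0 := by
  unfold ang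
  exact Complex.arg_neg_iff.2 h

theorem wind_triEdges_ne_zero {a b c x : Plane} (h : x ∈ openTri a b c) :
    wind (triEdges a b c) x ≠ 0 := by
  obtain ⟨h1, h2, h3⟩ := h
  rw [wind_triEdges]
  rcases lt_trichotomy (orient a b c) 0 with hD | hD | hD
  · have e1 := ang_neg (neg_of_mul_pos_right h1 hD.le)
    have e2 := ang_neg (neg_of_mul_pos_right h2 hD.le)
    have e3 := ang_neg (neg_of_mul_pos_right h3 hD.le)
    linarith
  · simp [hD] at h1
  · have e1 := ang_pos (pos_of_mul_pos_right h1 hD.le)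
    have e2 := ang_pos (pos_of_mul_pos_right h2 hD.le)
    have e3 := ang_pos (pos_of_mul_pos_right h3 hD.le)
    linarith

/-- A point strictly beyond the line through `a` and `b` sees the whole triangle in an open half
plane. Its direction is the normal of `a b`, with the factor `D` turning it towards `c`. -/
theorem wind_triEdges_eq_zero_of_neg {a b c x : Plane}
    (h : orient a b c * cr (a - x) (b - x) < 0) : wind (triEdges a b c) x = 0 := by
  have hD : 0 < orient a b c * orient a b c := by
    refine mul_self_pos.2 fun h0 => ?_
    simp [h0] at h
  set D := orient a b c with hDdef
  refine wind_eq_zero_of_half_plane (balanced_triEdges a b c)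
    !₂[-(D * (b 1 - a 1)), D * (b 0 - a 0)] ?_
  have ha : 0 < dt !₂[-(D * (b 1 - a 1)), D * (b 0 - a 0)] (a - x) := by
    simp [dt, cr] at h ⊢
    linarith
  have hb : 0 < dt !₂[-(D * (b 1 - a 1)), D * (b 0 - a 0)] (b - x) := by
    simp [dt, cr] at h ⊢
    linarith
  have hc : 0 < dt !₂[-(D * (b 1 - a 1)), D * (b 0 - a 0)] (c - x) := by
    have h1 : dt !₂[-(D * (b 1 - a 1)), D * (b 0 - a 0)] (c - x) =
        D * D - D * cr (a - x) (b - x) := by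
      nth_rewrite 4 [hDdef]
      simp [dt, cr, orient]
      ring
    rw [h1]
    linarith
  intro e he
  simp only [triEdges, Multiset.insert_eq_cons, Multiset.mem_cons, Multiset.mem_singleton] at he
  rcases he with rfl | rfl | rfl
  exacts [⟨ha, hb⟩, ⟨hb, hc⟩, ⟨hc, ha⟩]

theorem mem_segment_of_cr_eq_zero {a b c x : Plane} (hD : orient a b c ≠ 0)
    (h1 : cr (a - x) (b - x) = 0) (h2 : 0 ≤ orient a b c * cr (b - x) (c - x))
    (h3 : 0 ≤ orient a b c * cr (c - x) (a - x)) : x ∈ segment ℝ a b := by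
  have hs := cr_sum a b c x
  set D := orient a b c with hDdef
  have hDD : 0 < D * D := mul_self_pos.2 hD
  -- The barycentric coordinate at `c` vanishes, so the other two are the weights; expanding by `D`
  -- makes their signs visible.
  refine ⟨D * cr (b - x) (c - x) / (D * D), D * cr (c - x) (a - x) / (D * D),
    div_nonneg h2 hDD.le, div_nonneg h3 hDD.le, ?_, ?_⟩
  · rw [← add_div, div_eq_one_iff_eq hDD.ne', ← mul_add]
    congr 1
    linarith
  · rw [mul_div_mul_left _ _ hD, mul_div_mul_left _ _ hD]
    simp only [cr, PiLp.sub_apply] at h1 hs ⊢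
    apply plane_ext <;>
      simp only [PiLp.add_apply, PiLp.smul_apply, smul_eq_mul] <;>
      rw [div_mul_eq_mul_div, div_mul_eq_mul_div, ← add_div, div_eq_iff hD, ← hs]
    · linear_combination (-c 0) * h1
    · linear_combination (-c 1) * h1

theorem mem_openTri_or_mem_trace {a b c x : Plane} (hD : orient a b c ≠ 0)
    (h1 : 0 ≤ orient a b c * cr (a - x) (b - x)) (h2 : 0 ≤ orient a b c * cr (b - x) (c - x))
    (h3 : 0 ≤ orient a b c * cr (c - x) (a - x)) :
    x ∈ openTri a b c ∨ x ∈ trace (triEdges a b c) := by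
  rw [mem_trace_triEdges]
  rcases h1.eq_or_lt with e1 | p1
  · exact Or.inr (Or.inl (mem_segment_of_cr_eq_zero hD
      ((mul_eq_zero.1 e1.symm).resolve_left hD) h2 h3))
  rcases h2.eq_or_lt with e2 | p2
  · refine Or.inr (Or.inr (Or.inl (mem_segment_of_cr_eq_zero (c := a) ?_
      ((mul_eq_zero.1 e2.symm).resolve_left hD) ?_ ?_)))
    all_goals rw [orient_rotate]; assumption
  rcases h3.eq_or_lt with e3 | p3
  · refine Or.inr (Or.inr (Or.inr (mem_segment_of_cr_eq_zero (c := b) ?_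
      ((mul_eq_zero.1 e3.symm).resolve_left hD) ?_ ?_)))
    all_goals rw [← orient_rotate]; assumption
  exact Or.inl ⟨p1, p2, p3⟩

theorem wind_triEdges_eq_zero {a b c x : Plane} (hD : orient a b c ≠ 0)
    (hx : x ∉ openTri a b c) (hxt : x ∉ trace (triEdges a b c)) : wind (triEdges a b c) x = 0 := by
  by_cases h1 : orient a b c * cr (a - x) (b - x) < 0
  · exact wind_triEdges_eq_zero_of_neg h1
  by_cases h2 : orient a b c * cr (b - x) (c - x) < 0
  · have := wind_triEdges_eq_zero_of_neg (a := b) (b := c) (c := a) (x := x)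
      (by rwa [orient_rotate])
    rw [wind_triEdges] at this ⊢
    linarith
  by_cases h3 : orient a b c * cr (c - x) (a - x) < 0
  · have := wind_triEdges_eq_zero_of_neg (a := c) (b := a) (c := b) (x := x)
      (by rwa [← orient_rotate])
    rw [wind_triEdges] at this ⊢
    linarith
  exact absurd (mem_openTri_or_mem_trace hD (not_lt.1 h1) (not_lt.1 h2) (not_lt.1 h3))
    (not_or.2 ⟨hx, hxt⟩)

end PolygonTriangulation

/-! ### Components of a complement near a line or a corner -/

namespace PolygonTriangulation
open Filter Topology

section Local
variable {C : Set Plane} {x : Plane}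

theorem subset_component {A : Set Plane} (hA : IsPreconnected A) (hAC : ∀ y ∈ A, y ∉ C)
    (hAU : (A ∩ connectedComponentIn Cᶜ x).Nonempty) : A ⊆ connectedComponentIn Cᶜ x := by
  obtain ⟨y, hyA, hyU⟩ := hAU
  rw [connectedComponentIn_eq hyU]
  exact hA.subset_connectedComponentIn hyA hAC

theorem tendsto_add_smul (z v : Plane) : Tendsto (fun t : ℝ => z + t • v) (𝓝[>] 0) (𝓝 z) := by
  have h : Continuous fun t : ℝ => z + t • v := by fun_prop
  have h1 := h.tendsto 0
  simp only [zero_smul, add_zero] at h1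
  exact h1.mono_left nhdsWithin_le_nhds

/-- Closure statements below reduce to naming a direction `v` that leads from the point straight
into `A`. -/
theorem mem_closure_of_direction {A : Set Plane} {z v p : Plane} {r : ℝ}
    (hz : z ∈ Metric.ball p r) (h : ∀ t : ℝ, 0 < t → z + t • v ∈ Metric.ball p r → z + t • v ∈ A) :
    z ∈ closure A := by
  refine mem_closure_of_tendsto (tendsto_add_smul z v) ?_
  filter_upwards [(tendsto_add_smul z v).eventually (Metric.isOpen_ball.mem_nhds hz),
    self_mem_nhdsWithin] with t h1 h2
  exact h t h2 h1

theorem cr_add_smul_right (d z v p : Plane) (t : ℝ) :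
    cr d (z + t • v - p) = cr d (z - p) + t * cr d v := by
  simp only [cr, PiLp.sub_apply, PiLp.add_apply, PiLp.smul_apply, smul_eq_mul]
  ring

theorem cr_anti (u v : Plane) : cr u v = -cr v u := by
  simp only [cr]
  ring

theorem cr_self (u : Plane) : cr u u = 0 := by
  simp only [cr]
  ring

theorem convex_cr_pos (d p : Plane) : Convex ℝ {y | 0 < cr d (y - p)} := by
  intro y hy z hz a b ha hb hab
  obtain rfl : b = 1 - a := by linarith
  simp only [Set.mem_ofPred_eq] at *
  have h1 : cr d (a • y + (1 - a) • z - p) = a * cr d (y - p) + (1 - a) * cr d (z - p) := by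
    simp only [cr, PiLp.sub_apply, PiLp.add_apply, PiLp.smul_apply, smul_eq_mul]
    ring
  rw [h1]
  rcases ha.eq_or_lt with rfl | ha
  · simpa using hz
  · have := mul_pos ha hy
    have := mul_nonneg hb hz.le
    linarith

theorem convex_cr_neg (d p : Plane) : Convex ℝ {y | cr d (y - p) < 0} := by
  have h := convex_cr_pos (-d) p
  have h1 : {y | cr d (y - p) < 0} = {y | 0 < cr (-d) (y - p)} := by
    ext y
    simp only [cr, Set.mem_ofPred_eq, PiLp.neg_apply]
    constructor <;> intro h <;> linarith
  rwa [h1]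

/-- The vector `d` turned by a right angle. -/
noncomputable def rot (d : Plane) : Plane := !₂[-(d 1), d 0]

theorem cr_rot_pos {d : Plane} (hd : d ≠ 0) : 0 < cr d (rot d) := by
  have h1 : cr d (rot d) = d 0 ^ 2 + d 1 ^ 2 := by
    simp [cr, rot]
    ring
  rw [h1]
  by_contra h
  apply hd
  apply plane_ext <;> simp <;> nlinarith [sq_nonneg (d 0), sq_nonneg (d 1)]

/-- Near a point where `C` is a straight line, each component of the complement that comes near
contains one of the two half discs. -/
theorem half_disc_subset {p d : Plane} {r : ℝ}
    (hC : ∀ y ∈ Metric.ball p r, y ∈ C ↔ cr d (y - p) = 0)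
    (hU : (Metric.ball p r ∩ connectedComponentIn Cᶜ x).Nonempty) :
    Metric.ball p r ∩ {y | 0 < cr d (y - p)} ⊆ connectedComponentIn Cᶜ x ∨
      Metric.ball p r ∩ {y | cr d (y - p) < 0} ⊆ connectedComponentIn Cᶜ x := by
  obtain ⟨y, hyB, hyU⟩ := hU
  have hyC : y ∉ C := connectedComponentIn_subset _ _ hyU
  rw [hC y hyB] at hyC
  rcases lt_or_gt_of_ne hyC with h | h
  · right
    refine subset_component ((convex_ball p r).inter (convex_cr_neg d p)).isPreconnected ?_
      ⟨y, ⟨hyB, h⟩, hyU⟩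
    rintro z ⟨hzB, hz⟩
    rw [hC z hzB]
    exact hz.ne
  · left
    refine subset_component ((convex_ball p r).inter (convex_cr_pos d p)).isPreconnected ?_
      ⟨y, ⟨hyB, h⟩, hyU⟩
    rintro z ⟨hzB, hz⟩
    rw [hC z hzB]
    exact hz.ne'

theorem subset_closure_of_line {p d : Plane} {r : ℝ} (hd : d ≠ 0)
    (hC : ∀ y ∈ Metric.ball p r, y ∈ C ↔ cr d (y - p) = 0)
    (hU : (Metric.ball p r ∩ connectedComponentIn Cᶜ x).Nonempty) :
    C ∩ Metric.ball p r ⊆ closure (connectedComponentIn Cᶜ x) := by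
  rintro z ⟨hzC, hzB⟩
  rw [hC z hzB] at hzC
  have hrot := cr_rot_pos hd
  rcases half_disc_subset hC hU with h | h
  · refine closure_mono h (mem_closure_of_direction (v := rot d) hzB fun t ht htB => ⟨htB, ?_⟩)
    simp only [Set.mem_ofPred_eq]
    rw [cr_add_smul_right, hzC]
    nlinarith
  · refine closure_mono h (mem_closure_of_direction (v := -rot d) hzB fun t ht htB => ⟨htB, ?_⟩)
    simp only [Set.mem_ofPred_eq]
    have h1 : cr d (-rot d) = -cr d (rot d) := by
      simp only [cr, PiLp.neg_apply]
      ring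
    rw [cr_add_smul_right, hzC, h1]
    nlinarith

/-- Two rays cut the disc into a convex sector and a reflex one. The latter is the union of two
overlapping half discs, so each sector is connected, and each has both rays in its closure. -/
theorem subset_closure_of_corner {p d₁ d₂ : Plane} {r : ℝ} (hr : 0 < r) (hD : 0 < cr d₁ d₂)
    (hC : ∀ y ∈ Metric.ball p r, y ∈ C ↔ (cr d₁ (y - p) = 0 ∧ cr d₂ (y - p) ≤ 0) ∨
      (cr d₂ (y - p) = 0 ∧ 0 ≤ cr d₁ (y - p)))
    (hU : (Metric.ball p r ∩ connectedComponentIn Cᶜ x).Nonempty) :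
    C ∩ Metric.ball p r ⊆ closure (connectedComponentIn Cᶜ x) := by
  have hD' : cr d₂ d₁ < 0 := by
    rw [cr_anti]
    linarith
  have hsum : ∀ d v w : Plane, cr d (v + w) = cr d v + cr d w := by
    intro d v w
    simp only [cr, PiLp.add_apply]
    ring
  have hneg : ∀ d v : Plane, cr d (-v) = -cr d v := by
    intro d v
    simp only [cr, PiLp.neg_apply]
    ring
  obtain ⟨y, hyB, hyU⟩ := hU
  have hyC : y ∉ C := connectedComponentIn_subset _ _ hyU
  rw [hC y hyB] at hyC
  rintro z ⟨hzC, hzB⟩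
  rw [hC z hzB] at hzC
  by_cases hcase : 0 < cr d₁ (y - p) ∧ cr d₂ (y - p) < 0
  · have hsub : (Metric.ball p r ∩ {y | 0 < cr d₁ (y - p)}) ∩ {y | cr d₂ (y - p) < 0} ⊆
        connectedComponentIn Cᶜ x := by
      refine subset_component (((convex_ball p r).inter (convex_cr_pos d₁ p)).inter
        (convex_cr_neg d₂ p)).isPreconnected ?_ ⟨y, ⟨⟨hyB, hcase.1⟩, hcase.2⟩, hyU⟩
      rintro w ⟨⟨hwB, hw1⟩, hw2⟩
      simp only [Set.mem_ofPred_eq] at hw1 hw2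
      rw [hC w hwB]
      rintro (h | h) <;> linarith [h.1]
    refine closure_mono hsub (mem_closure_of_direction (v := d₁ + d₂) hzB
      fun t ht htB => ⟨⟨htB, ?_⟩, ?_⟩) <;> simp only [Set.mem_ofPred_eq] <;>
      rw [cr_add_smul_right, hsum, cr_self]
    · rcases hzC with h | h <;> nlinarith [h.1, h.2]
    · rcases hzC with h | h <;> nlinarith [h.1, h.2]
  -- The reflex sector: its half discs overlap at `p - t • (d₁ + d₂)` for small positive `t`.
  · have hA2 : ∀ w ∈ Metric.ball p r ∩ {y | cr d₁ (y - p) < 0}, w ∉ C := by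
      rintro w ⟨hwB, hw1⟩
      simp only [Set.mem_ofPred_eq] at hw1
      rw [hC w hwB]
      rintro (h | h) <;> linarith [h.1, h.2]
    have hA3 : ∀ w ∈ Metric.ball p r ∩ {y | 0 < cr d₂ (y - p)}, w ∉ C := by
      rintro w ⟨hwB, hw1⟩
      simp only [Set.mem_ofPred_eq] at hw1
      rw [hC w hwB]
      rintro (h | h) <;> linarith [h.1, h.2]
    have hc2 := ((convex_ball p r).inter (convex_cr_neg d₁ p)).isPreconnected
    have hc3 := ((convex_ball p r).inter (convex_cr_pos d₂ p)).isPreconnected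
    obtain ⟨w, hw2, hw3⟩ : ((Metric.ball p r ∩ {y | cr d₁ (y - p) < 0}) ∩
        (Metric.ball p r ∩ {y | 0 < cr d₂ (y - p)})).Nonempty := by
      have hpB : p ∈ Metric.ball p r := Metric.mem_ball_self hr
      have h1 := (tendsto_add_smul p (-(d₁ + d₂))).eventually (Metric.isOpen_ball.mem_nhds hpB)
      obtain ⟨t, h2, h3⟩ := (h1.and (self_mem_nhdsWithin (s := Set.Ioi (0 : ℝ)))).exists
      have h3' : 0 < t := h3
      refine ⟨_, ⟨h2, ?_⟩, h2, ?_⟩ <;> simp only [Set.mem_ofPred_eq] <;>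
        rw [cr_add_smul_right, hneg, hsum, cr_self, sub_self]
      · have : cr d₁ (0 : Plane) = 0 := by simp [cr]
        nlinarith
      · have : cr d₂ (0 : Plane) = 0 := by simp [cr]
        nlinarith
    have hunion : (Metric.ball p r ∩ {y | cr d₁ (y - p) < 0}) ∪
        (Metric.ball p r ∩ {y | 0 < cr d₂ (y - p)}) ⊆ connectedComponentIn Cᶜ x := by
      refine subset_component (hc2.union w hw2 hw3 hc3) ?_ ⟨y, ?_, hyU⟩
      · rintro v (hv | hv)
        exacts [hA2 v hv, hA3 v hv]
      · by_contra hnot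
        simp only [Set.mem_union, Set.mem_inter_iff, Set.mem_ofPred_eq, not_or, not_and,
          not_lt] at hnot
        have h1 := hnot.1 hyB
        have h2 := hnot.2 hyB
        apply hyC
        rcases h1.eq_or_lt with h1' | h1'
        · exact Or.inl ⟨h1'.symm, h2⟩
        · rcases h2.eq_or_lt with h2' | h2'
          · exact Or.inr ⟨h2', h1⟩
          · exact absurd ⟨h1', h2'⟩ hcase
    rcases hzC with h | h
    · refine closure_mono (Set.subset_union_left.trans hunion) (mem_closure_of_direction
        (v := -d₂) hzB fun t ht htB => ⟨htB, ?_⟩)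
      simp only [Set.mem_ofPred_eq]
      rw [cr_add_smul_right, hneg, h.1]
      nlinarith
    · refine closure_mono (Set.subset_union_right.trans hunion) (mem_closure_of_direction
        (v := -d₁) hzB fun t ht htB => ⟨htB, ?_⟩)
      simp only [Set.mem_ofPred_eq]
      rw [cr_add_smul_right, hneg, h.1]
      nlinarith

end Local

end PolygonTriangulation

/-! ### The complement of a simple polygon near its boundary -/

namespace PolygonTriangulation
open Filter Topology

theorem norm_sq_eq_dt (u : Plane) : ‖u‖ ^ 2 = dt u u := by
  rw [dt_eq_inner, real_inner_self_eq_norm_sq]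

theorem dt_self_pos {u : Plane} (hu : u ≠ 0) : 0 < dt u u := by
  rw [← norm_sq_eq_dt]
  have := norm_pos_iff.2 hu
  positivity

/-- Within distance `‖q - p‖` of `p` the segment cannot be told from the ray from `p` through `q`.
-/
theorem mem_segment_near_iff {p q y : Plane} (h : ‖y - p‖ ≤ ‖q - p‖) :
    y ∈ segment ℝ p q ↔ cr (q - p) (y - p) = 0 ∧ 0 ≤ dt (q - p) (y - p) := by
  have h2 : dt (y - p) (y - p) ≤ dt (q - p) (q - p) := by
    rw [← norm_sq_eq_dt, ← norm_sq_eq_dt]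
    exact pow_le_pow_left₀ (norm_nonneg _) h 2
  have e1 : cr (p - y) (q - y) = cr (q - p) (y - p) := by
    simp only [cr, PiLp.sub_apply]
    ring
  have e2 : dt (p - y) (q - y) = dt (y - p) (y - p) - dt (q - p) (y - p) := by
    simp only [dt, PiLp.sub_apply]
    ring
  have e3 : dt (q - p) (y - p) ^ 2 + cr (q - p) (y - p) ^ 2 =
      dt (y - p) (y - p) * dt (q - p) (q - p) := by
    simp only [dt, cr]
    ring
  have h3 : 0 ≤ dt (y - p) (y - p) := by
    rw [← norm_sq_eq_dt]
    positivity
  rw [mem_segment_iff, e1, e2]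
  constructor
  · rintro ⟨h4, h5⟩
    exact ⟨h4, by linarith⟩
  · rintro ⟨h4, h5⟩
    refine ⟨h4, ?_⟩
    rw [h4] at e3
    by_contra h6
    nlinarith

/-- If `C` consists of two segments near a common end `p`, and these do not point in the same
direction, then every component of the complement that comes near `p` accumulates at every point
of `C` near `p`. -/
theorem exists_ball_subset_closure {C : Set Plane} {p q₁ q₂ : Plane} {r₀ : ℝ} (hr₀ : 0 < r₀)
    (h1 : q₁ ≠ p) (h2 : q₂ ≠ p) (hdir : cr (q₁ - p) (q₂ - p) = 0 → dt (q₁ - p) (q₂ - p) < 0)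
    (hC : ∀ y ∈ Metric.ball p r₀, y ∈ C ↔ y ∈ segment ℝ p q₁ ∨ y ∈ segment ℝ p q₂) :
    ∃ r > 0, ∀ x, (Metric.ball p r ∩ connectedComponentIn Cᶜ x).Nonempty →
      C ∩ Metric.ball p r ⊆ closure (connectedComponentIn Cᶜ x) := by
  have hd1 := sub_ne_zero.2 h1
  have hd2 := sub_ne_zero.2 h2
  refine ⟨min r₀ (min ‖q₁ - p‖ ‖q₂ - p‖), by positivity, fun x hx => ?_⟩
  have hC' : ∀ y ∈ Metric.ball p (min r₀ (min ‖q₁ - p‖ ‖q₂ - p‖)), y ∈ C ↔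
      (cr (q₁ - p) (y - p) = 0 ∧ 0 ≤ dt (q₁ - p) (y - p)) ∨
      (cr (q₂ - p) (y - p) = 0 ∧ 0 ≤ dt (q₂ - p) (y - p)) := by
    intro y hy
    rw [mem_ball_iff_norm, lt_min_iff, lt_min_iff] at hy
    rw [hC y (mem_ball_iff_norm.2 hy.1), mem_segment_near_iff hy.2.1.le,
      mem_segment_near_iff hy.2.2.le]
  have hr : 0 < min r₀ (min ‖q₁ - p‖ ‖q₂ - p‖) := by positivity
  have p1 := dt_self_pos hd1
  have p2 := dt_self_pos hd2
  generalize min r₀ (min ‖q₁ - p‖ ‖q₂ - p‖) = r at *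
  generalize q₁ - p = d₁ at *
  generalize q₂ - p = d₂ at *
  -- These identities turn the ray conditions, a cross product zero and a dot product nonnegative,
  -- into the sign conditions on cross products that `subset_closure_of_corner` expects.
  have i1 : ∀ v, dt d₁ d₁ * cr d₂ v = dt d₁ d₂ * cr d₁ v - cr d₁ d₂ * dt d₁ v := by
    intro v
    simp only [cr, dt]
    ring
  have i2 : ∀ v, dt d₂ d₂ * cr d₁ v = dt d₁ d₂ * cr d₂ v + cr d₁ d₂ * dt d₂ v := by
    intro v
    simp only [cr, dt]
    ring
  have i3 : ∀ v, dt d₁ d₁ * dt d₂ v = dt d₁ d₂ * dt d₁ v + cr d₁ d₂ * cr d₁ v := by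
    intro v
    simp only [cr, dt]
    ring
  have s1 : ∀ v, cr d₁ v = 0 → 0 < cr d₁ d₂ → (0 ≤ dt d₁ v ↔ cr d₂ v ≤ 0) := by
    intro v hv hD
    have := i1 v
    rw [hv, mul_zero, zero_sub] at this
    constructor <;> intro h <;> by_contra h' <;> nlinarith
  have s2 : ∀ v, cr d₂ v = 0 → 0 < cr d₁ d₂ → (0 ≤ dt d₂ v ↔ 0 ≤ cr d₁ v) := by
    intro v hv hD
    have := i2 v
    rw [hv, mul_zero, zero_add] at this
    constructor <;> intro h <;> by_contra h' <;> nlinarith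
  have t1 : ∀ v, cr d₁ v = 0 → cr d₁ d₂ < 0 → (0 ≤ dt d₁ v ↔ 0 ≤ cr d₂ v) := by
    intro v hv hD
    have := i1 v
    rw [hv, mul_zero, zero_sub] at this
    constructor <;> intro h <;> by_contra h' <;> nlinarith
  have t2 : ∀ v, cr d₂ v = 0 → cr d₁ d₂ < 0 → (0 ≤ dt d₂ v ↔ cr d₁ v ≤ 0) := by
    intro v hv hD
    have := i2 v
    rw [hv, mul_zero, zero_add] at this
    constructor <;> intro h <;> by_contra h' <;> nlinarith
  rcases lt_trichotomy (cr d₁ d₂) 0 with hD | hD | hD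
  · refine subset_closure_of_corner (d₁ := d₂) (d₂ := d₁) hr (by rw [cr_anti]; linarith)
      (fun y hy => ?_) hx
    rw [hC' y hy, or_comm]
    exact or_congr (and_congr_right fun h => t2 _ h hD) (and_congr_right fun h => t1 _ h hD)
  · refine subset_closure_of_line (d := d₁) hd1 (fun y hy => ?_) hx
    rw [hC' y hy]
    have hneg := hdir hD
    have j1 := i1 (y - p)
    have j3 := i3 (y - p)
    rw [hD, zero_mul, sub_zero] at j1
    rw [hD, zero_mul, add_zero] at j3
    constructor
    · rintro (h | h)
      · exact h.1
      · rw [h.1, mul_zero] at j1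
        exact (mul_eq_zero.1 j1.symm).resolve_left hneg.ne
    · intro h
      rw [h, mul_zero] at j1
      by_cases h0 : 0 ≤ dt d₁ (y - p)
      · exact Or.inl ⟨h, h0⟩
      · refine Or.inr ⟨(mul_eq_zero.1 j1).resolve_left p1.ne', ?_⟩
        by_contra h'
        nlinarith
  · refine subset_closure_of_corner hr hD (fun y hy => ?_) hx
    rw [hC' y hy]
    exact or_congr (and_congr_right fun h => s1 _ h hD) (and_congr_right fun h => s2 _ h hD)

section Polygon
variable {n : ℕ} {P : Polygon Plane n}

theorem edgeSet_eq (P : Polygon Plane n) (i : Fin n) :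
    P.edgeSet ℝ i = segment ℝ (P i) (P (finRotate n i)) :=
  affineSegment_eq_segment _ _ _

theorem mem_boundary_iff {x : Plane} :
    x ∈ P.boundary ℝ ↔ ∃ i, x ∈ segment ℝ (P i) (P (finRotate n i)) := by
  simp only [Polygon.boundary, Set.mem_iUnion, edgeSet_eq]

theorem vertex_mem_boundary (i : Fin n) : P i ∈ P.boundary ℝ :=
  mem_boundary_iff.2 ⟨i, left_mem_segment _ _ _⟩

theorem val_finRotate (i : Fin n) :
    (finRotate n i).val = if i.val + 1 = n then 0 else i.val + 1 := by
  obtain _ | n := n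
  · exact i.elim0
  · rw [coe_finRotate]
    simp [Fin.ext_iff]

theorem finRotate_ne (hn : 3 ≤ n) (i : Fin n) : finRotate n i ≠ i := by
  intro h
  have := congrArg Fin.val h
  rw [val_finRotate] at this
  split_ifs at this <;> omega

theorem finRotate_finRotate_ne (hn : 3 ≤ n) (i : Fin n) : finRotate n (finRotate n i) ≠ i := by
  intro h
  have := congrArg Fin.val h
  rw [val_finRotate, val_finRotate] at this
  split_ifs at this <;> omega

theorem IsSimple.eq_of_mem (hP : IsSimple P) {i j : Fin n} {x : Plane} (hij : i ≠ j)
    (hi : x ∈ segment ℝ (P i) (P (finRotate n i)))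
    (hj : x ∈ segment ℝ (P j) (P (finRotate n j))) :
    (x = P i ∨ x = P (finRotate n i)) ∧ (x = P j ∨ x = P (finRotate n j)) := by
  have := hP.2 i j hij
  rw [edgeSet_eq, edgeSet_eq] at this
  exact this ⟨hi, hj⟩

theorem IsSimple.eq_of_vertex_mem (hP : IsSimple P) {i k : Fin n}
    (h : P k ∈ segment ℝ (P i) (P (finRotate n i))) : k = i ∨ k = finRotate n i := by
  by_cases hki : k = i
  · exact Or.inl hki
  · exact ((hP.eq_of_mem hki (left_mem_segment _ _ _) h).2).imp (fun h => hP.1 h)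
      (fun h => hP.1 h)

/-- Consecutive sides of a simple polygon do not point in the same direction. -/
theorem IsSimple.dt_neg_of_cr_eq_zero (hn : 3 ≤ n) (hP : IsSimple P) (j : Fin n)
    (h0 : cr (P (finRotate n (finRotate n j)) - P (finRotate n j)) (P j - P (finRotate n j)) = 0) :
    dt (P (finRotate n (finRotate n j)) - P (finRotate n j)) (P j - P (finRotate n j)) < 0 := by
  have nj := finRotate_ne hn j
  have nk := finRotate_ne hn (finRotate n j)
  have njk := finRotate_finRotate_ne hn j
  by_contra hpos
  rw [not_lt] at hpos
  -- If both sides pointed the same way, the far end of the shorter would lie on the longer.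
  rcases le_total ‖P j - P (finRotate n j)‖ ‖P (finRotate n (finRotate n j)) - P (finRotate n j)‖
    with hle | hle
  · rcases hP.eq_of_vertex_mem ((mem_segment_near_iff hle).2 ⟨h0, hpos⟩) with h | h
    exacts [nj h.symm, njk h.symm]
  · have h1 := (mem_segment_near_iff hle).2 ⟨by rw [cr_anti, h0, neg_zero], by
      rwa [dt_eq_inner, real_inner_comm, ← dt_eq_inner]⟩
    rw [segment_symm] at h1
    rcases hP.eq_of_vertex_mem h1 with h | h
    exacts [njk h, nk h]

/-- The finitely many sides that miss `p` form a closed set. -/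
theorem exists_ball_disjoint_edges (P : Polygon Plane n) (p : Plane) :
    ∃ r > 0, ∀ y ∈ Metric.ball p r, ∀ i, y ∈ segment ℝ (P i) (P (finRotate n i)) →
      p ∈ segment ℝ (P i) (P (finRotate n i)) := by
  have hcl : IsClosed (⋃ i ∈ {i | p ∉ segment ℝ (P i) (P (finRotate n i))},
      segment ℝ (P i) (P (finRotate n i))) :=
    (Set.toFinite _).isClosed_biUnion fun i _ => isClosed_segment _ _
  obtain ⟨r, hr, hsub⟩ := Metric.isOpen_iff.1 hcl.isOpen_compl p (by simp)
  refine ⟨r, hr, fun y hy i hi => ?_⟩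
  by_contra hp
  exact hsub hy (Set.mem_biUnion (x := i) hp hi)

/-- Near an interior point of a side, the boundary is a straight line. -/
theorem IsSimple.exists_ball_line (hP : IsSimple P) {i : Fin n} {z : Plane}
    (hz : z ∈ segment ℝ (P i) (P (finRotate n i))) (h1 : z ≠ P i) (h2 : z ≠ P (finRotate n i)) :
    ∃ r > 0, ∀ y ∈ Metric.ball z r,
      y ∈ P.boundary ℝ ↔ cr (P (finRotate n i) - P i) (y - z) = 0 := by
  obtain ⟨r, hr, hsub⟩ := exists_ball_disjoint_edges P z
  have n1 := norm_pos_iff.2 (sub_ne_zero.2 h1.symm)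
  have n2 := norm_pos_iff.2 (sub_ne_zero.2 h2.symm)
  refine ⟨min r (min ‖P i - z‖ ‖P (finRotate n i) - z‖), by positivity, fun y hy => ?_⟩
  rw [mem_ball_iff_norm, lt_min_iff, lt_min_iff] at hy
  have hyB : y ∈ P.boundary ℝ ↔ y ∈ segment ℝ (P i) (P (finRotate n i)) := by
    rw [mem_boundary_iff]
    refine ⟨?_, fun h => ⟨i, h⟩⟩
    rintro ⟨j, hj⟩
    by_cases hij : i = j
    · rwa [hij]
    · have := (hP.eq_of_mem hij hz (hsub y (mem_ball_iff_norm.2 hy.1) j hj)).1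
      exact absurd this (not_or.2 ⟨h1, h2⟩)
  rw [hyB]
  generalize P i = a at *
  generalize P (finRotate n i) = b at *
  rw [mem_segment_iff] at hz
  have pa := dt_self_pos (sub_ne_zero.2 h1.symm)
  have pb := dt_self_pos (sub_ne_zero.2 h2.symm)
  constructor
  · intro h
    rw [mem_segment_iff] at h
    obtain ⟨ha, hb⟩ := hz
    have e : cr (b - a) (y - z) = cr (a - y) (b - y) - cr (a - z) (b - z) := by
      simp only [cr, PiLp.sub_apply]
      ring
    rw [e, ha, h.1, sub_zero]
  · intro h
    have hza : z ∈ segment ℝ a b := mem_segment_iff.2 hz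
    have e1 : cr (a - z) (y - z) * dt (b - a) (b - a) =
        cr (b - a) (y - z) * dt (b - a) (a - z) + cr (a - z) (b - z) * dt (y - z) (b - a) := by
      simp only [cr, dt, PiLp.sub_apply]
      ring
    have e2 : cr (b - z) (y - z) * dt (b - a) (b - a) =
        cr (b - a) (y - z) * dt (b - a) (b - z) + cr (a - z) (b - z) * dt (y - z) (b - a) := by
      simp only [cr, dt, PiLp.sub_apply]
      ring
    have hab : b - a ≠ 0 := by
      intro h0
      have hab := sub_eq_zero.1 h0
      rw [hab, segment_same] at hza
      exact h1 hza
    have pab := dt_self_pos hab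
    rw [h, hz.1, zero_mul, zero_mul, add_zero] at e1 e2
    have c1 := (mul_eq_zero.1 e1).resolve_right pab.ne'
    have c2 := (mul_eq_zero.1 e2).resolve_right pab.ne'
    by_cases h0 : 0 ≤ dt (a - z) (y - z)
    · have : y ∈ segment ℝ z a := (mem_segment_near_iff hy.2.1.le).2 ⟨c1, h0⟩
      exact (convex_segment a b).segment_subset hza (left_mem_segment _ _ _) this
    · have e3 : dt (a - z) (a - z) * dt (b - z) (y - z) =
          dt (a - z) (b - z) * dt (a - z) (y - z) + cr (a - z) (b - z) * cr (a - z) (y - z) := by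
        simp only [cr, dt]
        ring
      rw [c1, mul_zero, add_zero] at e3
      have : y ∈ segment ℝ z b := by
        refine (mem_segment_near_iff hy.2.2.le).2 ⟨c2, ?_⟩
        by_contra h'
        nlinarith [hz.2]
      exact (convex_segment a b).segment_subset hza (right_mem_segment _ _ _) this

theorem IsSimple.exists_ball_subset_closure (hn : 3 ≤ n) (hP : IsSimple P) {p : Plane}
    (hp : p ∈ P.boundary ℝ) :
    ∃ r > 0, ∀ x, (Metric.ball p r ∩ connectedComponentIn (P.boundary ℝ)ᶜ x).Nonempty →
      P.boundary ℝ ∩ Metric.ball p r ⊆ closure (connectedComponentIn (P.boundary ℝ)ᶜ x) := by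
  by_cases hv : ∃ k, p = P k
  · obtain ⟨k, rfl⟩ := hv
    obtain ⟨j, rfl⟩ := (finRotate n).surjective k
    obtain ⟨r, hr, hsub⟩ := exists_ball_disjoint_edges P (P (finRotate n j))
    have nj := finRotate_ne hn j
    have nk := finRotate_ne hn (finRotate n j)
    refine PolygonTriangulation.exists_ball_subset_closure hr
      (q₁ := P (finRotate n (finRotate n j))) (q₂ := P j)
      (fun h => nk (hP.1 h)) (fun h => nj (hP.1 h).symm) ?_ ?_
    · exact hP.dt_neg_of_cr_eq_zero hn j
    · intro y hy
      rw [mem_boundary_iff]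
      constructor
      · rintro ⟨i, hi⟩
        rcases hP.eq_of_vertex_mem (hsub y hy i hi) with h | h
        · rw [← h] at hi
          exact Or.inl hi
        · rw [← (finRotate n).injective h] at hi
          rw [segment_symm] at hi
          exact Or.inr hi
      · rintro (h | h)
        · exact ⟨_, h⟩
        · rw [segment_symm] at h
          exact ⟨_, h⟩
  · simp only [not_exists] at hv
    obtain ⟨i, hi⟩ := mem_boundary_iff.1 hp
    obtain ⟨r, hr, hline⟩ := hP.exists_ball_line hi (hv _) (hv _)
    have hd : P (finRotate n i) - P i ≠ 0 :=
      sub_ne_zero.2 fun h => finRotate_ne hn i (hP.1 h)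
    exact ⟨r, hr, fun x hx => subset_closure_of_line hd hline hx⟩

theorem isPreconnected_boundary (P : Polygon Plane n) : IsPreconnected (P.boundary ℝ) := by
  obtain _ | n := n
  · have : P.boundary ℝ = ∅ := by
      ext x
      simp [mem_boundary_iff]
    rw [this]
    exact isPreconnected_empty
  have hit : ∀ k (hk : k < n + 1), ((finRotate (n + 1))^[k]) 0 = ⟨k, hk⟩ := by
    intro k
    induction k with
    | zero => intro _; rfl
    | succ k ih =>
      intro hk
      rw [Function.iterate_succ_apply', ih (by omega)]
      apply Fin.ext
      rw [val_finRotate]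
      simp
      omega
  have h : P.boundary ℝ = ⋃ k : ℕ, P.edgeSet ℝ (((finRotate (n + 1))^[k]) 0) := by
    apply Set.Subset.antisymm
    · refine Set.iUnion_subset fun i => ?_
      refine Set.subset_iUnion_of_subset i.val ?_
      rw [hit i.val i.isLt]
    · exact Set.iUnion_subset fun k => Set.subset_iUnion (fun i => P.edgeSet ℝ i) _
  rw [h]
  refine IsPreconnected.iUnion_of_chain (fun k => ?_) (fun k => ?_)
  · rw [edgeSet_eq]
    exact (convex_segment _ _).isPreconnected
  · refine ⟨P (((finRotate (n + 1))^[k + 1]) 0), ?_, ?_⟩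
    · rw [edgeSet_eq, Function.iterate_succ_apply']
      exact right_mem_segment _ _ _
    · rw [edgeSet_eq, Order.succ_eq_add_one]
      exact left_mem_segment _ _ _

theorem isClosed_boundary (P : Polygon Plane n) : IsClosed (P.boundary ℝ) :=
  isClosed_iUnion_of_finite fun i => by
    rw [edgeSet_eq]
    exact isClosed_segment _ _

/-- Every component of the complement of a simple polygon has the whole polygon in its closure. -/
theorem IsSimple.boundary_subset_closure (hn : 3 ≤ n) (hP : IsSimple P) {x : Plane}
    (hx : x ∉ P.boundary ℝ) :
    P.boundary ℝ ⊆ closure (connectedComponentIn (P.boundary ℝ)ᶜ x) := by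
  set C := P.boundary ℝ with hC
  set U := connectedComponentIn Cᶜ x with hU
  have hUo : IsOpen U := (isClosed_boundary P).isOpen_compl.connectedComponentIn
  have hxU : x ∈ U := mem_connectedComponentIn hx
  -- A component whose closure missed the boundary would be clopen, hence the whole plane.
  have hne : (C ∩ closure U).Nonempty := by
    by_contra hemp
    have hsub : closure U ⊆ U := by
      refine isPreconnected_connectedComponentIn.closure.subset_connectedComponentIn
        (subset_closure hxU) fun y hy hyC => hemp ⟨y, hyC, hy⟩
    have hclopen : IsClopen U := ⟨closure_subset_iff_isClosed.1 hsub, hUo⟩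
    have huniv := (isClopen_iff.1 hclopen).resolve_left (Set.nonempty_iff_ne_empty.1 ⟨x, hxU⟩)
    have h0 : P ⟨0, by omega⟩ ∈ U := huniv ▸ Set.mem_univ _
    exact connectedComponentIn_subset _ _ h0 (vertex_mem_boundary _)
  intro y hy
  by_contra hyU
  have hloc := fun p (hp : p ∈ C) => hP.exists_ball_subset_closure hn hp
  choose! r hr hball using hloc
  obtain ⟨p, hpC, hpU⟩ := hne
  -- The boundary points in `closure U` form a relatively closed set, which is also relatively open
  -- by the local lemma. The boundary is connected, so a point outside `closure U` gives a
  -- contradiction.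
  obtain ⟨q, hqC, hq1, hq2⟩ := isPreconnected_boundary P
    (⋃ p ∈ C ∩ closure U, Metric.ball p (r p)) (closure U)ᶜ
    (isOpen_biUnion fun _ _ => Metric.isOpen_ball) isClosed_closure.isOpen_compl
    (fun z hz => by
      by_cases hzU : z ∈ closure U
      · exact Or.inl (Set.mem_biUnion (x := z) ⟨hz, hzU⟩ (Metric.mem_ball_self (hr z hz)))
      · exact Or.inr hzU)
    ⟨p, hpC, Set.mem_biUnion (x := p) ⟨hpC, hpU⟩ (Metric.mem_ball_self (hr p hpC))⟩ ⟨y, hy, hyU⟩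
  simp only [Set.mem_iUnion] at hq1
  obtain ⟨z, ⟨hzC, hzU⟩, hqz⟩ := hq1
  refine hq2 (hball z hzC x ?_ ⟨hqC, hqz⟩)
  exact mem_closure_iff.1 hzU _ Metric.isOpen_ball (Metric.mem_ball_self (hr z hzC))

end Polygon
end PolygonTriangulation

/-! ### The winding angle inside a simple polygon -/

namespace PolygonTriangulation
open Filter Topology

theorem not_isBounded_ray {y : Plane} (hy : y ≠ 0) :
    ¬ Bornology.IsBounded ((fun t : ℝ => t • y) '' Set.Ici 1) := by
  intro h
  obtain ⟨R, hR⟩ := h.subset_closedBall (0 : Plane)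
  have hpos := norm_pos_iff.2 hy
  have h1 : (max 1 ((|R| + 1) / ‖y‖)) • y ∈ Metric.closedBall (0 : Plane) R :=
    hR ⟨_, Set.mem_Ici.2 (le_max_left _ _), rfl⟩
  rw [mem_closedBall_zero_iff, norm_smul, Real.norm_eq_abs,
    abs_of_nonneg (le_trans zero_le_one (le_max_left _ _))] at h1
  have h2 : (|R| + 1) / ‖y‖ * ‖y‖ ≤ max 1 ((|R| + 1) / ‖y‖) * ‖y‖ :=
    mul_le_mul_of_nonneg_right (le_max_right _ _) hpos.le
  rw [div_mul_cancel₀ _ hpos.ne'] at h2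
  linarith [le_abs_self R]

/-- From a point of large norm the radial ray to infinity avoids `K`. -/
theorem exists_unbounded_component {K : Set Plane} (hK : Bornology.IsBounded K) (R₀ : ℝ) :
    ∃ y ∉ K, R₀ < ‖y‖ ∧ ¬ Bornology.IsBounded (connectedComponentIn Kᶜ y) := by
  obtain ⟨R, hR⟩ := hK.subset_closedBall (0 : Plane)
  set M : ℝ := max (max R R₀) 0 + 1
  have hM : 0 < M := by positivity
  have hRM : R < M := by
    have := (le_max_left R R₀).trans (le_max_left _ (0 : ℝ))
    linarith
  have hR₀M : R₀ < M := by
    have := (le_max_right R R₀).trans (le_max_left _ (0 : ℝ))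
    linarith
  obtain ⟨y, hy⟩ := exists_norm_eq Plane hM.le
  have hy0 : y ≠ 0 := by
    rintro rfl
    simp at hy
    linarith
  have hout : ∀ z ∈ (fun t : ℝ => t • y) '' Set.Ici 1, z ∉ K := by
    rintro _ ⟨t, ht, rfl⟩ hz
    have h1 := hR hz
    rw [mem_closedBall_zero_iff, norm_smul, Real.norm_eq_abs, hy] at h1
    have h2 : 1 ≤ |t| := le_trans ht (le_abs_self t)
    nlinarith
  have hmem : y ∈ (fun t : ℝ => t • y) '' Set.Ici 1 := ⟨1, Set.self_mem_Ici, one_smul _ _⟩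
  refine ⟨y, hout y hmem, hy.symm ▸ hR₀M, fun hb => not_isBounded_ray hy0 (hb.subset ?_)⟩
  refine IsPreconnected.subset_connectedComponentIn ?_ hmem hout
  exact (convex_Ici _).isPreconnected.image _ (by fun_prop)

section Polygon
variable {n : ℕ} {P : Polygon Plane n}

/-- The directed sides of a polygon. -/
def polyEdges (P : Polygon Plane n) : Multiset (Plane × Plane) :=
  (Finset.univ : Finset (Fin n)).val.map fun i => (P i, P (finRotate n i))

theorem trace_polyEdges (P : Polygon Plane n) : trace (polyEdges P) = P.boundary ℝ := by
  ext x
  rw [mem_boundary_iff]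
  simp [trace, polyEdges]

theorem balanced_polyEdges (P : Polygon Plane n) : Balanced (polyEdges P) := by
  unfold Balanced polyEdges
  rw [Multiset.map_map, Multiset.map_map]
  have h := Multiset.map_univ_val_equiv (finRotate n)
  calc _ = Multiset.map (fun i => P i) Finset.univ.val := rfl
    _ = Multiset.map (fun i => P i) (Multiset.map (finRotate n) Finset.univ.val) := by rw [h]
    _ = _ := by rw [Multiset.map_map]; rfl

theorem wind_polyEdges (P : Polygon Plane n) (x : Plane) :
    wind (polyEdges P) x = ∑ i, ang x (P i) (P (finRotate n i)) := by
  rw [wind, polyEdges, Multiset.map_map]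
  rfl

theorem isBounded_boundary (P : Polygon Plane n) : Bornology.IsBounded (P.boundary ℝ) := by
  unfold Polygon.boundary
  rw [Bornology.isBounded_iUnion]
  intro i
  rw [edgeSet_eq, ← convexHull_pair]
  exact isBounded_convexHull.2 (Set.toFinite _).isBounded

/-- At its midpoint a segment is seen under a straight angle, whose sign depends on the side of
approach: this is the jump of `arg` across its branch cut. -/
theorem tendsto_ang_midpoint {a b : Plane} (hab : a ≠ b) :
    Tendsto (fun t : ℝ => ang (midpoint ℝ a b + t • rot (b - a)) a b) (𝓝[>] 0) (𝓝 Real.pi) ∧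
    Tendsto (fun t : ℝ => ang (midpoint ℝ a b + t • -rot (b - a)) a b) (𝓝[>] 0)
      (𝓝 (-Real.pi)) := by
  have hd : 0 < dt (b - a) (b - a) := dt_self_pos (sub_ne_zero.2 hab.symm)
  set D := dt (b - a) (b - a) with hD
  have hmid0 : (midpoint ℝ a b) 0 = (a 0 + b 0) / 2 := by
    simp [midpoint_eq_smul_add]
    ring
  have hmid1 : (midpoint ℝ a b) 1 = (a 1 + b 1) / 2 := by
    simp [midpoint_eq_smul_add]
    ring
  have e1 : ∀ t : ℝ, (⟨dt (a - (midpoint ℝ a b + t • rot (b - a)))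
      (b - (midpoint ℝ a b + t • rot (b - a))),
      cr (a - (midpoint ℝ a b + t • rot (b - a))) (b - (midpoint ℝ a b + t • rot (b - a)))⟩ : ℂ) =
      ⟨(t ^ 2 - 1 / 4) * D, t * D⟩ := by
    intro t
    apply Complex.ext
    · simp only [dt, hD, PiLp.sub_apply, PiLp.add_apply, PiLp.smul_apply, smul_eq_mul, hmid0, hmid1,
        rot, Matrix.cons_val_zero, Matrix.cons_val_one]
      ring
    · simp only [cr, dt, hD, PiLp.sub_apply, PiLp.add_apply, PiLp.smul_apply, smul_eq_mul, hmid0,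
        hmid1, rot, Matrix.cons_val_zero, Matrix.cons_val_one]
      ring
  have hcont : Continuous fun t : ℝ => (⟨(t ^ 2 - 1 / 4) * D, t * D⟩ : ℂ) := by
    have : (fun t : ℝ => (⟨(t ^ 2 - 1 / 4) * D, t * D⟩ : ℂ)) =
        fun t : ℝ => (((t ^ 2 - 1 / 4) * D : ℝ) : ℂ) + ((t * D : ℝ) : ℂ) * Complex.I := by
      ext t
      exact Complex.mk_eq_add_mul_I _ _
    rw [this]
    fun_prop
  have h0re : ((⟨(0 ^ 2 - 1 / 4) * D, 0 * D⟩ : ℂ)).re < 0 := by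
    simp only
    linarith
  have h0im : ((⟨(0 ^ 2 - 1 / 4) * D, 0 * D⟩ : ℂ)).im = 0 := by simp
  constructor
  · refine (Complex.tendsto_arg_nhdsWithin_im_nonneg_of_re_neg_of_im_zero h0re h0im).comp
      (f := fun t : ℝ => _) (tendsto_nhdsWithin_iff.2 ⟨?_, ?_⟩)
    · simp only [e1]
      exact (hcont.tendsto 0).mono_left nhdsWithin_le_nhds
    · filter_upwards [self_mem_nhdsWithin] with t ht
      have h3 := congrArg Complex.im (e1 t)
      simp only at h3
      rw [h3]
      exact mul_nonneg (le_of_lt ht) hd.le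
  · refine (Complex.tendsto_arg_nhdsWithin_im_neg_of_re_neg_of_im_zero h0re h0im).comp
      (f := fun t : ℝ => _) (tendsto_nhdsWithin_iff.2 ⟨?_, ?_⟩)
    · have e2 : ∀ t : ℝ, t • -rot (b - a) = (-t) • rot (b - a) := by
        intro t
        rw [smul_neg, neg_smul]
      simp only [e2, e1]
      have h3 := (hcont.comp continuous_neg).tendsto 0
      simp only [Function.comp_def, neg_zero] at h3
      exact h3.mono_left nhdsWithin_le_nhds
    · filter_upwards [self_mem_nhdsWithin] with t ht
      have h3 := congrArg Complex.im (e1 (-t))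
      simp only at h3
      rw [smul_neg, ← neg_smul, h3]
      have ht' : (0 : ℝ) < t := ht
      have := mul_pos ht' hd
      linarith

/-- The winding number of a simple polygon does not vanish in its interior. -/
theorem IsSimple.wind_ne_zero (hn : 3 ≤ n) (hP : IsSimple P) {x : Plane} (hx : x ∈ inside P) :
    wind (polyEdges P) x ≠ 0 := by
  intro hw
  obtain ⟨hxC, hxb⟩ := hx
  obtain ⟨R, hR⟩ := exists_wind_eq_zero_of_lt_norm (balanced_polyEdges P)
  obtain ⟨R', hR'⟩ := hxb.subset_closedBall (0 : Plane)
  obtain ⟨y, hyC, hyR, -⟩ := exists_unbounded_component (isBounded_boundary P) (max R R')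
  have hyw := hR y ((le_max_left _ _).trans_lt hyR)
  have hyU : y ∉ connectedComponentIn (P.boundary ℝ)ᶜ x := fun h =>
    absurd (mem_closedBall_zero_iff.1 (hR' h)) (not_le.2 ((le_max_right _ _).trans_lt hyR))
  have hdisj : ∀ z, z ∈ connectedComponentIn (P.boundary ℝ)ᶜ x →
      z ∈ connectedComponentIn (P.boundary ℝ)ᶜ y → False := by
    intro z h1 h2
    apply hyU
    rw [connectedComponentIn_eq h1, ← connectedComponentIn_eq h2]
    exact mem_connectedComponentIn hyC
  have hzero : ∀ {x}, x ∉ P.boundary ℝ → wind (polyEdges P) x = 0 →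
      ∀ z ∈ connectedComponentIn (P.boundary ℝ)ᶜ x, wind (polyEdges P) z = 0 := by
    intro x hx h z hz
    rw [← h]
    refine wind_eq_of_isPreconnected (balanced_polyEdges P)
      isPreconnected_connectedComponentIn (fun w hw => ?_) hz (mem_connectedComponentIn hx)
    rw [trace_polyEdges]
    exact connectedComponentIn_subset _ _ hw
  -- If the winding vanished on the component of `x`, it would vanish on two different components,
  -- the other being that of the far point `y`. Both reach the midpoint of any side; side `0` is
  -- chosen.
  set i : Fin n := ⟨0, by omega⟩
  have hab : P i ≠ P (finRotate n i) := fun h => finRotate_ne hn i (hP.1 h).symm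
  set a := P i with ha
  set b := P (finRotate n i) with hb
  set z := midpoint ℝ a b with hz
  have hzseg : z ∈ segment ℝ a b := midpoint_mem_segment a b
  have hza : z ≠ a := by simpa [hz] using hab
  have hzb : z ≠ b := by simpa [hz] using hab
  obtain ⟨r, hr, hline⟩ := hP.exists_ball_line hzseg hza hzb
  have hzB : z ∈ Metric.ball z r := Metric.mem_ball_self hr
  have hnear : ∀ x ∉ P.boundary ℝ,
      (Metric.ball z r ∩ connectedComponentIn (P.boundary ℝ)ᶜ x).Nonempty := by
    intro x hx
    exact mem_closure_iff.1 (hP.boundary_subset_closure hn hx (mem_boundary_iff.2 ⟨i, hzseg⟩)) _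
      Metric.isOpen_ball hzB
  have hrot : 0 < cr (b - a) (rot (b - a)) := cr_rot_pos (sub_ne_zero.2 hab.symm)
  have hcr0 : cr (b - a) (z - z) = 0 := by simp [cr]
  have hne : ∀ s : Plane, (∃ t : ℝ, 0 < t ∧ z + t • s ∈ Metric.ball z r) := by
    intro s
    obtain ⟨t, h1, h2⟩ := (((tendsto_add_smul z s).eventually
      (Metric.isOpen_ball.mem_nhds hzB)).and (self_mem_nhdsWithin (s := Set.Ioi (0 : ℝ)))).exists
    exact ⟨t, h2, h1⟩
  have hpos : ∀ t : ℝ, 0 < t → 0 < cr (b - a) (z + t • rot (b - a) - z) := by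
    intro t ht
    rw [cr_add_smul_right, hcr0]
    positivity
  have hneg : ∀ t : ℝ, 0 < t → cr (b - a) (z + t • -rot (b - a) - z) < 0 := by
    intro t ht
    rw [smul_neg, ← neg_smul, cr_add_smul_right, hcr0]
    nlinarith
  -- Each component contains a half disc at `z`, and disjointness forces different ones.
  have hboth : (∀ w ∈ Metric.ball z r, 0 < cr (b - a) (w - z) → wind (polyEdges P) w = 0) ∧
      (∀ w ∈ Metric.ball z r, cr (b - a) (w - z) < 0 → wind (polyEdges P) w = 0) := by
    obtain ⟨t1, ht1, ht1B⟩ := hne (rot (b - a))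
    obtain ⟨t2, ht2, ht2B⟩ := hne (-rot (b - a))
    rcases half_disc_subset hline (hnear x hxC) with h1 | h1 <;>
      rcases half_disc_subset hline (hnear y hyC) with h2 | h2
    · exact (hdisj _ (h1 ⟨ht1B, hpos t1 ht1⟩) (h2 ⟨ht1B, hpos t1 ht1⟩)).elim
    · exact ⟨fun w hwB hw' => hzero hxC hw w (h1 ⟨hwB, hw'⟩),
        fun w hwB hw' => hzero hyC hyw w (h2 ⟨hwB, hw'⟩)⟩
    · exact ⟨fun w hwB hw' => hzero hyC hyw w (h2 ⟨hwB, hw'⟩),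
        fun w hwB hw' => hzero hxC hw w (h1 ⟨hwB, hw'⟩)⟩
    · exact (hdisj _ (h1 ⟨ht2B, hneg t2 ht2⟩) (h2 ⟨ht2B, hneg t2 ht2⟩)).elim
  -- The other sides contribute continuously at `z`. Approaching from both sides yields `π + rest z
  -- = 0` and `-π + rest z = 0`.
  set rest : Plane → ℝ := fun y => ∑ j ∈ Finset.univ.erase i, ang y (P j) (P (finRotate n j))
    with hrest
  have hsplit : ∀ y, wind (polyEdges P) y = ang y a b + rest y := by
    intro y
    rw [wind_polyEdges]
    exact (Finset.add_sum_erase _ _ (Finset.mem_univ i)).symm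
  have hrestcont : ContinuousAt rest z := by
    refine tendsto_finsetSum _ fun j hj => continuousAt_ang fun hzj => ?_
    have := (hP.eq_of_mem (Finset.ne_of_mem_erase hj).symm hzseg hzj).1
    exact absurd this (not_or.2 ⟨hza, hzb⟩)
  have hlim : ∀ (s : Plane) (l : ℝ),
      Tendsto (fun t : ℝ => ang (z + t • s) a b) (𝓝[>] 0) (𝓝 l) →
      (∀ t : ℝ, 0 < t → z + t • s ∈ Metric.ball z r → wind (polyEdges P) (z + t • s) = 0) →
      l + rest z = 0 := by
    intro s l hl hs
    have h1 := hl.add (hrestcont.tendsto.comp (tendsto_add_smul z s))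
    refine tendsto_nhds_unique (h1.congr' ?_) tendsto_const_nhds
    filter_upwards [(tendsto_add_smul z s).eventually (Metric.isOpen_ball.mem_nhds hzB),
      self_mem_nhdsWithin] with t h2 h3
    rw [Function.comp_apply, ← hsplit]
    exact hs t h3 h2
  obtain ⟨l1, l2⟩ := tendsto_ang_midpoint hab
  have r1 := hlim _ _ l1 fun t ht htB => hboth.1 _ htB (hpos t ht)
  have r2 := hlim _ _ l2 fun t ht htB => hboth.2 _ htB (hneg t ht)
  have := Real.pi_pos
  linarith

/-- Every boundary point of a simple polygon is a limit of points outside the polygon. -/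
theorem IsSimple.exists_notMem_region (hn : 3 ≤ n) (hP : IsSimple P) :
    ∃ y ∉ region P, ¬ Bornology.IsBounded (connectedComponentIn (P.boundary ℝ)ᶜ y) ∧
      P.boundary ℝ ⊆ closure (connectedComponentIn (P.boundary ℝ)ᶜ y) ∧
      connectedComponentIn (P.boundary ℝ)ᶜ y ⊆ (region P)ᶜ := by
  obtain ⟨y, hyC, -, hyb⟩ := exists_unbounded_component (isBounded_boundary P) 0
  have h : connectedComponentIn (P.boundary ℝ)ᶜ y ⊆ (region P)ᶜ := by
    rintro z hz (h | h)
    · exact connectedComponentIn_subset _ _ hz h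
    · rw [connectedComponentIn_eq hz] at hyb
      exact hyb h.2
  exact ⟨y, h (mem_connectedComponentIn hyC), hyb, hP.boundary_subset_closure hn hyC, h⟩

end Polygon
end PolygonTriangulation

/-! ### Crossing-free graphs inside a polygon -/

namespace PolygonTriangulation
open Filter Topology

section Collinear

theorem exists_param_of_mem_segment {a b z : Plane} (h : z ∈ segment ℝ a b) (ha : z ≠ a)
    (hb : z ≠ b) : ∃ s t : ℝ, 0 < s ∧ 0 < t ∧ a = z - s • (b - a) ∧ b = z + t • (b - a) := by
  obtain ⟨u, v, hu, hv, huv, rfl⟩ := h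
  obtain rfl : u = 1 - v := by linarith
  refine ⟨v, 1 - v, ?_, ?_, ?_, ?_⟩
  · refine lt_of_le_of_ne hv fun h => ha ?_
    simp [← h]
  · refine lt_of_le_of_ne hu fun h => hb ?_
    rw [← h, zero_smul, zero_add, show v = 1 by linarith, one_smul]
  · module
  · module

theorem param_mem_segment (z e : Plane) {r s t : ℝ} (h1 : r ≤ s) (h2 : s ≤ t) :
    z + s • e ∈ segment ℝ (z + r • e) (z + t • e) := by
  rcases (h1.trans h2).eq_or_lt with h | h
  · obtain rfl : s = r := by linarith
    exact left_mem_segment _ _ _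
  · refine ⟨(t - s) / (t - r), (s - r) / (t - r), div_nonneg (by linarith) (by linarith),
      div_nonneg (by linarith) (by linarith), ?_, ?_⟩
    · rw [← add_div, div_eq_one_iff_eq (by linarith)]
      ring
    · have h0 : t - r ≠ 0 := by linarith
      have e1 : (t - s) / (t - r) = 1 - (s - r) / (t - r) := by
        field_simp
        ring
      have e2 : s = r + (s - r) / (t - r) * (t - r) := by
        field_simp
        ring
      rw [e1]
      nth_rewrite 3 [e2]
      module

theorem param_injective {z e : Plane} (he : e ≠ 0) {s t : ℝ} (h : z + s • e = z + t • e) :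
    s = t := smul_left_injective ℝ he (add_left_cancel h)

/-- Two collinear segments with a common interior point, neither of which has an end inside the
other, have the same ends. -/
theorem ends_eq_of_collinear {a b c d z : Plane} (h1 : z ∈ segment ℝ a b)
    (h2 : z ∈ segment ℝ c d) (za : z ≠ a) (zb : z ≠ b) (zc : z ≠ c) (zd : z ≠ d)
    (hcr : cr (b - a) (d - c) = 0) (ha : a ∈ segment ℝ c d → a = c ∨ a = d)
    (hb : b ∈ segment ℝ c d → b = c ∨ b = d) (hc : c ∈ segment ℝ a b → c = a ∨ c = b)
    (hd : d ∈ segment ℝ a b → d = a ∨ d = b) : (a = c ∧ b = d) ∨ (a = d ∧ b = c) := by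
  obtain ⟨s, t, hs, ht, hsa, htb⟩ := exists_param_of_mem_segment h1 za zb
  obtain ⟨u, v, hu, hv, huc, hvd⟩ := exists_param_of_mem_segment h2 zc zd
  have he : b - a ≠ 0 := by
    intro h0
    rw [h0, smul_zero, sub_zero] at hsa
    exact za hsa.symm
  have hf : d - c ≠ 0 := by
    intro h0
    rw [h0, smul_zero, sub_zero] at huc
    exact zc huc.symm
  obtain ⟨l, hl⟩ : ∃ l : ℝ, d - c = l • (b - a) := by
    have hp := dt_self_pos he
    refine ⟨dt (b - a) (d - c) / dt (b - a) (b - a), ?_⟩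
    generalize b - a = e at *
    generalize d - c = f at *
    apply plane_ext <;> rw [PiLp.smul_apply, smul_eq_mul, div_mul_eq_mul_div, eq_div_iff hp.ne'] <;>
      simp only [dt, cr] at hcr ⊢
    · linear_combination (-e 1) * hcr
    · linear_combination (e 0) * hcr
  have hl0 : l ≠ 0 := by
    rintro rfl
    rw [zero_smul] at hl
    exact hf hl
  rw [hl, smul_smul] at huc hvd
  set e := b - a
  have hsa' : a = z + (-s) • e := by
    rw [hsa]
    module
  have huc' : c = z + (-(u * l)) • e := by
    rw [huc]
    module
  clear_value e
  rw [sub_eq_add_neg, ← neg_smul] at hsa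
  -- With `z` as origin of the line, compare the two ends on the same side of `z`: if they differ,
  -- the nearer one lies inside the other segment. The sign of `l` decides which ends share a side.
  have key : ∀ {c d : Plane} {γ δ : ℝ}, 0 < γ → 0 < δ → c = z + (-γ) • e → d = z + δ • e →
      (a ∈ segment ℝ c d → a = c ∨ a = d) → (b ∈ segment ℝ c d → b = c ∨ b = d) →
      (c ∈ segment ℝ a b → c = a ∨ c = b) → (d ∈ segment ℝ a b → d = a ∨ d = b) →
      a = c ∧ b = d := by
    intro c d γ δ hγ hδ hc' hd' ha hb hc hd
    constructor
    · rcases lt_trichotomy s γ with h | h | h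
      · have := ha (by rw [hsa', hc', hd']; exact param_mem_segment z e (by linarith) (by linarith))
        rw [hsa', hc', hd'] at this
        rcases this with h' | h' <;> linarith [param_injective he h']
      · rw [hsa', hc', h]
      · have := hc (by rw [hsa', hc', htb]; exact param_mem_segment z e (by linarith) (by linarith))
        rw [hsa', hc', htb] at this
        rcases this with h' | h' <;> linarith [param_injective he h']
    · rcases lt_trichotomy t δ with h | h | h
      · have := hb (by rw [htb, hc', hd']; exact param_mem_segment z e (by linarith) (by linarith))
        rw [htb, hc', hd'] at this
        rcases this with h' | h' <;> linarith [param_injective he h']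
      · rw [htb, hd', h]
      · have := hd (by rw [hsa', hd', htb]; exact param_mem_segment z e (by linarith) (by linarith))
        rw [hsa', hd', htb] at this
        rcases this with h' | h' <;> linarith [param_injective he h']
  rcases lt_or_gt_of_ne hl0 with hl | hl
  · right
    refine key (c := d) (d := c) (γ := -(v * l)) (δ := -(u * l)) (by nlinarith) (by nlinarith)
      (by rw [neg_neg]; exact hvd) huc' ?_ ?_ hd hc
    · rw [segment_symm]
      exact fun h => (ha h).symm
    · rw [segment_symm]
      exact fun h => (hb h).symm
  · left
    exact key (γ := u * l) (δ := v * l) (by positivity) (by positivity) huc' hvd ha hb hc hd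

end Collinear

section Graph
variable {n : ℕ} {P : Polygon Plane n} {T : SimpleGraph (Fin n)}

/-- A bounded component of the complement of a closed subset of the polygon contains no boundary
point of the polygon and lies in the polygon. -/
theorem IsSimple.insideSet_subset (hn : 3 ≤ n) (hP : IsSimple P) {K : Set Plane} (hK : IsClosed K)
    (hKP : K ⊆ region P) : insideSet K ⊆ region P \ P.boundary ℝ := by
  rintro z ⟨hzK, hzb⟩
  -- A component outside the polygon avoids `K`, so if it meets the bounded component of `z` it is
  -- contained in it.
  have hout : ∀ {v y : Plane}, v ∈ connectedComponentIn (P.boundary ℝ)ᶜ y →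
      connectedComponentIn (P.boundary ℝ)ᶜ y ⊆ (region P)ᶜ →
      v ∈ connectedComponentIn Kᶜ z → Bornology.IsBounded (connectedComponentIn (P.boundary ℝ)ᶜ y) := by
    intro v y hv hy hvz
    rw [connectedComponentIn_eq hvz] at hzb
    exact hzb.subset (isPreconnected_connectedComponentIn.subset_connectedComponentIn hv
      fun w hw hwK => hy hw (hKP hwK))
  have hnb : z ∉ P.boundary ℝ := by
    intro hz
    obtain ⟨y, -, hyb, hyc, hyr⟩ := hP.exists_notMem_region hn
    obtain ⟨v, hv1, hv2⟩ := mem_closure_iff.1 (hyc hz) _ (hK.isOpen_compl.connectedComponentIn)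
      (mem_connectedComponentIn hzK)
    exact hyb (hout hv2 hyr hv1)
  refine ⟨?_, hnb⟩
  by_contra hzr
  have hzb' : ¬ Bornology.IsBounded (connectedComponentIn (P.boundary ℝ)ᶜ z) := fun h =>
    hzr (Or.inr ⟨hnb, h⟩)
  refine hzb' (hout (mem_connectedComponentIn hnb) ?_ (mem_connectedComponentIn hzK))
  rintro w hw (h | h)
  · exact connectedComponentIn_subset _ _ hw h
  · rw [connectedComponentIn_eq hw] at hzb'
    exact hzb' h.2

/-- A family of directed edges of the drawing. -/
def IsDrawn (P : Polygon Plane n) (T : SimpleGraph (Fin n)) (E : Multiset (Plane × Plane)) : Prop :=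
  ∀ e ∈ E, ∃ a b, T.Adj a b ∧ e = (P a, P b)

theorem IsDrawn.trace_subset (hC : IsCrossingFreeIn P T) {E : Multiset (Plane × Plane)}
    (hE : IsDrawn P T E) : trace E ⊆ region P := by
  rintro x ⟨e, he, hx⟩
  obtain ⟨a, b, hab, rfl⟩ := hE e he
  exact hC.edge_subset a b hab hx

theorem IsDrawn.trace_subset_drawing {E : Multiset (Plane × Plane)}
    (hE : IsDrawn P T E) : trace E ⊆ drawing P T := by
  rintro x ⟨e, he, hx⟩
  obtain ⟨a, b, hab, rfl⟩ := hE e he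
  exact Or.inr ⟨a, b, hab, hx⟩

theorem IsDrawn.add {E F : Multiset (Plane × Plane)} (hE : IsDrawn P T E) (hF : IsDrawn P T F) :
    IsDrawn P T (E + F) := fun e he => (Multiset.mem_add.1 he).elim (hE e) (hF e)

/-- If an edge of the drawing meets a bounded component of the complement of a family of edges,
then its ends are vertices of that family. -/
theorem IsDrawn.exists_end_eq (hn : 3 ≤ n) (hP : IsSimple P) (hC : IsCrossingFreeIn P T)
    {E : Multiset (Plane × Plane)} (hE : IsDrawn P T E) {z : Plane} (hz : z ∈ insideSet (trace E))
    {x y : Fin n} (hxy : T.Adj x y) (hzxy : z ∈ segment ℝ (P x) (P y)) :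
    ∃ e ∈ E, P x = e.1 ∨ P x = e.2 := by
  have hsub := hP.insideSet_subset hn (isClosed_trace E) (hE.trace_subset hC)
  -- On the way from `z` to the end `P x` the family must be met: otherwise the vertex `P x` would
  -- lie in a bounded component, and these contain no boundary point.
  obtain ⟨w, hw, hwK⟩ : (segment ℝ z (P x) ∩ trace E).Nonempty := by
    by_contra hemp
    have h1 : segment ℝ z (P x) ⊆ connectedComponentIn (trace E)ᶜ z :=
      (convex_segment _ _).isPreconnected.subset_connectedComponentIn (left_mem_segment _ _ _)
        fun w hw hwK => hemp ⟨w, hw, hwK⟩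
    have h2 := h1 (right_mem_segment _ _ _)
    refine (hsub (show P x ∈ insideSet (trace E) from ⟨connectedComponentIn_subset _ _ h2, ?_⟩)).2
      (vertex_mem_boundary x)
    rw [← connectedComponentIn_eq h2]
    exact hz.2
  obtain ⟨e, he, hwe⟩ := hwK
  obtain ⟨c, d, hcd, rfl⟩ := hE e he
  have hne : s(x, y) ≠ s(c, d) := by
    intro h
    rw [Sym2.eq_iff] at h
    apply hz.1
    refine ⟨_, he, ?_⟩
    rcases h with ⟨rfl, rfl⟩ | ⟨rfl, rfl⟩
    · exact hzxy
    · rwa [segment_symm]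
  have hwxy : w ∈ segment ℝ (P x) (P y) :=
    (convex_segment _ _).segment_subset hzxy (left_mem_segment _ _ _) hw
  obtain ⟨h1, h2⟩ := hC.inter_subset x y c d hxy hcd hne ⟨hwxy, hwe⟩
  rcases h1 with h1 | h1
  · exact ⟨_, he, h1 ▸ h2⟩
  · rw [Set.mem_singleton_iff] at h1
    -- If the meeting point is the other end `P y`, then `P y` lies between `z` and `P x` while `z`
    -- lies between `P x` and `P y`, which forces `z = P y`.
    have hzy : z = w := by
      rw [h1] at hw ⊢
      rw [mem_segment_iff] at hw hzxy
      by_contra hne'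
      have p1 := dt_self_pos (sub_ne_zero.2 hne')
      obtain ⟨u, v, hu, hv, huv, hz'⟩ := mem_segment_iff.2 hzxy
      obtain rfl : u = 1 - v := by linarith
      obtain ⟨p, q, hp, hq, hpq, hy'⟩ := mem_segment_iff.2 hw
      obtain rfl : p = 1 - q := by linarith
      have h3 : P x - P y = (q * (1 - v) + (1 - q) * (1 - v) + v) • (P x - P y) := by
        rw [show q * (1 - v) + (1 - q) * (1 - v) + v = 1 by ring, one_smul]
      have h4 : (q + (1 - q) * (1 - v)) • (P x - P y) = 0 := by
        have : (1 - q) • ((1 - v) • P x + v • P y) + q • P x - P y =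
            (q + (1 - q) * (1 - v)) • (P x - P y) := by module
        rw [← this, hz', hy', sub_self]
      rcases smul_eq_zero.1 h4 with h5 | h5
      · have hq0 : q = 0 := by nlinarith
        rw [hq0] at hy'
        simp at hy'
        exact hne' hy'
      · rw [sub_eq_zero] at h5
        exact hxy.ne (hP.1 h5)
    exact absurd (show z ∈ trace E from ⟨_, he, hzy ▸ hwe⟩) hz.1

/-- A segment that can be added to a triangulation belongs to it. -/
theorem IsTriangulation.adj_of_addable (hT : IsTriangulation P T) {s t : Fin n} (hst : s ≠ t)
    (hreg : segment ℝ (P s) (P t) ⊆ region P)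
    (hvert : ∀ c, P c ∈ segment ℝ (P s) (P t) → c = s ∨ c = t)
    (hcross : ∀ c d, T.Adj c d → s(s, t) ≠ s(c, d) →
      segment ℝ (P s) (P t) ∩ segment ℝ (P c) (P d) ⊆ ({P s, P t} ∩ {P c, P d} : Set Plane)) :
    T.Adj s t := by
  have hC := hT.prop
  have hadj : ∀ {a b}, (T ⊔ SimpleGraph.edge s t).Adj a b →
      T.Adj a b ∨ (a = s ∧ b = t) ∨ (a = t ∧ b = s) := by
    intro a b h
    rw [SimpleGraph.sup_adj, SimpleGraph.edge_adj] at h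
    tauto
  have hcross' : ∀ a b c d, T.Adj c d → s(a, b) ≠ s(c, d) → (a = s ∧ b = t) ∨ (a = t ∧ b = s) →
      segment ℝ (P a) (P b) ∩ segment ℝ (P c) (P d) ⊆ ({P a, P b} ∩ {P c, P d} : Set Plane) := by
    rintro a b c d hcd hne (⟨rfl, rfl⟩ | ⟨rfl, rfl⟩)
    · exact hcross c d hcd hne
    · rw [segment_symm, Set.pair_comm (P a)]
      exact hcross c d hcd (by rwa [Sym2.eq_swap])
  have hnew : IsCrossingFreeIn P (T ⊔ SimpleGraph.edge s t) := by
    constructor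
    · intro a b hab
      rcases hadj hab with h | ⟨rfl, rfl⟩ | ⟨rfl, rfl⟩
      · exact hC.edge_subset a b h
      · exact hreg
      · rwa [segment_symm]
    · intro a b c hab hc
      rcases hadj hab with h | ⟨rfl, rfl⟩ | ⟨rfl, rfl⟩
      · exact hC.vertex_mem a b c h hc
      · exact hvert c hc
      · rw [segment_symm] at hc
        exact (hvert c hc).symm
    · intro a b c d hab hcd hne
      rcases hadj hab with h1 | h1 <;> rcases hadj hcd with h2 | h2
      · exact hC.inter_subset a b c d h1 h2 hne
      · rw [Set.inter_comm, Set.inter_comm {P a, P b}]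
        exact hcross' c d a b h1 hne.symm h2
      · exact hcross' a b c d h2 hne h1
      · exfalso
        apply hne
        rw [Sym2.eq_iff]
        rcases h1 with ⟨rfl, rfl⟩ | ⟨rfl, rfl⟩ <;> rcases h2 with ⟨rfl, rfl⟩ | ⟨rfl, rfl⟩ <;> simp
  have hle := hT.le_of_ge hnew le_sup_left
  apply hle
  rw [SimpleGraph.sup_adj, SimpleGraph.edge_adj]
  exact Or.inr ⟨Or.inl ⟨rfl, rfl⟩, hst⟩

/-- The sides of the polygon belong to every triangulation. -/
theorem IsTriangulation.adj_finRotate (hn : 3 ≤ n) (hP : IsSimple P) (hT : IsTriangulation P T)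
    (i : Fin n) : T.Adj i (finRotate n i) := by
  have hC := hT.prop
  refine hT.adj_of_addable (finRotate_ne hn i).symm
    (fun x hx => Or.inl (mem_boundary_iff.2 ⟨i, hx⟩)) (fun c hc => hP.eq_of_vertex_mem hc) ?_
  rintro c d hcd hne z ⟨hz1, hz2⟩
  by_cases zc : z = P c
  · rcases hP.eq_of_vertex_mem (zc ▸ hz1) with h | h <;> simp [zc, h]
  by_cases zd : z = P d
  · rcases hP.eq_of_vertex_mem (zd ▸ hz1) with h | h <;> simp [zd, h]
  by_cases za : z = P i
  · rcases hC.vertex_mem c d i hcd (za ▸ hz2) with h | h <;> simp [za, h]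
  by_cases zb : z = P (finRotate n i)
  · rcases hC.vertex_mem c d _ hcd (zb ▸ hz2) with h | h <;> simp [zb, h]
  exfalso
  -- A collinear edge through an interior point of the side is the side itself. A transversal edge
  -- has points near `z` in both half discs, one of which lies outside the polygon.
  by_cases hcr : cr (P (finRotate n i) - P i) (P d - P c) = 0
  · apply hne
    rw [Sym2.eq_iff]
    rcases ends_eq_of_collinear hz1 hz2 za zb zc zd hcr
      (fun h => (hC.vertex_mem c d _ hcd h).imp (congrArg _) (congrArg _))
      (fun h => (hC.vertex_mem c d _ hcd h).imp (congrArg _) (congrArg _))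
      (fun h => (hP.eq_of_vertex_mem h).imp (congrArg _) (congrArg _))
      (fun h => (hP.eq_of_vertex_mem h).imp (congrArg _) (congrArg _)) with h | h
    · exact Or.inl ⟨hP.1 h.1, hP.1 h.2⟩
    · exact Or.inr ⟨hP.1 h.1, hP.1 h.2⟩
  · obtain ⟨r, hr, hline⟩ := hP.exists_ball_line hz1 za zb
    obtain ⟨y, -, -, hyc, hyr⟩ := hP.exists_notMem_region hn
    obtain ⟨s, t, hs, ht, hsc, htd⟩ := exists_param_of_mem_segment hz2 zc zd
    have hnear := mem_closure_iff.1 (hyc (mem_boundary_iff.2 ⟨i, hz1⟩)) _ Metric.isOpen_ball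
      (Metric.mem_ball_self (x := z) hr)
    set e := P (finRotate n i) - P i
    set f := P d - P c
    have hpt : ∀ v : Plane, (∃ l : ℝ, 0 < l ∧ segment ℝ z (z + l • v) ⊆ segment ℝ (P c) (P d)) →
        ∃ w ∈ Metric.ball z r, w ∈ region P ∧ ∃ l : ℝ, 0 < l ∧ w = z + l • v := by
      rintro v ⟨l, hl, hsub⟩
      obtain ⟨k, ⟨h1, h2⟩, h3⟩ := (((tendsto_add_smul z v).eventually (Metric.isOpen_ball.mem_nhds
        (Metric.mem_ball_self (x := z) hr))).and (Ioo_mem_nhdsGT hl)).exists.imp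
          (fun k hk => (⟨⟨hk.1, hk.2.1⟩, hk.2.2⟩ : (_ ∧ _) ∧ _))
      refine ⟨_, h1, hC.edge_subset c d hcd (hsub ?_), k, h2, rfl⟩
      have := param_mem_segment z v h2.le h3.le
      rwa [zero_smul, add_zero] at this
    have hp1 := hpt f ⟨t, ht, by
      rw [← htd]
      exact (convex_segment _ _).segment_subset hz2 (right_mem_segment _ _ _)⟩
    have hp2 := hpt (-f) ⟨s, hs, by
      rw [smul_neg, ← sub_eq_add_neg, ← hsc]
      exact (convex_segment _ _).segment_subset hz2 (left_mem_segment _ _ _)⟩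
    obtain ⟨w1, hw1B, hw1r, l1, hl1, hw1⟩ := hp1
    obtain ⟨w2, hw2B, hw2r, l2, hl2, hw2⟩ := hp2
    have c1 : cr e (w1 - z) = l1 * cr e f := by
      rw [hw1, cr_add_smul_right, sub_self]
      simp [cr]
    have c2 : cr e (w2 - z) = -(l2 * cr e f) := by
      rw [hw2, smul_neg, ← neg_smul, cr_add_smul_right, sub_self]
      simp [cr]
    rcases half_disc_subset hline hnear with h | h <;> rcases lt_or_gt_of_ne hcr with hD | hD
    · exact hyr (h ⟨hw2B, by rw [Set.mem_ofPred_eq, c2]; nlinarith⟩) hw2r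
    · exact hyr (h ⟨hw1B, by rw [Set.mem_ofPred_eq, c1]; nlinarith⟩) hw1r
    · exact hyr (h ⟨hw1B, by rw [Set.mem_ofPred_eq, c1]; nlinarith⟩) hw1r
    · exact hyr (h ⟨hw2B, by rw [Set.mem_ofPred_eq, c2]; nlinarith⟩) hw2r

end Graph
end PolygonTriangulation

/-! ### Splitting the polygon along chords -/

namespace PolygonTriangulation

section Chain
variable {n : ℕ} {P : Polygon Plane n} {T : SimpleGraph (Fin n)}

/-- The sides of a polygon that start at the vertices of a given set. -/
def sidesFrom (P : Polygon Plane n) (s : Finset (Fin n)) : Multiset (Plane × Plane) :=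
  s.val.map fun i => (P i, P (finRotate n i))

theorem mem_sidesFrom {s : Finset (Fin n)} {e : Plane × Plane} :
    e ∈ sidesFrom P s ↔ ∃ i ∈ s, (P i, P (finRotate n i)) = e := by
  simp [sidesFrom]

theorem sidesFrom_union {s t : Finset (Fin n)} (h : Disjoint s t) :
    sidesFrom P (s ∪ t) = sidesFrom P s + sidesFrom P t := by
  rw [← Finset.disjUnion_eq_union s t h]
  exact Multiset.map_add _ _ _

theorem val_finRotate_of_lt {i j : Fin n} (h : i < j) : (finRotate n i).val = i.val + 1 := by
  rw [val_finRotate, if_neg]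
  have : i.val < j.val := h
  have := j.isLt
  omega

/-- The starts run over `Ico a b`, the ends over `Ioc a b`. This is an equation of multisets, free
of subtraction. -/
theorem map_fst_sidesFrom_Ico {a b : Fin n} (hab : a ≤ b) :
    (sidesFrom P (Finset.Ico a b)).map Prod.fst + {P b} =
      (sidesFrom P (Finset.Ico a b)).map Prod.snd + {P a} := by
  have h1 : (Finset.Ico a b).map (finRotate n).toEmbedding = Finset.Ioc a b := by
    ext j
    simp only [Finset.mem_map, Finset.mem_Ico, Finset.mem_Ioc, Equiv.coe_toEmbedding]
    constructor
    · rintro ⟨i, ⟨hi1, hi2⟩, rfl⟩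
      have := val_finRotate_of_lt hi2
      rw [Fin.lt_def, Fin.le_def, this]
      rw [Fin.le_def] at hi1
      rw [Fin.lt_def] at hi2
      omega
    · rintro ⟨hj1, hj2⟩
      rw [Fin.lt_def] at hj1
      rw [Fin.le_def] at hj2
      have hlt : (⟨j.val - 1, by omega⟩ : Fin n) < b := by
        rw [Fin.lt_def]
        simp only
        omega
      refine ⟨⟨j.val - 1, by omega⟩, ⟨?_, hlt⟩, ?_⟩
      · rw [Fin.le_def]
        simp only
        omega
      · apply Fin.ext
        rw [val_finRotate_of_lt hlt]
        simp only
        omega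
  have h2 : (Finset.Ico a b).val + {b} = (Finset.Ioc a b).val + {a} := by
    have e1 := congrArg Finset.val (Finset.Icc_eq_cons_Ico hab)
    have e2 := congrArg Finset.val (Finset.Icc_eq_cons_Ioc hab)
    rw [e1, Finset.cons_val, Finset.cons_val] at e2
    rw [add_comm, add_comm (Finset.Ioc a b).val, Multiset.singleton_add, Multiset.singleton_add]
    exact e2
  rw [← h1, Finset.map_val] at h2
  have h3 := congrArg (Multiset.map fun i => P i) h2
  simp only [Multiset.map_add, Multiset.map_map, Multiset.map_singleton] at h3
  simp only [sidesFrom, Multiset.map_map]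
  exact h3

/-- The closed curve formed by the sides from `a` up to `b` and the chord from `b` to `a`. -/
def underLoop (P : Polygon Plane n) (a b : Fin n) : Multiset (Plane × Plane) :=
  sidesFrom P (Finset.Ico a b) + {(P b, P a)}

/-- The closed curve formed by the sides not used by `underLoop` and the chord from `a` to `b`. -/
def overLoop (P : Polygon Plane n) (a b : Fin n) : Multiset (Plane × Plane) :=
  sidesFrom P (Finset.univ \ Finset.Ico a b) + {(P a, P b)}

theorem balanced_underLoop {a b : Fin n} (hab : a ≤ b) : Balanced (underLoop P a b) := by
  unfold Balanced underLoop
  rw [Multiset.map_add, Multiset.map_add]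
  exact map_fst_sidesFrom_Ico hab

theorem polyEdges_eq_add (s : Finset (Fin n)) :
    polyEdges P = sidesFrom P s + sidesFrom P (Finset.univ \ s) := by
  rw [← sidesFrom_union Finset.disjoint_sdiff, Finset.union_sdiff_of_subset (Finset.subset_univ _)]
  rfl

theorem balanced_overLoop {a b : Fin n} (hab : a ≤ b) : Balanced (overLoop P a b) := by
  have h1 := balanced_polyEdges P
  have h2 := map_fst_sidesFrom_Ico (P := P) hab
  unfold Balanced overLoop at *
  rw [polyEdges_eq_add (Finset.Ico a b)] at h1
  rw [Multiset.map_add, Multiset.map_add] at h1 ⊢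
  rw [Multiset.map_singleton, Multiset.map_singleton]
  apply add_left_cancel (a := (sidesFrom P (Finset.Ico a b)).map Prod.snd)
  rw [add_comm _ {(P a, P b).1}, ← add_assoc, ← h2, add_right_comm, h1, add_assoc]

theorem wind_underLoop_add_wind_overLoop {a b : Fin n} {x : Plane}
    (hx : x ∉ segment ℝ (P a) (P b)) :
    wind (underLoop P a b) x + wind (overLoop P a b) x = wind (polyEdges P) x := by
  rw [polyEdges_eq_add (Finset.Ico a b), wind_add, underLoop, overLoop, wind_add, wind_add]
  have h := ang_swap hx
  simp only [wind, Multiset.map_singleton, Multiset.sum_singleton]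
  linarith

/-- The chords `a b` and `b c` are run through once in each direction and cancel. This is the
recursive step that cuts the polygon into triangles. -/
theorem wind_underLoop_eq_add {a b c : Fin n} (hab : a ≤ b) (hbc : b ≤ c) {x : Plane}
    (h1 : x ∉ segment ℝ (P a) (P b)) (h2 : x ∉ segment ℝ (P b) (P c)) :
    wind (underLoop P a c) x =
      wind (underLoop P a b) x + wind (underLoop P b c) x + wind (triEdges (P a) (P b) (P c)) x := by
  rw [wind_triEdges, underLoop, underLoop, underLoop, ← Finset.Ico_union_Ico_eq_Ico hab hbc,
    sidesFrom_union (Finset.Ico_disjoint_Ico_consecutive a b c)]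
  simp only [wind_add]
  have e1 := ang_swap h1
  have e2 := ang_swap h2
  simp only [wind, Multiset.map_singleton, Multiset.sum_singleton]
  linarith

theorem wind_underLoop_of_succ {a b : Fin n} (hab : a.val + 1 = b.val) {x : Plane}
    (hx : x ∉ segment ℝ (P a) (P b)) : wind (underLoop P a b) x = 0 := by
  have h1 : Finset.Ico a b = {a} := by
    ext j
    simp only [Finset.mem_Ico, Finset.mem_singleton, Fin.lt_def, Fin.le_def, Fin.ext_iff]
    omega
  have h2 : finRotate n a = b := by
    apply Fin.ext
    rw [val_finRotate_of_lt (j := b) (by rw [Fin.lt_def]; omega)]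
    exact hab
  rw [underLoop, h1, wind_add]
  have := ang_swap hx
  simp [wind, sidesFrom, h2, -finRotate_apply]
  linarith

theorem wind_underLoop_zero_last {a b : Fin n} (ha : a.val = 0) (hb : b.val + 1 = n) (x : Plane) :
    wind (underLoop P a b) x = wind (polyEdges P) x := by
  have h1 : Finset.univ \ Finset.Ico a b = {b} := by
    ext j
    simp only [Finset.mem_sdiff, Finset.mem_univ, true_and, Finset.mem_Ico, Finset.mem_singleton,
      Fin.lt_def, Fin.le_def, Fin.ext_iff]
    omega
  have h2 : finRotate n b = a := by
    apply Fin.ext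
    rw [val_finRotate, if_pos hb, ha]
  rw [polyEdges_eq_add (Finset.Ico a b), h1, underLoop]
  congr 2
  simp [sidesFrom, h2, -finRotate_apply]

theorem isDrawn_sidesFrom (hn : 3 ≤ n) (hP : IsSimple P) (hT : IsTriangulation P T)
    (s : Finset (Fin n)) : IsDrawn P T (sidesFrom P s) := by
  intro e he
  obtain ⟨i, -, rfl⟩ := mem_sidesFrom.1 he
  exact ⟨_, _, hT.adj_finRotate hn hP i, rfl⟩

theorem isDrawn_singleton {a b : Fin n} (hab : T.Adj a b) : IsDrawn P T {(P a, P b)} := by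
  intro e he
  rw [Multiset.mem_singleton] at he
  exact ⟨a, b, hab, he⟩

theorem IsTriangulation.boundary_subset_drawing (hn : 3 ≤ n) (hP : IsSimple P)
    (hT : IsTriangulation P T) : P.boundary ℝ ⊆ drawing P T := by
  intro x hx
  obtain ⟨i, hi⟩ := mem_boundary_iff.1 hx
  exact Or.inr ⟨_, _, hT.adj_finRotate hn hP i, hi⟩

theorem IsCrossingFreeIn.drawing_subset_region (hC : IsCrossingFreeIn P T) :
    drawing P T ⊆ region P := by
  rintro x (⟨i, rfl⟩ | ⟨a, b, hab, hx⟩)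
  · exact Or.inl (vertex_mem_boundary i)
  · exact hC.edge_subset a b hab hx

/-- The chords of a triangulation do not interleave. -/
theorem IsTriangulation.not_interleaved (hn : 3 ≤ n) (hP : IsSimple P) (hT : IsTriangulation P T)
    {a b c d : Fin n} (hab : T.Adj a b) (hcd : T.Adj c d) (hac : a < c) (hcb : c < b)
    (hbd : b < d) : False := by
  have hC := hT.prop
  have hcdne : P c ≠ P d := fun h => hcd.ne (hP.1 h)
  set z := midpoint ℝ (P c) (P d) with hz
  have hzseg : z ∈ segment ℝ (P c) (P d) := midpoint_mem_segment _ _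
  have hzc : z ≠ P c := by simpa [hz] using hcdne
  have hzd : z ≠ P d := by simpa [hz] using hcdne
  have hoff : ∀ {x y : Fin n}, T.Adj x y → s(c, d) ≠ s(x, y) → z ∉ segment ℝ (P x) (P y) := by
    intro x y hxy hne h
    rcases (hC.inter_subset c d x y hcd hxy hne ⟨hzseg, h⟩).1 with h | h
    exacts [hzc h, hzd h]
  have hside : ∀ i, z ∉ segment ℝ (P i) (P (finRotate n i)) := by
    intro i
    refine hoff (hT.adj_finRotate hn hP i) fun h => ?_
    have hv := val_finRotate i
    rw [Sym2.eq_iff] at h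
    simp only [Fin.lt_def, Fin.ext_iff] at hac hcb hbd h
    split_ifs at hv <;> omega
  have hzB : z ∉ P.boundary ℝ := by
    rw [mem_boundary_iff]
    rintro ⟨i, hi⟩
    exact hside i hi
  have hzab : z ∉ segment ℝ (P a) (P b) := by
    refine hoff hab fun h => ?_
    rw [Sym2.eq_iff] at h
    simp only [Fin.lt_def, Fin.ext_iff] at hac hcb hbd h
    omega
  have hzin : z ∈ inside P := (hC.edge_subset c d hcd hzseg).resolve_left hzB
  have hw := hP.wind_ne_zero hn hzin
  rw [← wind_underLoop_add_wind_overLoop hzab] at hw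
  have hnotSides : ∀ s : Finset (Fin n), z ∉ trace (sidesFrom P s) := by
    rintro s ⟨e, he, hze⟩
    obtain ⟨i, -, rfl⟩ := mem_sidesFrom.1 he
    exact hside i hze
  have hable := (hac.trans hcb).le
  by_cases hu : wind (underLoop P a b) z = 0
  · have ho : wind (overLoop P a b) z ≠ 0 := fun h => hw (by rw [hu, h, add_zero])
    have hdr : IsDrawn P T (overLoop P a b) :=
      (isDrawn_sidesFrom hn hP hT _).add (isDrawn_singleton hab)
    have hzt : z ∉ trace (overLoop P a b) := by
      rw [overLoop, trace_add]
      rintro (h | ⟨e, he, h⟩)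
      · exact hnotSides _ h
      · rw [Multiset.mem_singleton] at he
        rw [he] at h
        exact hzab h
    have hin := mem_insideSet_of_wind_ne_zero (balanced_overLoop hable) hzt ho
    obtain ⟨e, he, hce⟩ := hdr.exists_end_eq hn hP hC hin hcd hzseg
    rw [overLoop, Multiset.mem_add, mem_sidesFrom, Multiset.mem_singleton] at he
    rcases he with ⟨i, hi, rfl⟩ | rfl
    · simp only [Finset.mem_sdiff, Finset.mem_univ, true_and, Finset.mem_Ico, Fin.lt_def,
        Fin.le_def] at hi
      have hv := val_finRotate i
      rcases hce with h | h <;> have h := hP.1 h <;>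
        simp only [Fin.lt_def, Fin.ext_iff] at hac hcb hbd h
      · omega
      · split_ifs at hv <;> omega
    · rcases hce with h | h <;> have h := hP.1 h <;>
        simp only [Fin.lt_def, Fin.ext_iff] at hac hcb hbd h <;> omega
  · have hdr : IsDrawn P T (underLoop P a b) :=
      (isDrawn_sidesFrom hn hP hT _).add (isDrawn_singleton hab.symm)
    have hzt : z ∉ trace (underLoop P a b) := by
      rw [underLoop, trace_add]
      rintro (h | ⟨e, he, h⟩)
      · exact hnotSides _ h
      · rw [Multiset.mem_singleton] at he
        rw [he, segment_symm] at h
        exact hzab h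
    have hin := mem_insideSet_of_wind_ne_zero (balanced_underLoop hable) hzt hu
    rw [segment_symm] at hzseg
    obtain ⟨e, he, hce⟩ := hdr.exists_end_eq hn hP hC hin hcd.symm hzseg
    rw [underLoop, Multiset.mem_add, mem_sidesFrom, Multiset.mem_singleton] at he
    rcases he with ⟨i, hi, rfl⟩ | rfl
    · rw [Finset.mem_Ico] at hi
      have hv := val_finRotate_of_lt hi.2
      simp only [Fin.lt_def, Fin.le_def] at hi
      rcases hce with h | h <;> have h := hP.1 h <;>
        simp only [Fin.lt_def, Fin.ext_iff] at hac hcb hbd h <;> omega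
    · rcases hce with h | h <;> have h := hP.1 h <;>
        simp only [Fin.lt_def, Fin.ext_iff] at hac hcb hbd h <;> omega

end Chain
end PolygonTriangulation

/-! ### Existence of a diagonal -/

namespace PolygonTriangulation
open Filter Topology

/-- The quadratic term `cr x x` vanishes, so the expression is affine in the point. -/
theorem cr_combo (p q x y : Plane) {a b : ℝ} (hab : a + b = 1) :
    cr (p - (a • x + b • y)) (q - (a • x + b • y)) =
      a * cr (p - x) (q - x) + b * cr (p - y) (q - y) := by
  obtain rfl : b = 1 - a := by linarith
  simp only [cr, PiLp.sub_apply, PiLp.add_apply, PiLp.smul_apply, smul_eq_mul]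
  ring

theorem cr_sub_left_self (p q : Plane) : cr (p - p) (q - p) = 0 := by
  simp [cr]

theorem cr_sub_right_self (p q : Plane) : cr (p - q) (q - q) = 0 := by
  simp [cr]

theorem combo_le_or_le (x y : ℝ) {a b : ℝ} (ha : 0 ≤ a) (hb : 0 ≤ b) (hab : a + b = 1) :
    a * x + b * y ≤ x ∨ a * x + b * y ≤ y := by
  obtain rfl : b = 1 - a := by linarith
  rcases le_total x y with h | h
  · right
    nlinarith
  · left
    nlinarith

theorem eq_zero_of_combo_eq_zero {a b x y : ℝ} (hx : x ≤ 0) (hy : y ≤ 0) (ha : 0 < a) (hb : 0 < b)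
    (h : a * x + b * y = 0) : x = 0 ∧ y = 0 := by
  have h1 : a * x ≤ 0 := mul_nonpos_of_nonneg_of_nonpos ha.le hx
  have h2 : b * y ≤ 0 := mul_nonpos_of_nonneg_of_nonpos hb.le hy
  exact ⟨(mul_eq_zero.1 (show a * x = 0 by linarith)).resolve_left ha.ne',
    (mul_eq_zero.1 (show b * y = 0 by linarith)).resolve_left hb.ne'⟩

/-- A segment that leaves a quadrant meets the boundary of the quadrant. -/
theorem exists_mem_segment_min_eq_zero {f g : Plane → ℝ} (hf : Continuous f) (hg : Continuous g)
    {z t : Plane} (hfz : 0 < f z) (hgz : 0 < g z) (ht : f t < 0 ∨ g t < 0) :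
    ∃ y ∈ segment ℝ z t, (f y = 0 ∧ 0 ≤ g y) ∨ (g y = 0 ∧ 0 ≤ f y) := by
  have hcont : ContinuousOn (fun y => min (f y) (g y)) (segment ℝ z t) :=
    (hf.min hg).continuousOn
  obtain ⟨y, hy, h0⟩ := (convex_segment z t).isPreconnected.intermediate_value
    (right_mem_segment ℝ z t) (left_mem_segment ℝ z t) hcont
    (show (0 : ℝ) ∈ Set.Icc _ _ from
      ⟨ht.elim (fun h => (min_le_left _ _).trans h.le) (fun h => (min_le_right _ _).trans h.le),
        (lt_min hfz hgz).le⟩)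
  refine ⟨y, hy, ?_⟩
  simp only at h0
  rcases min_choice (f y) (g y) with h | h
  · exact Or.inl ⟨by rw [← h, h0], by rw [← h0]; exact min_le_right _ _⟩
  · exact Or.inr ⟨by rw [← h, h0], by rw [← h0]; exact min_le_left _ _⟩

section Diagonal
variable {n : ℕ} {P : Polygon Plane n}

/-- The tangent at `v` to the circle about the origin touches the closed disc at `v` only. -/
theorem dt_neg_sub_pos {v q : Plane} (hq : ‖q‖ ≤ ‖v‖) (hqv : q ≠ v) : 0 < dt (-v) (q - v) := by
  have h1 := dt_self_pos (sub_ne_zero.2 hqv)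
  have h2 := pow_le_pow_left₀ (norm_nonneg _) hq 2
  rw [norm_sq_eq_dt, norm_sq_eq_dt] at h2
  simp only [dt, PiLp.sub_apply, PiLp.neg_apply] at *
  nlinarith

/-- With a straight angle at the vertex its neighbours would lie in opposite directions, but both
lie strictly on one side of the tangent to the circle there. -/
theorem IsSimple.orient_ne_zero (hn : 3 ≤ n) (hP : IsSimple P) {j : Fin n}
    (hmax : ∀ i, ‖P i‖ ≤ ‖P (finRotate n j)‖) :
    orient (P j) (P (finRotate n j)) (P (finRotate n (finRotate n j))) ≠ 0 := by
  intro h0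
  have nj := finRotate_ne hn j
  have nk := finRotate_ne hn (finRotate n j)
  have h1 := hP.dt_neg_of_cr_eq_zero hn j
  have d1 := dt_neg_sub_pos (hmax j) (fun h => nj (hP.1 h).symm)
  have d2 := dt_neg_sub_pos (hmax (finRotate n (finRotate n j))) (fun h => nk (hP.1 h))
  generalize P j = u at *
  generalize P (finRotate n (finRotate n j)) = w at *
  generalize P (finRotate n j) = v at *
  have e0 : cr (w - v) (u - v) = orient u v w := by
    simp only [cr, orient, PiLp.sub_apply]
    ring
  rw [e0] at h1
  have h2 := h1 h0
  have p1 : 0 ≤ dt (u - v) (u - v) := by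
    rw [← norm_sq_eq_dt]
    positivity
  have e1 : dt (-v) (w - v) * dt (u - v) (u - v) =
      dt (-v) (u - v) * dt (w - v) (u - v) + cr (-v) (u - v) * cr (w - v) (u - v) := by
    simp only [cr, dt]
    ring
  rw [e0, h0, mul_zero, add_zero] at e1
  nlinarith

/-- At a vertex of largest norm, the points of the angle close to the vertex are inside. -/
theorem IsSimple.exists_ball_corner_inside (hn : 3 ≤ n) (hP : IsSimple P) {j : Fin n}
    (hmax : ∀ i, ‖P i‖ ≤ ‖P (finRotate n j)‖) :
    ∃ r > 0, ∀ z ∈ Metric.ball (P (finRotate n j)) r,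
      z ∈ openTri (P j) (P (finRotate n j)) (P (finRotate n (finRotate n j))) → z ∈ inside P := by
  have nj := finRotate_ne hn j
  have nk := finRotate_ne hn (finRotate n j)
  have njk := finRotate_finRotate_ne hn j
  have hD := hP.orient_ne_zero hn hmax
  obtain ⟨r, hr, hsub⟩ := exists_ball_disjoint_edges P (P (finRotate n j))
  set k := finRotate n j with hk
  set l := finRotate n k with hl
  set u := P j with hu
  set v := P k with hv
  set w := P l with hw
  have hvuw : v ∉ segment ℝ u w := by
    intro h
    rw [mem_segment_iff] at h
    apply hD
    have := cr_sum u v w v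
    rw [cr_sub_right_self, cr_sub_left_self] at this
    rw [← this, cr_anti, h.1]
    ring
  -- Near `v` the polygon winds like the triangle `u v w` plus a remainder: the chord from `u` to
  -- `w` and the sides away from `v`, all continuous at `v`.
  set rest : Plane → ℝ := fun y =>
    ang y u w + ∑ i ∈ (Finset.univ.erase j).erase k, ang y (P i) (P (finRotate n i)) with hrest
  have hsplit : ∀ y, y ∉ segment ℝ u w →
      wind (polyEdges P) y = wind (triEdges u v w) y + rest y := by
    intro y hy
    have h1 := ang_swap hy
    rw [wind_polyEdges, wind_triEdges, ← Finset.add_sum_erase _ _ (Finset.mem_univ j),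
      ← Finset.add_sum_erase _ _ (Finset.mem_erase.2 ⟨nj, Finset.mem_univ k⟩)]
    simp only [hrest]
    linarith
  have hcont : ContinuousAt rest v := by
    refine (continuousAt_ang hvuw).add (tendsto_finsetSum _ fun i hi => continuousAt_ang fun h => ?_)
    rw [Finset.mem_erase, Finset.mem_erase] at hi
    rcases hP.eq_of_vertex_mem h with h' | h'
    · exact hi.1 h'.symm
    · exact hi.2.1 ((finRotate n).injective h').symm
  have hnear : ∀ᶠ y in 𝓝 v, y ∉ segment ℝ u w :=
    (isClosed_segment u w).isOpen_compl.mem_nhds hvuw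
  -- Approach `v` along `v + t • v`, outside the disc of radius `‖v‖`, where both windings vanish.
  have hzero : rest v = 0 := by
    have h1 := hcont.tendsto.comp (tendsto_add_smul v v)
    refine tendsto_nhds_unique (h1.congr' ?_) tendsto_const_nhds
    filter_upwards [(tendsto_add_smul v v).eventually hnear, self_mem_nhdsWithin] with t h2 h3
    have ht : (0 : ℝ) < t := h3
    have hv0 : v ≠ 0 := by
      intro h0
      have h5 := hmax j
      rw [h0, norm_zero] at h5
      exact nj (hP.1 ((h0.trans (norm_le_zero_iff.1 h5).symm)))
    have hpos : ∀ i, 0 < dt (-v) (P i - (v + t • v)) := by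
      intro i
      have e : dt (-v) (P i - (v + t • v)) = dt (-v) (P i - v) + t * dt v v := by
        simp only [dt, PiLp.sub_apply, PiLp.add_apply, PiLp.smul_apply, PiLp.neg_apply, smul_eq_mul]
        ring
      have h4 := mul_pos ht (dt_self_pos hv0)
      rw [e]
      by_cases hi : P i = v
      · rw [hi, sub_self]
        have : dt (-v) (0 : Plane) = 0 := by simp [dt]
        linarith
      · linarith [dt_neg_sub_pos (hmax i) hi]
    have w1 : wind (polyEdges P) (v + t • v) = 0 := by
      refine wind_eq_zero_of_half_plane (balanced_polyEdges P) (-v) fun e he => ?_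
      obtain ⟨i, -, rfl⟩ := Multiset.mem_map.1 he
      exact ⟨hpos _, hpos _⟩
    have w2 : wind (triEdges u v w) (v + t • v) = 0 := by
      refine wind_eq_zero_of_half_plane (balanced_triEdges _ _ _) (-v) fun e he => ?_
      simp only [triEdges, Multiset.insert_eq_cons, Multiset.mem_cons, Multiset.mem_singleton] at he
      rcases he with rfl | rfl | rfl
      exacts [⟨hpos _, hpos _⟩, ⟨hpos _, hpos _⟩, ⟨hpos _, hpos _⟩]
    have h6 := hsplit _ h2
    rw [w1, w2, zero_add] at h6
    exact h6.symm
  have hsmall : ∀ᶠ y in 𝓝 v, |rest y| < 2 * Real.pi := by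
    have h1 := hcont.tendsto.abs
    rw [hzero, abs_zero] at h1
    exact h1.eventually (gt_mem_nhds (by have := Real.pi_pos; linarith))
  obtain ⟨s, hs, hball⟩ := Metric.eventually_nhds_iff_ball.1 (hnear.and hsmall)
  refine ⟨min r s, lt_min hr hs, fun z hz hzT => ?_⟩
  obtain ⟨hz1, hz2⟩ := hball z (Metric.ball_subset_ball (min_le_right _ _) hz)
  have hzC : z ∉ P.boundary ℝ := by
    rw [mem_boundary_iff]
    rintro ⟨i, hi⟩
    rcases hP.eq_of_vertex_mem (hsub z (Metric.ball_subset_ball (min_le_left _ _) hz) i hi)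
      with h | h
    · rw [← h] at hi
      have := (mem_segment_iff.1 hi).1
      have h2 := hzT.2.1
      rw [this, mul_zero] at h2
      exact h2.false
    · rw [← (finRotate n).injective h] at hi
      have := (mem_segment_iff.1 hi).1
      have h2 := hzT.1
      rw [this, mul_zero] at h2
      exact h2.false
  have hzP : z ∉ trace (polyEdges P) := by rwa [trace_polyEdges]
  obtain ⟨a, ha⟩ := exists_int_of_balanced (balanced_polyEdges P) (ne_of_notMem_trace hzP)
  have hzt : z ∉ trace (triEdges u v w) := by
    rw [mem_trace_triEdges]
    rintro (h | h | h)
    · exact hzC (mem_boundary_iff.2 ⟨j, h⟩)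
    · exact hzC (mem_boundary_iff.2 ⟨k, h⟩)
    · rw [segment_symm] at h
      exact hz1 h
  obtain ⟨b, hb⟩ := exists_int_of_balanced (balanced_triEdges u v w) (ne_of_notMem_trace hzt)
  have h3 := hsplit z hz1
  -- A multiple of `2π` of absolute value below `2π` is zero, so polygon and triangle wind equally
  -- at `z`.
  have hab : rest z = ((a - b : ℤ) : ℝ) * (2 * Real.pi) := by
    push_cast
    linarith
  have hab0 : a - b = 0 := by
    have h2pi : 0 < 2 * Real.pi := by
      have := Real.pi_pos
      linarith
    rw [hab, abs_mul, abs_of_pos h2pi] at hz2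
    have h4 : |((a - b : ℤ) : ℝ)| < 1 := by
      by_contra h
      nlinarith
    rw [← Int.cast_abs] at h4
    exact Int.abs_lt_one_iff.1 (by exact_mod_cast h4)
  rw [hab, hab0, Int.cast_zero, zero_mul, add_zero] at h3
  rw [inside_eq_insideSet, ← trace_polyEdges]
  refine mem_insideSet_of_wind_ne_zero (balanced_polyEdges P) hzP ?_
  rw [h3]
  exact wind_triEdges_ne_zero hzT

theorem inside_of_isPreconnected {A : Set Plane} (hA : IsPreconnected A)
    (hAC : ∀ y ∈ A, y ∉ P.boundary ℝ) {s z : Plane} (hs : s ∈ A) (hz : z ∈ A)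
    (hsi : s ∈ inside P) : z ∈ inside P := by
  refine ⟨hAC z hz, ?_⟩
  have h := hA.subset_connectedComponentIn (F := (P.boundary ℝ)ᶜ) hs hAC hz
  rw [← connectedComponentIn_eq h]
  exact hsi.2

theorem finRotate_iterate_three_ne (hn : 4 ≤ n) (i : Fin n) :
    finRotate n (finRotate n (finRotate n i)) ≠ i := by
  intro h
  have := congrArg Fin.val h
  rw [val_finRotate, val_finRotate, val_finRotate] at this
  split_ifs at this <;> omega

set_option maxHeartbeats 1000000 in
/-- Every simple polygon with at least four vertices has a diagonal. -/
theorem IsSimple.exists_diagonal (hn : 4 ≤ n) (hP : IsSimple P) :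
    ∃ i j : Fin n, i ≠ j ∧ j ≠ finRotate n i ∧ i ≠ finRotate n j ∧
      openSegment ℝ (P i) (P j) ⊆ inside P := by
  have hn3 : 3 ≤ n := by omega
  obtain ⟨k', -, hmax⟩ := Finset.exists_max_image (Finset.univ : Finset (Fin n)) (fun i => ‖P i‖)
    ⟨⟨0, by omega⟩, Finset.mem_univ _⟩
  obtain ⟨j, rfl⟩ := (finRotate n).surjective k'
  replace hmax : ∀ i, ‖P i‖ ≤ ‖P (finRotate n j)‖ := fun i => hmax i (Finset.mem_univ i)
  have nj := finRotate_ne hn3 j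
  have nk := finRotate_ne hn3 (finRotate n j)
  have njk := finRotate_finRotate_ne hn3 j
  have nl := finRotate_iterate_three_ne hn j
  have hD := hP.orient_ne_zero hn3 hmax
  obtain ⟨r, hr, hcorner⟩ := hP.exists_ball_corner_inside hn3 hmax
  set k := finRotate n j with hk
  set l := finRotate n k with hl
  set u := P j with hu
  set v := P k with hv
  set w := P l with hw
  set D := orient u v w with hDdef
  have hDD : 0 < D * D := mul_self_pos.2 hD
  -- Barycentric coordinates at `u`, `v`, `w`, scaled by `D * D` so that signs do not depend on the
  -- orientation. `β` is the height above the line `u w`, measured towards `v`.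
  set α : Plane → ℝ := fun x => D * cr (v - x) (w - x) with hα
  set β : Plane → ℝ := fun x => D * cr (w - x) (u - x) with hβ
  set γ : Plane → ℝ := fun x => D * cr (u - x) (v - x) with hγ
  have hαc : Continuous α := continuous_const.mul (continuous_cr (by fun_prop) (by fun_prop))
  have hγc : Continuous γ := continuous_const.mul (continuous_cr (by fun_prop) (by fun_prop))
  have hβc : Continuous β := continuous_const.mul (continuous_cr (by fun_prop) (by fun_prop))
  have hsum : ∀ x, α x + β x + γ x = D * D := by
    intro x
    have := cr_sum u v w x
    simp only [hα, hβ, hγ]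
    rw [← mul_add, ← mul_add]
    congr 1
    linarith
  have hlin : ∀ (p q x y : Plane) (a b : ℝ), a + b = 1 →
      D * cr (p - (a • x + b • y)) (q - (a • x + b • y)) =
        a * (D * cr (p - x) (q - x)) + b * (D * cr (p - y) (q - y)) := by
    intro p q x y a b hab
    rw [cr_combo p q x y hab]
    ring
  have αlin : ∀ (x y : Plane) (a b : ℝ), a + b = 1 → α (a • x + b • y) = a * α x + b * α y :=
    fun x y a b => hlin v w x y a b
  have βlin : ∀ (x y : Plane) (a b : ℝ), a + b = 1 → β (a • x + b • y) = a * β x + b * β y :=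
    fun x y a b => hlin w u x y a b
  have γlin : ∀ (x y : Plane) (a b : ℝ), a + b = 1 → γ (a • x + b • y) = a * γ x + b * γ y :=
    fun x y a b => hlin u v x y a b
  have αv : α v = 0 := by simp only [hα, cr_sub_left_self, mul_zero]
  have αw : α w = 0 := by simp only [hα, cr_sub_right_self, mul_zero]
  have βw : β w = 0 := by simp only [hβ, cr_sub_left_self, mul_zero]
  have βu : β u = 0 := by simp only [hβ, cr_sub_right_self, mul_zero]
  have γu : γ u = 0 := by simp only [hγ, cr_sub_left_self, mul_zero]
  have γv : γ v = 0 := by simp only [hγ, cr_sub_right_self, mul_zero]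
  have αu : α u = D * D := by linarith [hsum u]
  have βv : β v = D * D := by linarith [hsum v]
  have γw : γ w = D * D := by linarith [hsum w]
  have seg_uv : ∀ x, γ x = 0 → 0 ≤ α x → 0 ≤ β x → x ∈ segment ℝ u v := fun x h1 h2 h3 =>
    mem_segment_of_cr_eq_zero hD ((mul_eq_zero.1 h1).resolve_left hD) h2 h3
  have seg_vw : ∀ x, α x = 0 → 0 ≤ β x → 0 ≤ γ x → x ∈ segment ℝ v w := fun x h1 h2 h3 =>
    mem_segment_of_cr_eq_zero (c := u) (by rwa [orient_rotate])
      ((mul_eq_zero.1 h1).resolve_left hD) (by rwa [orient_rotate]) (by rwa [orient_rotate])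
  have γ_of_uv : ∀ x ∈ segment ℝ u v, γ x = 0 := fun x hx => by
    simp only [hγ, (mem_segment_iff.1 hx).1, mul_zero]
  have α_of_vw : ∀ x ∈ segment ℝ v w, α x = 0 := fun x hx => by
    simp only [hα, (mem_segment_iff.1 hx).1, mul_zero]
  have not_edge : ∀ i z, 0 < α z → 0 < γ z → z ∈ segment ℝ (P i) (P (finRotate n i)) →
      i ≠ j ∧ i ≠ k ∧ i ≠ k ∧ finRotate n i ≠ k := by
    intro i z h1 h2 hz
    have hij : i ≠ j := by
      rintro rfl
      exact h2.ne' (γ_of_uv z hz)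
    have hik : i ≠ k := by
      rintro rfl
      exact h1.ne' (α_of_vw z hz)
    exact ⟨hij, hik, hik, fun h => hij ((finRotate n).injective h)⟩
  -- the part of the angle above height `c` contains no boundary point
  have hempty : ∀ c : ℝ, 0 ≤ c →
      (∀ i, 0 ≤ α (P i) → 0 ≤ γ (P i) → c < β (P i) → i = k) →
      ∀ z, 0 < α z → 0 < γ z → c < β z → z ∉ P.boundary ℝ := by
    intro c hc hH z hαz hγz hβz hzC
    obtain ⟨i, hzi⟩ := mem_boundary_iff.1 hzC
    obtain ⟨ne1, ne2, -, ne3⟩ := not_edge i z hαz hγz hzi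
    -- A side through `z` has an end at least as high as `z`. That end is outside the angle at `v`,
    -- so the side leaves the angle through `u v` or `v w` above height `c`, where simplicity allows
    -- no such meeting.
    obtain ⟨t, htk, htseg, htβ⟩ : ∃ t, t ≠ k ∧
        segment ℝ z (P t) ⊆ segment ℝ (P i) (P (finRotate n i)) ∧ β z ≤ β (P t) := by
      have hle : β z ≤ β (P i) ∨ β z ≤ β (P (finRotate n i)) := by
        obtain ⟨a, b, ha, hb, hab, rfl⟩ := hzi
        rw [βlin _ _ _ _ hab]
        exact combo_le_or_le _ _ ha hb hab
      rcases hle with h | h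
      · exact ⟨i, ne2, (convex_segment _ _).segment_subset hzi (left_mem_segment _ _ _), h⟩
      · exact ⟨_, ne3, (convex_segment _ _).segment_subset hzi (right_mem_segment _ _ _), h⟩
    have hneg : α (P t) < 0 ∨ γ (P t) < 0 := by
      by_contra h
      rw [not_or, not_lt, not_lt] at h
      exact htk (hH t h.1 h.2 (hβz.trans_le htβ))
    obtain ⟨y, hy, hy'⟩ := exists_mem_segment_min_eq_zero hαc hγc hαz hγz hneg
    have hβy : c < β y := by
      obtain ⟨a, b, ha, hb, hab, rfl⟩ := hy
      rw [βlin _ _ _ _ hab]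
      nlinarith
    have hyi := htseg hy
    have hends : y = P k → False := by
      intro h
      rw [h] at hyi
      rcases hP.eq_of_vertex_mem hyi with h' | h'
      exacts [ne2 h'.symm, ne3 h'.symm]
    rcases hy' with ⟨h1, h2⟩ | ⟨h1, h2⟩
    · have hyk := seg_vw y h1 (hc.trans hβy.le) h2
      rcases (hP.eq_of_mem ne2.symm hyk hyi).1 with h | h
      · exact hends h
      · have : β y = 0 := by rw [h]; exact βw
        linarith
    · have hyj := seg_uv y h1 h2 (hc.trans hβy.le)
      rcases (hP.eq_of_mem ne1.symm hyj hyi).1 with h | h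
      · have : β y = 0 := by rw [h]; exact βu
        linarith
      · exact hends h
  have hinside : ∀ c : ℝ, 0 ≤ c → c < D * D →
      (∀ i, 0 ≤ α (P i) → 0 ≤ γ (P i) → c < β (P i) → i = k) →
      ∀ z, 0 < α z → 0 < γ z → c < β z → z ∈ inside P := by
    intro c hc hcD hH z hαz hγz hβz
    have hconv : Convex ℝ {z | 0 < α z ∧ 0 < γ z ∧ c < β z} := by
      rintro x ⟨hx1, hx2, hx3⟩ y ⟨hy1, hy2, hy3⟩ a b ha hb hab
      rw [Set.mem_ofPred_eq, αlin _ _ _ _ hab, βlin _ _ _ _ hab, γlin _ _ _ _ hab]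
      rcases ha.eq_or_lt with rfl | ha
      · obtain rfl : b = 1 := by linarith
        simp only [zero_mul, one_mul, zero_add]
        exact ⟨hy1, hy2, hy3⟩
      · refine ⟨by positivity, by positivity, ?_⟩
        have : c = a * c + b * c := by rw [← add_mul, hab, one_mul]
        nlinarith
    -- A point of the median close to `v` is inside by the corner lemma; convexity of the cap
    -- spreads this.
    obtain ⟨t, ht1, ht2, ht3, ht4⟩ : ∃ t : ℝ, 0 < t ∧
        v + t • (midpoint ℝ u w - v) ∈ Metric.ball v r ∧ c < β (v + t • (midpoint ℝ u w - v)) ∧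
        t < 1 := by
      have hlim := tendsto_add_smul v (midpoint ℝ u w - v)
      have h1 := hlim.eventually (Metric.isOpen_ball.mem_nhds (Metric.mem_ball_self hr))
      have h2 := hlim.eventually (hβc.continuousAt.eventually (lt_mem_nhds (by rwa [βv])))
      obtain ⟨t, h3, h4, h5⟩ := (h1.and (h2.and (Ioo_mem_nhdsGT (zero_lt_one' ℝ)))).exists
      exact ⟨t, h5.1, h3, h4, h5.2⟩
    have hs : v + t • (midpoint ℝ u w - v) = (1 - t) • v + t • midpoint ℝ u w := by module
    have hm : midpoint ℝ u w = (1 / 2 : ℝ) • u + (1 / 2 : ℝ) • w := by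
      rw [midpoint_eq_smul_add, smul_add]
      norm_num
    have hsα : 0 < α (v + t • (midpoint ℝ u w - v)) := by
      rw [hs, αlin _ _ _ _ (by ring), hm, αlin _ _ _ _ (by norm_num), αv, αu, αw]
      have := mul_pos ht1 hDD
      linarith
    have hsγ : 0 < γ (v + t • (midpoint ℝ u w - v)) := by
      rw [hs, γlin _ _ _ _ (by ring), hm, γlin _ _ _ _ (by norm_num), γv, γu, γw]
      have := mul_pos ht1 hDD
      linarith
    refine inside_of_isPreconnected hconv.isPreconnected
      (fun y hy => hempty c hc hH y hy.1 hy.2.1 hy.2.2) ⟨hsα, hsγ, ht3⟩ ⟨hαz, hγz, hβz⟩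
      (hcorner _ ht2 ⟨hsγ, hsα, hc.trans_lt ht3⟩)
  -- If another vertex lies in the closed triangle, join `v` to one of greatest height; otherwise
  -- join `u` to `w`.
  by_cases hM : ∃ i, i ≠ j ∧ i ≠ k ∧ i ≠ l ∧ 0 ≤ α (P i) ∧ 0 ≤ β (P i) ∧ 0 ≤ γ (P i)
  · classical
    obtain ⟨i₀, hi₀⟩ := hM
    obtain ⟨p, hp, hpmax⟩ := Finset.exists_max_image (Finset.univ.filter fun i =>
      i ≠ j ∧ i ≠ k ∧ i ≠ l ∧ 0 ≤ α (P i) ∧ 0 ≤ β (P i) ∧ 0 ≤ γ (P i)) (fun i => β (P i))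
      ⟨i₀, by simpa using hi₀⟩
    rw [Finset.mem_filter] at hp
    obtain ⟨-, hpj, hpk, hpl, hpα, hpβ, hpγ⟩ := hp
    have hα' : 0 < α (P p) := by
      refine lt_of_le_of_ne hpα fun h => ?_
      rcases hP.eq_of_vertex_mem (seg_vw _ h.symm hpβ hpγ) with h | h
      exacts [hpk h, hpl h]
    have hγ' : 0 < γ (P p) := by
      refine lt_of_le_of_ne hpγ fun h => ?_
      rcases hP.eq_of_vertex_mem (seg_uv _ h.symm hpα hpβ) with h | h
      exacts [hpj h, hpk h]
    have hβD : β (P p) < D * D := by linarith [hsum (P p)]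
    refine ⟨k, p, hpk.symm, hpl, fun h => hpj ((finRotate n).injective h).symm, ?_⟩
    rintro z ⟨a, b, ha, hb, hab, rfl⟩
    refine hinside (β (P p)) hpβ hβD ?_ _ ?_ ?_ ?_
    · intro i h1 h2 h3
      by_contra hik
      by_cases hij : i = j
      · rw [hij] at h3
        linarith
      by_cases hil : i = l
      · rw [hil] at h3
        linarith
      have := hpmax i (by
        rw [Finset.mem_filter]
        exact ⟨Finset.mem_univ _, hij, hik, hil, h1, by linarith, h2⟩)
      linarith
    · rw [αlin _ _ _ _ hab, αv]
      have := mul_pos hb hα'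
      linarith
    · rw [γlin _ _ _ _ hab, γv]
      have := mul_pos hb hγ'
      linarith
    · rw [βlin _ _ _ _ hab, βv]
      obtain rfl : b = 1 - a := by linarith
      nlinarith
  · have hH : ∀ i, 0 ≤ α (P i) → 0 ≤ β (P i) → 0 ≤ γ (P i) → i = j ∨ i = k ∨ i = l := by
      intro i h1 h2 h3
      by_contra h
      rw [not_or, not_or] at h
      exact hM ⟨i, h.1, h.2.1, h.2.2, h1, h2, h3⟩
    have hH0 : ∀ i, 0 ≤ α (P i) → 0 ≤ γ (P i) → 0 < β (P i) → i = k := by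
      intro i h1 h2 h3
      rcases hH i h1 h3.le h2 with rfl | h | rfl
      · exact absurd βu h3.ne'
      · exact h
      · exact absurd βw h3.ne'
    have hS := hinside 0 le_rfl hDD hH0
    refine ⟨j, l, njk.symm, nk, Ne.symm nl, ?_⟩
    rintro z ⟨a, b, ha, hb, hab, rfl⟩
    have hzα : 0 < α (a • u + b • w) := by
      rw [αlin _ _ _ _ hab, αu, αw]
      have := mul_pos ha hDD
      linarith
    have hzγ : 0 < γ (a • u + b • w) := by
      rw [γlin _ _ _ _ hab, γu, γw]
      have := mul_pos hb hDD
      linarith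
    have hzβ : β (a • u + b • w) = 0 := by
      rw [βlin _ _ _ _ hab, βu, βw]
      ring
    have hzseg : a • u + b • w ∈ segment ℝ u w := ⟨a, b, ha.le, hb.le, hab, rfl⟩
    set z := a • u + b • w
    have hzC : z ∉ P.boundary ℝ := by
      rw [mem_boundary_iff]
      rintro ⟨i, hzi⟩
      obtain ⟨ne1, ne2, -, ne3⟩ := not_edge i z hzα hzγ hzi
      have hzP : ∀ t, z ≠ P t := by
        intro t ht
        rw [ht] at hzα hzγ hzβ
        rcases hH t hzα.le hzβ.ge hzγ.le with rfl | rfl | rfl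
        · exact hzγ.ne' γu
        · exact hzα.ne' αv
        · exact hzα.ne' αw
      -- A side rising from `z` would enter the part of the angle that is free of boundary points.
      -- So neither end is above height zero, and since `z` has height zero, both have it.
      have hβle : ∀ t, segment ℝ z (P t) ⊆ segment ℝ (P i) (P (finRotate n i)) → β (P t) ≤ 0 := by
        intro t ht
        by_contra hpos
        rw [not_le] at hpos
        have hlim := tendsto_add_smul z (P t - z)
        obtain ⟨s, h1, h2, h3⟩ := ((hlim.eventually (hαc.continuousAt.eventually
          (lt_mem_nhds hzα))).and ((hlim.eventually (hγc.continuousAt.eventually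
          (lt_mem_nhds hzγ))).and (Ioo_mem_nhdsGT (zero_lt_one' ℝ)))).exists
        have e : z + s • (P t - z) = (1 - s) • z + s • P t := by module
        have h4 : 0 < β (z + s • (P t - z)) := by
          rw [e, βlin _ _ _ _ (by ring), hzβ]
          have := mul_pos h3.1 hpos
          linarith
        refine (hS _ h1 h2 h4).1 (mem_boundary_iff.2 ⟨i, ht ?_⟩)
        rw [e]
        exact ⟨1 - s, s, by linarith [h3.2], h3.1.le, by ring, rfl⟩
      have b1 := hβle i ((convex_segment _ _).segment_subset hzi (left_mem_segment _ _ _))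
      have b2 := hβle _ ((convex_segment _ _).segment_subset hzi (right_mem_segment _ _ _))
      have hβ0 : β (P i) = 0 ∧ β (P (finRotate n i)) = 0 := by
        obtain ⟨c, d, hc, hd, hcd, hz'⟩ := hzi
        have h3 := βlin (P i) (P (finRotate n i)) c d hcd
        rw [hz', hzβ] at h3
        have hc0 : c ≠ 0 := by
          rintro rfl
          obtain rfl : d = 1 := by linarith
          rw [zero_smul, zero_add, one_smul] at hz'
          exact hzP _ hz'.symm
        have hd0 : d ≠ 0 := by
          rintro rfl
          obtain rfl : c = 1 := by linarith
          rw [zero_smul, add_zero, one_smul] at hz'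
          exact hzP _ hz'.symm
        have hc' := lt_of_le_of_ne hc hc0.symm
        have hd' := lt_of_le_of_ne hd hd0.symm
        exact eq_zero_of_combo_eq_zero b1 b2 hc' hd' h3.symm
      have hcr : cr (w - u) (P (finRotate n i) - P i) = 0 := by
        have e : D * cr (w - u) (P (finRotate n i) - P i) = β (P i) - β (P (finRotate n i)) := by
          simp only [hβ, cr, PiLp.sub_apply]
          ring
        rw [hβ0.1, hβ0.2, sub_zero] at e
        exact (mul_eq_zero.1 e).resolve_left hD
      have hvert : ∀ t, β (P t) = 0 → P t ∈ segment ℝ u w → P t = u ∨ P t = w := by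
        intro t h0 ht
        have hαt : 0 ≤ α (P t) ∧ 0 ≤ γ (P t) := by
          obtain ⟨c, d, hc, hd, hcd, h⟩ := ht
          rw [← h, αlin _ _ _ _ hcd, γlin _ _ _ _ hcd, αu, αw, γu, γw, mul_zero, mul_zero,
            add_zero, zero_add]
          exact ⟨by positivity, by positivity⟩
        rcases hH t hαt.1 h0.ge hαt.2 with rfl | rfl | rfl
        · exact Or.inl rfl
        · exact absurd h0 (by rw [← hv, βv]; exact hDD.ne')
        · exact Or.inr rfl
      -- The side lies on the line `u w` and hence joins `w` to `u`, so the polygon closes after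
      -- three steps; `4 ≤ n` forbids this.
      rcases ends_eq_of_collinear hzseg hzi (hzP j) (hzP l) (hzP _) (hzP _) hcr
        (fun h => (hP.eq_of_vertex_mem h).imp (congrArg _) (congrArg _))
        (fun h => (hP.eq_of_vertex_mem h).imp (congrArg _) (congrArg _))
        (hvert _ hβ0.1) (hvert _ hβ0.2) with ⟨h1, h2⟩ | ⟨h1, h2⟩
      · exact ne1 (hP.1 h1).symm
      · have e1 := hP.1 h1
        have e2 := hP.1 h2
        rw [← e2] at e1
        exact nl e1.symm
    have hsv : v ∈ segment ℝ z v := right_mem_segment _ _ _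
    -- The point `z` is at height zero and not in the open cap; the segment towards `v` connects it
    -- to the cap.
    refine inside_of_isPreconnected (A := openSegment ℝ z v ∪ {z}) ?_ ?_
      (s := midpoint ℝ z v) (Or.inl (midpoint_mem_openSegment z v)) (Or.inr rfl) ?_
    · refine (convex_openSegment z v).isPreconnected.subset_closure Set.subset_union_left ?_
      rw [closure_openSegment]
      rintro y (hy | rfl)
      · exact openSegment_subset_segment _ _ _ hy
      · exact left_mem_segment _ _ _
    · rintro y (hy | rfl)
      · obtain ⟨c, d, hc, hd, hcd, rfl⟩ := hy
        refine hempty 0 le_rfl hH0 _ ?_ ?_ ?_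
        · rw [αlin _ _ _ _ hcd, αv]
          have := mul_pos hc hzα
          linarith
        · rw [γlin _ _ _ _ hcd, γv]
          have := mul_pos hc hzγ
          linarith
        · rw [βlin _ _ _ _ hcd, βv, hzβ]
          have := mul_pos hd hDD
          linarith
      · exact hzC
    · obtain ⟨c, d, hc, hd, hcd, hmid⟩ := midpoint_mem_openSegment (𝕜 := ℝ) z v
      rw [← hmid]
      refine hS _ ?_ ?_ ?_
      · rw [αlin _ _ _ _ hcd, αv]
        have := mul_pos hc hzα
        linarith
      · rw [γlin _ _ _ _ hcd, γv]
        have := mul_pos hc hzγ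
        linarith
      · rw [βlin _ _ _ _ hcd, βv, hzβ]
        have := mul_pos hd hDD
        linarith

end Diagonal
end PolygonTriangulation

/-! ### Increasing paths and the triangle on a chord -/

namespace PolygonTriangulation
open Filter Topology

section Rise
variable {n : ℕ} {P : Polygon Plane n} {T : SimpleGraph (Fin n)}

/-- The first `k + 1` values of `s` form an increasing path from `a` to `b` in `T`. -/
def IsRise (T : SimpleGraph (Fin n)) (a b : Fin n) (k : ℕ) (s : ℕ → Fin n) : Prop :=
  s 0 = a ∧ s k = b ∧ ∀ i < k, s i < s (i + 1) ∧ T.Adj (s i) (s (i + 1))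

theorem IsRise.lt {a b : Fin n} {k : ℕ} {s : ℕ → Fin n} (h : IsRise T a b k s) {i j : ℕ}
    (hij : i < j) (hj : j ≤ k) : s i < s j := by
  induction j with
  | zero => omega
  | succ j ih =>
    have h1 := (h.2.2 j (by omega)).1
    rcases Nat.lt_succ_iff_lt_or_eq.1 hij with h2 | rfl
    · exact (ih h2 (by omega)).trans h1
    · exact h1

theorem IsRise.injOn {a b : Fin n} {k : ℕ} {s : ℕ → Fin n} (h : IsRise T a b k s) {i j : ℕ}
    (hi : i ≤ k) (hj : j ≤ k) (hij : s i = s j) : i = j := by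
  rcases lt_trichotomy i j with h1 | h1 | h1
  · exact absurd hij (h.lt h1 hj).ne
  · exact h1
  · exact absurd hij (h.lt h1 hi).ne'

theorem IsRise.shortcut {a b : Fin n} {k : ℕ} {s : ℕ → Fin n} (h : IsRise T a b k s) {i j : ℕ}
    (hij : i < j) (hj : j ≤ k) (hadj : T.Adj (s i) (s j)) :
    IsRise T a b (k - (j - i) + 1) fun t => if t ≤ i then s t else s (t + (j - i - 1)) := by
  refine ⟨by simpa using h.1, ?_, fun t ht => ?_⟩
  · dsimp only
    rw [if_neg (by omega), ← h.2.1]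
    congr 1
    omega
  · dsimp only
    rcases lt_trichotomy t i with h1 | rfl | h1
    · rw [if_pos h1.le, if_pos (by omega)]
      exact h.2.2 t (by omega)
    · rw [if_pos le_rfl, if_neg (by omega), show t + 1 + (j - t - 1) = j by omega]
      exact ⟨h.lt hij hj, hadj⟩
    · rw [if_neg (by omega), if_neg (by omega),
        show t + 1 + (j - i - 1) = t + (j - i - 1) + 1 by omega]
      exact h.2.2 _ (by omega)

theorem IsTriangulation.exists_isRise (hn : 3 ≤ n) (hP : IsSimple P) (hT : IsTriangulation P T)
    {a b : Fin n} (hab : a < b) : ∃ s, IsRise T a b (b.val - a.val) s := by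
  have hab' : a.val < b.val := hab
  refine ⟨fun i => if h : a.val + i < n then ⟨a.val + i, h⟩ else b, ?_, ?_, fun i hi => ?_⟩
  · simp
  · dsimp only
    rw [dif_pos (by omega)]
    apply Fin.ext
    simp only
    omega
  · dsimp only
    rw [dif_pos (by omega), dif_pos (by omega)]
    have h1 := hT.adj_finRotate hn hP ⟨a.val + i, by omega⟩
    have h2 : finRotate n ⟨a.val + i, by omega⟩ = ⟨a.val + (i + 1), by omega⟩ := by
      apply Fin.ext
      rw [val_finRotate]
      simp only
      rw [if_neg (by omega)]
      omega
    rw [h2] at h1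
    exact ⟨by rw [Fin.lt_def]; simp only; omega, h1⟩

/-- The polygon of an increasing path. -/
def risePolygon (P : Polygon Plane n) (k : ℕ) (s : ℕ → Fin n) : Polygon Plane (k + 1) :=
  ⟨fun i => P (s i)⟩

theorem IsRise.adj_finRotate {a b : Fin n} {k : ℕ} {s : ℕ → Fin n} (h : IsRise T a b k s)
    (hab : T.Adj a b) (i : Fin (k + 1)) : T.Adj (s i) (s (finRotate (k + 1) i)) := by
  rw [val_finRotate]
  split_ifs with hi
  · rw [show i.val = k by omega, h.1, h.2.1]
    exact hab.symm
  · exact (h.2.2 i.val (by omega)).2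

/-- The sides are edges of a crossing-free graph, and for `2 ≤ k` no edge is used twice. -/
theorem IsRise.isSimple {a b : Fin n} {k : ℕ} {s : ℕ → Fin n} (h : IsRise T a b k s)
    (hk : 2 ≤ k) (hab : T.Adj a b) (hP : IsSimple P) (hC : IsCrossingFreeIn P T) :
    IsSimple (risePolygon P k s) := by
  have hinj : ∀ i j : Fin (k + 1), s i = s j → i = j := fun i j hij =>
    Fin.ext (h.injOn (by omega) (by omega) hij)
  refine ⟨fun i j hij => hinj i j (hP.1 hij), fun i j hij => ?_⟩
  rw [edgeSet_eq, edgeSet_eq]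
  refine hC.inter_subset _ _ _ _ (h.adj_finRotate hab i) (h.adj_finRotate hab j) fun he => ?_
  rw [Sym2.eq_iff] at he
  rcases he with ⟨h1, -⟩ | ⟨h1, h2⟩
  · exact hij (hinj _ _ h1)
  · have e1 := hinj _ _ h1
    have e2 := hinj _ _ h2
    rw [e1] at e2
    exact finRotate_finRotate_ne (by omega) j e2

/-- Every edge of a triangulation is the longest side of a triangle of edges, unless its ends are
neighbours. -/
theorem IsTriangulation.exists_apex (hn : 3 ≤ n) (hP : IsSimple P) (hT : IsTriangulation P T)
    {a b : Fin n} (hab : T.Adj a b) (hlt : a.val + 1 < b.val) :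
    ∃ c, a < c ∧ c < b ∧ T.Adj a c ∧ T.Adj c b := by
  classical
  have hC := hT.prop
  -- Length one is excluded because the chord `a b` is itself such a path; the sides from `a` to `b`
  -- show existence.
  have hex : ∃ k, 2 ≤ k ∧ ∃ s, IsRise T a b k s :=
    ⟨b.val - a.val, by omega, hT.exists_isRise hn hP (by rw [Fin.lt_def]; omega)⟩
  obtain ⟨hk2, s, hs⟩ := Nat.find_spec hex
  have hmin : ∀ k' < Nat.find hex, ¬ (2 ≤ k' ∧ ∃ s, IsRise T a b k' s) := fun k' hk' =>
    Nat.find_min hex hk'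
  generalize Nat.find hex = k at *
  -- Any further chord would shorten the path while leaving at least two edges.
  have hchord : ∀ i j, i < j → j ≤ k → T.Adj (s i) (s j) → j = i + 1 ∨ (i = 0 ∧ j = k) := by
    intro i j hij hj hadj
    by_contra hnot
    exact hmin (k - (j - i) + 1) (by omega) ⟨by omega, _, hs.shortcut hij hj hadj⟩
  rcases hk2.eq_or_lt with rfl | hk3
  · exact ⟨s 1, by rw [← hs.1]; exact hs.lt (by omega) (by omega),
      by rw [← hs.2.1]; exact hs.lt (by omega) (by omega),
      by rw [← hs.1]; exact (hs.2.2 0 (by omega)).2,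
      by rw [← hs.2.1]; exact (hs.2.2 1 (by omega)).2⟩
  -- A path of length at least three, closed by `a b`, has a diagonal. It can be added to `T`, so it
  -- is in `T`, against minimality.
  exfalso
  set Q := risePolygon P k s with hQ
  have hQs : IsSimple Q := hs.isSimple hk2 hab hP hC
  have hdrawn : IsDrawn P T (polyEdges Q) := by
    intro e he
    obtain ⟨i, -, rfl⟩ := Multiset.mem_map.1 he
    exact ⟨_, _, hs.adj_finRotate hab i, rfl⟩
  have hside : ∀ i j : Fin (k + 1), i < j → T.Adj (s i) (s j) →
      j = finRotate (k + 1) i ∨ i = finRotate (k + 1) j := by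
    intro i j hij hadj
    rw [Fin.lt_def] at hij
    rcases hchord i.val j.val hij (by omega) hadj with h | ⟨h1, h2⟩
    · left
      apply Fin.ext
      rw [val_finRotate, if_neg (by omega), h]
    · right
      apply Fin.ext
      rw [val_finRotate, if_pos (by omega), h1]
  have hside' : ∀ i j : Fin (k + 1), T.Adj (s i) (s j) →
      j = finRotate (k + 1) i ∨ i = finRotate (k + 1) j := by
    intro i j hadj
    rcases lt_trichotomy i j with h | h | h
    · exact hside i j h hadj
    · rw [h] at hadj
      exact absurd hadj (SimpleGraph.irrefl _)
    · exact (hside j i h hadj.symm).symm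
  obtain ⟨i, j, hij, hji, hij', hopen⟩ := hQs.exists_diagonal (by omega)
  have hins := hP.insideSet_subset hn (isClosed_trace (polyEdges Q)) (hdrawn.trace_subset hC)
  rw [inside_eq_insideSet, ← trace_polyEdges] at hopen
  have hsegcases : ∀ z ∈ segment ℝ (P (s i)) (P (s j)),
      z = P (s i) ∨ z = P (s j) ∨ z ∈ insideSet (trace (polyEdges Q)) := by
    intro z hz
    rw [← insert_endpoints_openSegment] at hz
    rcases hz with h | h | h
    exacts [Or.inl h, Or.inr (Or.inl h), Or.inr (Or.inr (hopen h))]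
  have hvertex : ∀ e ∈ polyEdges Q, ∀ c, P c = e.1 ∨ P c = e.2 → ∃ t : Fin (k + 1), c = s t := by
    intro e he c hc
    obtain ⟨t, -, rfl⟩ := Multiset.mem_map.1 he
    rcases hc with h | h
    exacts [⟨t, hP.1 h⟩, ⟨_, hP.1 h⟩]
  have hadj : T.Adj (s i) (s j) := by
    refine hT.adj_of_addable (fun h => hij (Fin.ext (hs.injOn (by omega) (by omega) h))) ?_ ?_ ?_
    · intro z hz
      rcases hsegcases z hz with rfl | rfl | h
      · exact Or.inl (vertex_mem_boundary _)
      · exact Or.inl (vertex_mem_boundary _)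
      · exact (hins h).1
    · intro c hc
      rcases hsegcases _ hc with h | h | h
      · exact Or.inl (hP.1 h)
      · exact Or.inr (hP.1 h)
      · exact absurd (vertex_mem_boundary c) (hins h).2
    · rintro c d hcd - z ⟨hz1, hz2⟩
      rcases hsegcases z hz1 with rfl | rfl | h
      · rcases hC.vertex_mem c d _ hcd hz2 with h | h <;> simp [h]
      · rcases hC.vertex_mem c d _ hcd hz2 with h | h <;> simp [h]
      -- An edge meeting the interior of the closed path has both ends on the path, so by minimality
      -- it is one of its sides, and `z` would be on the curve.
      · exfalso
        obtain ⟨e, he, hce⟩ := hdrawn.exists_end_eq hn hP hC h hcd hz2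
        obtain ⟨t, rfl⟩ := hvertex e he c hce
        rw [segment_symm] at hz2
        obtain ⟨e', he', hde⟩ := hdrawn.exists_end_eq hn hP hC h hcd.symm hz2
        obtain ⟨t', rfl⟩ := hvertex e' he' d hde
        apply h.1
        rw [trace_polyEdges, mem_boundary_iff]
        rcases hside' t t' hcd with rfl | rfl
        · rw [segment_symm] at hz2
          exact ⟨t, hz2⟩
        · exact ⟨t', hz2⟩
  rcases hside' i j hadj with h | h
  exacts [hji h, hij' h]

end Rise

/-! ### Open triangles and their closures -/

section OpenTri

/-- Of three collinear points one lies between the other two. -/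
theorem orient_ne_zero_of_notMem {a b c : Plane} (h1 : a ∉ segment ℝ b c) (h2 : b ∉ segment ℝ a c)
    (h3 : c ∉ segment ℝ a b) : orient a b c ≠ 0 := by
  intro h0
  rw [mem_segment_iff, not_and_or, not_le] at h1 h2 h3
  have e1 : cr (b - a) (c - a) = 0 := h0
  have e2 : cr (a - b) (c - b) = 0 := by
    rw [← neg_eq_zero, ← h0]
    simp only [cr, orient, PiLp.sub_apply]
    ring
  have e3 : cr (a - c) (b - c) = 0 := by
    rw [← h0]
    simp only [cr, orient, PiLp.sub_apply]
    ring
  replace h1 := h1.resolve_left (not_not.2 e1)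
  replace h2 := h2.resolve_left (not_not.2 e2)
  replace h3 := h3.resolve_left (not_not.2 e3)
  have i1 : dt (a - b) (c - b) = dt (b - a) (b - a) - dt (b - a) (c - a) := by
    simp only [dt, PiLp.sub_apply]
    ring
  have i2 : dt (a - c) (b - c) = dt (c - a) (c - a) - dt (b - a) (c - a) := by
    simp only [dt, PiLp.sub_apply]
    ring
  have i3 : dt (b - a) (b - a) * dt (c - a) (c - a) =
      dt (b - a) (c - a) ^ 2 + cr (b - a) (c - a) ^ 2 := by
    simp only [dt, cr]
    ring
  rw [e1] at i3
  nlinarith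

theorem notMem_trace_of_mem_openTri {a b c x : Plane} (h : x ∈ openTri a b c) :
    x ∉ trace (triEdges a b c) := by
  rw [mem_trace_triEdges]
  obtain ⟨h1, h2, h3⟩ := h
  rintro (h | h | h) <;> have h := (mem_segment_iff.1 h).1
  · simp [h] at h1
  · simp [h] at h2
  · simp [h] at h3

theorem openTri_combo {a b c x y : Plane} {s t : ℝ} (hs : 0 ≤ s) (ht : 0 < t) (hst : s + t = 1)
    (h1 : 0 ≤ orient a b c * cr (a - x) (b - x)) (h2 : 0 ≤ orient a b c * cr (b - x) (c - x))
    (h3 : 0 ≤ orient a b c * cr (c - x) (a - x)) (hy : y ∈ openTri a b c) :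
    s • x + t • y ∈ openTri a b c := by
  obtain ⟨g1, g2, g3⟩ := hy
  refine ⟨?_, ?_, ?_⟩ <;> rw [cr_combo _ _ _ _ hst]
  · have := mul_nonneg hs h1
    have := mul_pos ht g1
    linarith
  · have := mul_nonneg hs h2
    have := mul_pos ht g2
    linarith
  · have := mul_nonneg hs h3
    have := mul_pos ht g3
    linarith

theorem convex_openTri (a b c : Plane) : Convex ℝ (openTri a b c) := by
  intro x hx y hy s t hs ht hst
  rcases ht.eq_or_lt with rfl | ht
  · obtain rfl : s = 1 := by linarith
    simpa using hx
  · exact openTri_combo hs ht hst hx.1.le hx.2.1.le hx.2.2.le hy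

theorem isOpen_openTri (a b c : Plane) : IsOpen (openTri a b c) := by
  have h : ∀ p q : Plane, IsOpen {x | 0 < orient a b c * cr (p - x) (q - x)} := fun p q =>
    isOpen_lt continuous_const (continuous_const.mul (continuous_cr (by fun_prop) (by fun_prop)))
  exact (h a b).inter ((h b c).inter (h c a))

theorem centroid_mem_openTri {a b c : Plane} (hD : orient a b c ≠ 0) :
    (1 / 3 : ℝ) • (a + b + c) ∈ openTri a b c := by
  have hDD := mul_self_pos.2 hD
  have e : ∀ a b c : Plane, cr (a - (1 / 3 : ℝ) • (a + b + c)) (b - (1 / 3 : ℝ) • (a + b + c)) =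
      orient a b c / 3 := by
    intro a b c
    simp only [cr, orient, PiLp.sub_apply, PiLp.add_apply, PiLp.smul_apply, smul_eq_mul]
    ring
  have e2 := e b c a
  have e3 := e c a b
  rw [orient_rotate, show b + c + a = a + b + c by abel] at e2
  rw [← orient_rotate, show c + a + b = a + b + c by abel] at e3
  refine ⟨?_, ?_, ?_⟩
  · rw [e, ← mul_div_assoc]
    positivity
  · rw [e2, ← mul_div_assoc]
    positivity
  · rw [e3, ← mul_div_assoc]
    positivity

theorem closure_openTri_subset {a b c : Plane} (hD : orient a b c ≠ 0) :
    closure (openTri a b c) ⊆ openTri a b c ∪ trace (triEdges a b c) := by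
  have hcl : IsClosed ({x | 0 ≤ orient a b c * cr (a - x) (b - x)} ∩
      ({x | 0 ≤ orient a b c * cr (b - x) (c - x)} ∩
        {x | 0 ≤ orient a b c * cr (c - x) (a - x)})) := by
    refine (isClosed_le continuous_const ?_).inter
      ((isClosed_le continuous_const ?_).inter (isClosed_le continuous_const ?_))
    all_goals exact continuous_const.mul (continuous_cr (by fun_prop) (by fun_prop))
  intro x hx
  have hsub : openTri a b c ⊆ {x | 0 ≤ orient a b c * cr (a - x) (b - x)} ∩
      ({x | 0 ≤ orient a b c * cr (b - x) (c - x)} ∩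
        {x | 0 ≤ orient a b c * cr (c - x) (a - x)}) :=
    fun y hy => ⟨hy.1.le, hy.2.1.le, hy.2.2.le⟩
  obtain ⟨h1, h2, h3⟩ := closure_minimal hsub hcl hx
  exact mem_openTri_or_mem_trace hD h1 h2 h3

theorem left_mem_closure_openTri {a b c : Plane} (hD : orient a b c ≠ 0) :
    a ∈ closure (openTri a b c) := by
  have hDD := mul_self_pos.2 hD
  refine mem_closure_of_tendsto (tendsto_add_smul a ((1 / 3 : ℝ) • (a + b + c) - a)) ?_
  filter_upwards [Ioo_mem_nhdsGT (zero_lt_one' ℝ)] with t ht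
  have e : a + t • ((1 / 3 : ℝ) • (a + b + c) - a) = (1 - t) • a + t • (1 / 3 : ℝ) • (a + b + c) := by
    module
  rw [e]
  refine openTri_combo (by linarith [ht.2]) ht.1 (by ring) ?_ ?_ ?_ (centroid_mem_openTri hD)
  · rw [cr_sub_left_self, mul_zero]
  · exact hDD.le
  · rw [cr_sub_right_self, mul_zero]

theorem mem_closure_openTri {a b c x : Plane} (hD : orient a b c ≠ 0)
    (hx : x = a ∨ x = b ∨ x = c) : x ∈ closure (openTri a b c) := by
  rcases hx with rfl | rfl | rfl
  · exact left_mem_closure_openTri hD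
  · rw [← openTri_rotate]
    exact left_mem_closure_openTri (by rwa [orient_rotate])
  · rw [openTri_rotate]
    exact left_mem_closure_openTri (by rwa [← orient_rotate])

end OpenTri
end PolygonTriangulation

/-! ### Counting vertices of trees of maximum degree three -/

namespace PolygonTriangulation

section Tree
variable {V : Type*} {G : SimpleGraph V}

/-- The vertices on the far side of the step from `p` to `c`, at distance at most `k` from `c`. -/
def branch (G : SimpleGraph V) (p c : V) (k : ℕ) : Set V :=
  {x | G.dist p x = G.dist c x + 1 ∧ G.dist c x ≤ k}

/-- Coming from `p`, each vertex has at most two onward neighbours, so the count is at most `1 + 2 +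
... + 2 ^ k`. Acyclicity plays no role: overlapping branches only lower the number. -/
theorem ncard_branch_add_one_le [Finite V] (hG : G.Connected)
    (hdeg : ∀ v, (G.neighborSet v).ncard ≤ 3) (k : ℕ) :
    ∀ p c, G.Adj p c → (branch G p c k).ncard + 1 ≤ 2 ^ (k + 1) := by
  induction k with
  | zero =>
    intro p c _
    have : branch G p c 0 ⊆ {c} := by
      rintro x ⟨_, h⟩
      exact (((hG c x).dist_eq_zero_iff).1 (by omega)).symm
    have := Set.ncard_le_ncard this
    simp at this ⊢
    omega
  | succ k ih =>
    intro p c hpc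
    have hN : (G.neighborSet c \ {p}).ncard ≤ 2 := by
      have := Set.ncard_sdiff_singleton_add_one (s := G.neighborSet c) (a := p) hpc.symm
      have := hdeg c
      omega
    have hsub : branch G p c (k + 1) ⊆ {c} ∪ ⋃ d ∈ (Set.toFinite (G.neighborSet c \ {p})).toFinset,
        branch G c d k := by
      rintro x ⟨h1, h2⟩
      by_cases hx : c = x
      · exact Or.inl hx.symm
      right
      obtain ⟨d, hd, hdx⟩ : ∃ d, G.Adj c d ∧ G.dist c x = G.dist d x + 1 := by
        obtain ⟨w, hw⟩ := (hG c x).exists_walk_length_eq_dist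
        cases w with
        | nil => exact absurd rfl hx
        | cons h w =>
          refine ⟨_, h, ?_⟩
          have h3 := G.dist_le w
          have h4 := hG.dist_triangle (u := c) (v := _) (w := x) |>.trans
            (Nat.add_le_add_right (SimpleGraph.dist_eq_one_iff_adj.2 h).le _)
          simp at hw
          omega
      simp only [Set.Finite.mem_toFinset, Set.mem_iUnion]
      refine ⟨d, ⟨hd, ?_⟩, hdx, by omega⟩
      rintro rfl
      omega
    have hcard : (⋃ d ∈ (Set.toFinite (G.neighborSet c \ {p})).toFinset, branch G c d k).ncard ≤
        ∑ d ∈ (Set.toFinite (G.neighborSet c \ {p})).toFinset, (branch G c d k).ncard :=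
      Finset.set_ncard_biUnion_le _ _
    have hsum : ∑ d ∈ (Set.toFinite (G.neighborSet c \ {p})).toFinset, (branch G c d k).ncard ≤
        (Set.toFinite (G.neighborSet c \ {p})).toFinset.card * (2 ^ (k + 1) - 1) := by
      rw [← smul_eq_mul]
      refine Finset.sum_le_card_nsmul _ _ _ fun d hd => ?_
      simp only [Set.Finite.mem_toFinset] at hd
      have := ih c d hd.1
      omega
    rw [← Set.ncard_eq_toFinset_card] at hsum
    have h5 := (Set.ncard_le_ncard hsub (Set.toFinite _)).trans (Set.ncard_union_le _ _)
    rw [Set.ncard_singleton] at h5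
    have h6 := Nat.mul_le_mul_right (2 ^ (k + 1) - 1) hN
    have : 1 ≤ 2 ^ (k + 1) := Nat.one_le_two_pow
    rw [pow_succ 2 (k + 1)]
    omega

theorem length_ge_of_mem_edges {x y a b : V} (w : G.Walk x y) (h : s(a, b) ∈ w.edges) :
    G.dist x a + 1 + G.dist b y ≤ w.length ∨ G.dist x b + 1 + G.dist a y ≤ w.length := by
  have key : ∀ {a b : V} (hab : G.Adj a b), hab.toWalk.IsSubwalk w →
      G.dist x a + 1 + G.dist b y ≤ w.length := by
    rintro a b hab ⟨r, s, rfl⟩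
    have := G.dist_le r
    have := G.dist_le s
    simp
    omega
  have hab := w.adj_of_mem_edges h
  rcases (SimpleGraph.Walk.isSubwalk_toWalk_iff_mem_edges hab).2 h with h | h
  · exact Or.inl (key hab h)
  · exact Or.inr (key hab.symm h)

/-- In an acyclic graph every walk between the two sides of an edge runs through that edge. -/
theorem dist_add_one_add_dist_le (hG : G.Connected) (hA : G.IsAcyclic) {p c x y : V}
    (hpc : G.Adj p c) (hx : G.dist x p = G.dist x c + 1) (hy : G.dist y c = G.dist y p + 1) :
    G.dist x c + 1 + G.dist p y ≤ G.dist x y := by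
  classical
  have hb := (SimpleGraph.isAcyclic_iff_forall_adj_isBridge.1 hA hpc)
  -- A shortest walk from `z` to `b` does not visit the more distant `a`, so it avoids the edge `a
  -- b`.
  have side : ∀ {a b z : V}, G.Adj a b → G.dist z a = G.dist z b + 1 →
      (G.deleteEdges {s(a, b)}).Reachable z b := by
    intro a b z hab hz
    obtain ⟨w, hw⟩ := (hG z b).exists_walk_length_eq_dist
    refine ⟨w.toDeleteEdge s(a, b) fun he => ?_⟩
    have ha := w.fst_mem_support_of_mem_edges he
    have h1 := G.dist_le (w.takeUntil a ha)
    have h2 := w.length_takeUntil_le_length ha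
    omega
  obtain ⟨w, hw⟩ := (hG x y).exists_walk_length_eq_dist
  have hmem : s(p, c) ∈ w.edges := by
    by_contra hnot
    rw [SimpleGraph.isBridge_iff] at hb
    have h1 := side hpc hx
    have h2 := side hpc.symm hy
    rw [Sym2.eq_swap] at h2
    exact hb (h2.symm.trans ((SimpleGraph.Walk.toDeleteEdge _ w hnot).reachable.symm.trans h1))
  have hc := G.dist_comm (u := c) (v := y)
  have hp := G.dist_comm (u := p) (v := y)
  rcases length_ge_of_mem_edges w hmem with h | h <;> omega

/-- A finite tree of maximum degree three and diameter `D` has at most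
`2 ^ (D / 2 + 1) + 2 ^ (D - D / 2) - 2` vertices. -/
theorem card_add_two_le_of_isAcyclic [Finite V] (hG : G.Connected) (hA : G.IsAcyclic)
    (hdeg : ∀ v, (G.neighborSet v).ncard ≤ 3) :
    Nat.card V + 2 ≤ 2 ^ (G.diam / 2 + 1) + 2 ^ (G.diam - G.diam / 2) := by
  have := hG.nonempty
  -- This excludes the default value `diam = 0` of an infinite diameter.
  have htop : G.ediam ≠ ⊤ := SimpleGraph.connected_iff_ediam_ne_top.1 hG
  rcases Nat.eq_zero_or_pos G.diam with h0 | hpos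
  · rcases SimpleGraph.diam_eq_zero.1 h0 with h | h
    · exact absurd h htop
    · have := Finite.card_le_one_iff_subsingleton.2 h
      simp [h0]
  obtain ⟨u, v, huv⟩ := G.exists_dist_eq_diam
  obtain ⟨w, hw⟩ := (hG u v).exists_walk_length_eq_dist
  set D := G.diam with hD
  set k := D / 2 with hk
  have hkD : k < w.length := by omega
  set c := w.getVert k
  set p := w.getVert (k + 1)
  have hcp : G.Adj c p := w.adj_getVert_succ hkD
  have h1 : G.dist u c ≤ k := by
    have := G.dist_le (w.take k)
    simpa [hkD.le] using this
  have h2 : G.dist p v ≤ D - k - 1 := by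
    have := G.dist_le (w.drop (k + 1))
    rw [SimpleGraph.Walk.drop_length] at this
    change G.dist p v ≤ _ at this
    omega
  have h3 := SimpleGraph.dist_eq_one_iff_adj.2 hcp
  have h4 := hG.dist_triangle (u := u) (v := c) (w := v)
  have h5 := hG.dist_triangle (u := c) (v := p) (w := v)
  have h6 := hG.dist_triangle (u := u) (v := c) (w := p)
  have h7 := hG.dist_triangle (u := u) (v := p) (w := v)
  -- From a vertex on the side of `c`, the path to `v` crosses the middle edge and then still needs
  -- `D - k - 1` steps, leaving at most `k` before `c`. The side of `p` is treated with `u`.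
  have hcover : (Set.univ : Set V) ⊆ branch G p c k ∪ branch G c p (D - k - 1) := by
    intro x _
    rcases (show G.IsTree from ⟨hG, hA⟩).dist_eq_dist_add_one_of_adj x hcp with h | h
    · right
      have h8 := dist_add_one_add_dist_le hG hA hcp h (y := u) (by omega)
      have h9 := G.dist_le_diam htop (u := x) (v := u)
      rw [G.dist_comm (u := x), G.dist_comm (u := x)] at h
      rw [G.dist_comm (u := x) (v := p), G.dist_comm (u := c)] at h8
      refine ⟨h, ?_⟩
      omega
    · left
      have h8 := dist_add_one_add_dist_le hG hA hcp.symm h (y := v)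
        (by rw [G.dist_comm (u := v), G.dist_comm (u := v)]; omega)
      have h9 := G.dist_le_diam htop (u := x) (v := v)
      rw [G.dist_comm (u := x), G.dist_comm (u := x)] at h
      rw [G.dist_comm (u := x) (v := c)] at h8
      refine ⟨h, ?_⟩
      omega
  have h8 := (Set.ncard_le_ncard hcover (Set.toFinite _)).trans (Set.ncard_union_le _ _)
  rw [Set.ncard_univ] at h8
  have h9 := ncard_branch_add_one_le hG hdeg k p c hcp.symm
  have h10 := ncard_branch_add_one_le hG hdeg (D - k - 1) c p hcp
  rw [show D - k - 1 + 1 = D - k by omega] at h10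
  omega
end Tree
end PolygonTriangulation

/-! ### The tree of triangles of a chord triangulation -/

namespace PolygonTriangulation

/-- On a cycle, a vertex of least rank has two different neighbours of at least its rank. -/
theorem isAcyclic_of_rank {V : Type*} {G : SimpleGraph V} (rank : V → ℕ)
    (h : ∀ v x y, G.Adj v x → G.Adj v y → rank v ≤ rank x → rank v ≤ rank y → x = y) :
    G.IsAcyclic := by
  classical
  intro u c hc
  obtain ⟨v, hv, hmin⟩ := Finset.exists_min_image c.support.toFinset rank
    ⟨u, by simp⟩
  rw [List.mem_toFinset] at hv
  have hc' := hc.rotate hv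
  have hmem : ∀ w ∈ (c.rotate v hv).support, rank v ≤ rank w := by
    intro w hw
    refine hmin w ?_
    rw [List.mem_toFinset]
    exact (SimpleGraph.Walk.mem_support_rotate_iff c v hv).1 hw
  have hnil := hc'.not_nil
  exact hc'.snd_ne_penultimate (h v _ _ (SimpleGraph.Walk.adj_snd hnil)
    (SimpleGraph.Walk.adj_penultimate hnil).symm
    (hmem _ (SimpleGraph.Walk.getVert_mem_support _ _))
    (hmem _ (SimpleGraph.Walk.getVert_mem_support _ _)))

section Chords
variable {n : ℕ} {T : SimpleGraph (Fin n)}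

/-- The edges of a triangulation of a convex polygon, with the vertices numbered in order. -/
structure IsChordTriangulation (T : SimpleGraph (Fin n)) : Prop where
  base : ∀ a b : Fin n, a.val = 0 → b.val + 1 = n → T.Adj a b
  apex : ∀ a b : Fin n, T.Adj a b → a.val + 1 < b.val →
    ∃ c, a < c ∧ c < b ∧ T.Adj a c ∧ T.Adj c b
  not_interleaved : ∀ a b c d : Fin n, T.Adj a b → T.Adj c d → a < c → c < b → b < d → False

/-- Three increasing, pairwise adjacent vertices. -/
structure TriIn (T : SimpleGraph (Fin n)) where
  /-- the first vertex -/
  l : Fin n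
  /-- the middle vertex -/
  m : Fin n
  /-- the last vertex -/
  r : Fin n
  hlm : l < m
  hmr : m < r
  alm : T.Adj l m
  amr : T.Adj m r
  alr : T.Adj l r

theorem TriIn.ext' {t t' : TriIn T} (hl : t.l = t'.l) (hm : t.m = t'.m) (hr : t.r = t'.r) :
    t = t' := by
  cases t
  cases t'
  simp only at hl hm hr
  subst hl hm hr
  rfl

/-- The vertices of a triangle. -/
def TriIn.IsVertex (t : TriIn T) (x : Fin n) : Prop := x = t.l ∨ x = t.m ∨ x = t.r

/-- Two triangles are adjacent if they share an edge. -/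
def triGraph (T : SimpleGraph (Fin n)) : SimpleGraph (TriIn T) where
  Adj t t' := t ≠ t' ∧ ∃ x y, T.Adj x y ∧ t.IsVertex x ∧ t.IsVertex y ∧ t'.IsVertex x ∧
    t'.IsVertex y
  symm := ⟨fun _ _ ⟨h, x, y, hxy, h1, h2, h3, h4⟩ => ⟨h.symm, x, y, hxy, h3, h4, h1, h2⟩⟩
  loopless := ⟨fun _ h => h.1 rfl⟩

instance : Finite (TriIn T) :=
  Finite.of_injective (fun t => (t.l, t.m, t.r)) fun t t' h => by
    simp only [Prod.mk.injEq] at h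
    exact TriIn.ext' h.1 h.2.1 h.2.2

/-- The long side of `t'` is a short side of `t`. -/
def IsChild (t t' : TriIn T) : Prop :=
  (t'.l = t.l ∧ t'.r = t.m) ∨ (t'.l = t.m ∧ t'.r = t.r)

namespace IsChordTriangulation

/-- If the outer vertices differed, a short side of one triangle would interleave with the long side
of the other. -/
theorem eq_of_m_eq (h : IsChordTriangulation T) {t t' : TriIn T} (hm : t.m = t'.m) : t = t' := by
  have a1 := t.alm
  have a2 := t.amr
  have b1 := t.hlm
  have b2 := t.hmr
  rw [hm] at a1 a2 b1 b2
  refine TriIn.ext' ?_ hm ?_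
  · rcases lt_trichotomy t.l t'.l with hl | hl | hl
    · exact (h.not_interleaved _ _ _ _ a1 t'.alr hl t'.hlm t'.hmr).elim
    · exact hl
    · exact (h.not_interleaved _ _ _ _ t'.alm t.alr hl b1 b2).elim
  · rcases lt_trichotomy t.r t'.r with hl | hl | hl
    · exact (h.not_interleaved _ _ _ _ t.alr t'.amr b1 b2 hl).elim
    · exact hl
    · exact (h.not_interleaved _ _ _ _ t'.alr a2 t'.hlm t'.hmr hl).elim

theorem eq_of_lr_eq (h : IsChordTriangulation T) {t t' : TriIn T} (hl : t.l = t'.l)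
    (hr : t.r = t'.r) : t = t' := by
  rcases lt_trichotomy t.m t'.m with hm | hm | hm
  · have := t.amr
    rw [hr] at this
    exact (h.not_interleaved _ _ _ _ t'.alm this (hl ▸ t.hlm) hm t'.hmr).elim
  · exact h.eq_of_m_eq hm
  · have := t'.amr
    rw [← hr] at this
    exact (h.not_interleaved _ _ _ _ t.alm this (hl ▸ t'.hlm) hm t.hmr).elim

/-- The shortest chord passing over `b` has its apex at `b`, since any other apex yields a shorter
chord over `b`. Each of the `n - 2` inner vertices thus contributes a triangle. -/
theorem exists_m_eq (h : IsChordTriangulation T) (hn : 3 ≤ n) (b : Fin n) (h0 : 0 < b.val)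
    (h1 : b.val + 1 < n) :
    ∃ t : TriIn T, t.m = b := by
  classical
  obtain ⟨⟨a, c⟩, hp, hmin⟩ := Finset.exists_min_image
    (Finset.univ.filter fun p : Fin n × Fin n => T.Adj p.1 p.2 ∧ p.1 < b ∧ b < p.2)
    (fun p => p.2.val - p.1.val) ⟨(⟨0, by omega⟩, ⟨n - 1, by omega⟩), by
      rw [Finset.mem_filter]
      exact ⟨Finset.mem_univ _, h.base _ _ rfl (by simp only; omega), h0,
        by rw [Fin.lt_def]; simp only; omega⟩⟩
  rw [Finset.mem_filter] at hp
  obtain ⟨-, hac, hab, hbc⟩ := hp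
  simp only at hac hab hbc
  obtain ⟨d, had, hdc, aad, adc⟩ := h.apex a c hac (by rw [Fin.lt_def] at hab hbc; omega)
  rcases lt_trichotomy b d with hd | hd | hd
  · have := hmin (a, d) (by
      rw [Finset.mem_filter]
      exact ⟨Finset.mem_univ _, aad, hab, hd⟩)
    simp only [Fin.lt_def] at *
    omega
  · subst hd
    exact ⟨⟨a, b, c, had, hdc, aad, adc, hac⟩, rfl⟩
  · have := hmin (d, c) (by
      rw [Finset.mem_filter]
      exact ⟨Finset.mem_univ _, adc, hd, hbc⟩)
    simp only [Fin.lt_def] at *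
    omega

theorem le_card (h : IsChordTriangulation T) (hn : 3 ≤ n) : n ≤ Nat.card (TriIn T) + 2 := by
  have hx : ∀ b : Fin (n - 2), ∃ t : TriIn T, t.m.val = b.val + 1 := by
    intro b
    obtain ⟨t, ht⟩ := h.exists_m_eq hn ⟨b.val + 1, by omega⟩ (by simp) (by simp only; omega)
    exact ⟨t, by rw [ht]⟩
  choose f hf using hx
  have hinj : Function.Injective f := fun b b' hb => Fin.ext (by
    have := hf b
    rw [hb, hf b'] at this
    omega)
  have := Nat.card_le_card_of_injective f hinj
  rw [Nat.card_fin] at this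
  omega

/-- A shared edge in the same role makes the triangles equal, and a left short side of one as right
short side of the other makes the long sides interleave. What remains is long against short. -/
theorem adj_iff (h : IsChordTriangulation T) {t t' : TriIn T} :
    (triGraph T).Adj t t' ↔ IsChild t t' ∨ IsChild t' t := by
  have key : ∀ {t t' : TriIn T}, IsChild t t' → (triGraph T).Adj t t' := by
    intro t t' hc
    have h1 := t.hlm
    have h2 := t.hmr
    rcases hc with ⟨e1, e2⟩ | ⟨e1, e2⟩
    · exact ⟨fun e => h2.ne (by rw [← e2, e]), t.l, t.m, t.alm, Or.inl rfl, Or.inr (Or.inl rfl),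
        Or.inl e1.symm, Or.inr (Or.inr e2.symm)⟩
    · exact ⟨fun e => h1.ne (by rw [← e1, e]), t.m, t.r, t.amr, Or.inr (Or.inl rfl),
        Or.inr (Or.inr rfl), Or.inl e1.symm, Or.inr (Or.inr e2.symm)⟩
  constructor
  · rintro ⟨hne, x, y, hxy, hx, hy, hx', hy'⟩
    wlog hlt : x < y generalizing x y
    · exact this y x hxy.symm hy hx hy' hx' (lt_of_le_of_ne (not_lt.1 hlt) hxy.ne.symm)
    have cases : ∀ t : TriIn T, t.IsVertex x → t.IsVertex y →
        (x = t.l ∧ y = t.m) ∨ (x = t.m ∧ y = t.r) ∨ (x = t.l ∧ y = t.r) := by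
      intro t hx hy
      have h1 := t.hlm
      have h2 := t.hmr
      rcases hx with e1 | e1 | e1 <;> rcases hy with e2 | e2 | e2 <;> rw [e1, e2] at hlt ⊢ <;>
        first
          | exact absurd hlt (lt_irrefl _)
          | exact absurd hlt (not_lt.2 h1.le)
          | exact absurd hlt (not_lt.2 h2.le)
          | exact absurd hlt (not_lt.2 (h1.trans h2).le)
          | simp
    rcases cases t hx hy with ⟨e1, e2⟩ | ⟨e1, e2⟩ | ⟨e1, e2⟩ <;>
      rcases cases t' hx' hy' with ⟨e3, e4⟩ | ⟨e3, e4⟩ | ⟨e3, e4⟩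
    · exact absurd (h.eq_of_m_eq (e2.symm.trans e4)) hne
    · have a1 := t'.alr
      have a2 := t.alr
      rw [← e4] at a1
      rw [← e1] at a2
      have h1 := t'.hlm
      rw [← e3] at h1
      have h2 := t.hmr
      rw [← e2] at h2
      exact (h.not_interleaved _ _ _ _ a1 a2 h1 hlt h2).elim
    · exact Or.inl (Or.inl ⟨e3.symm.trans e1, e4.symm.trans e2⟩)
    · have a1 := t'.alr
      have a2 := t.alr
      rw [← e3] at a1
      rw [← e2] at a2
      have h1 := t'.hmr
      rw [← e4] at h1
      have h2 := t.hlm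
      rw [← e1] at h2
      exact (h.not_interleaved _ _ _ _ a2 a1 h2 hlt h1).elim
    · exact absurd (h.eq_of_m_eq (e1.symm.trans e3)) hne
    · exact Or.inl (Or.inr ⟨e3.symm.trans e1, e4.symm.trans e2⟩)
    · exact Or.inr (Or.inl ⟨e1.symm.trans e3, e2.symm.trans e4⟩)
    · exact Or.inr (Or.inr ⟨e1.symm.trans e3, e2.symm.trans e4⟩)
    · exact absurd (h.eq_of_lr_eq (e1.symm.trans e3) (e2.symm.trans e4)) hne
  · rintro (hc | hc)
    exacts [key hc, (key hc).symm]

theorem parent_unique (h : IsChordTriangulation T) {t t' c : TriIn T} (h1 : IsChild t c)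
    (h2 : IsChild t' c) : t = t' := by
  have key : ∀ {t t' : TriIn T}, (c.l = t.l ∧ c.r = t.m) → (c.l = t'.m ∧ c.r = t'.r) → t = t' := by
    rintro t t' ⟨e1, e2⟩ ⟨e3, e4⟩
    have a1 := t'.alr
    have a2 := t.alr
    have b1 := t'.hlm
    have b2 := t.hmr
    rw [← e4] at a1
    rw [← e1] at a2
    rw [← e3] at b1
    rw [← e2] at b2
    exact (h.not_interleaved _ _ _ _ a1 a2 b1 (c.hlm.trans c.hmr) b2).elim
  rcases h1 with h1 | h1 <;> rcases h2 with h2 | h2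
  · exact h.eq_of_m_eq (h1.2.symm.trans h2.2)
  · exact key h1 h2
  · exact (key h2 h1).symm
  · exact h.eq_of_m_eq (h1.1.symm.trans h2.1)

/-- Take a shortest chord that spans the long side of `c` and differs from it. Its apex cannot fall
strictly inside, by non-interleaving, so minimality makes the long side of `c` a short side of that
triangle. -/
theorem exists_parent (h : IsChordTriangulation T) (c : TriIn T)
    (hc : 0 < c.l.val ∨ c.r.val + 1 < n) :
    ∃ t, IsChild t c := by
  classical
  have hlr := c.hlm.trans c.hmr
  have hr := c.r.isLt
  obtain ⟨⟨x, y⟩, hp, hmin⟩ := Finset.exists_min_image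
    (Finset.univ.filter fun p : Fin n × Fin n =>
      T.Adj p.1 p.2 ∧ p.1 ≤ c.l ∧ c.r ≤ p.2 ∧ p ≠ (c.l, c.r))
    (fun p => p.2.val - p.1.val) ⟨(⟨0, by omega⟩, ⟨n - 1, by omega⟩), by
      rw [Finset.mem_filter]
      refine ⟨Finset.mem_univ _, h.base _ _ rfl (by simp only; omega), ?_, ?_, ?_⟩
      · rw [Fin.le_def]
        simp
      · rw [Fin.le_def]
        simp only
        omega
      · rw [Ne, Prod.mk.injEq, Fin.ext_iff, Fin.ext_iff]
        simp only
        omega⟩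
  rw [Finset.mem_filter] at hp
  obtain ⟨-, hxy, hxl, hry, hne⟩ := hp
  simp only at hxy hxl hry
  have hcm1 := c.hlm
  have hcm2 := c.hmr
  obtain ⟨d, hxd, hdy, axd, ady⟩ := h.apex x y hxy (by
    rw [Fin.lt_def] at hcm1 hcm2
    rw [Fin.le_def] at hxl hry
    omega)
  rcases le_or_gt d c.l with hd | hd
  · have hdl : (d, y) = (c.l, c.r) := by
      by_contra hne'
      have := hmin (d, y) (by
        rw [Finset.mem_filter]
        exact ⟨Finset.mem_univ _, ady, hd, hry, hne'⟩)
      simp only [Fin.lt_def] at *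
      omega
    rw [Prod.mk.injEq] at hdl
    exact ⟨⟨x, d, y, hxd, hdy, axd, ady, hxy⟩, Or.inr ⟨hdl.1.symm, hdl.2.symm⟩⟩
  rcases le_or_gt c.r d with hd' | hd'
  · have hdl : (x, d) = (c.l, c.r) := by
      by_contra hne'
      have := hmin (x, d) (by
        rw [Finset.mem_filter]
        exact ⟨Finset.mem_univ _, axd, hxl, hd', hne'⟩)
      simp only [Fin.lt_def] at *
      omega
    rw [Prod.mk.injEq] at hdl
    exact ⟨⟨x, d, y, hxd, hdy, axd, ady, hxy⟩, Or.inl ⟨hdl.1.symm, hdl.2.symm⟩⟩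
  exfalso
  rcases hxl.eq_or_lt with e1 | l1
  · rcases hry.eq_or_lt with e2 | l2
    · exact hne (by rw [e1, e2])
    · exact h.not_interleaved _ _ _ _ c.alr ady hd hd' l2
  · exact h.not_interleaved _ _ _ _ axd c.alr l1 hd hd'

theorem rank_lt {t c : TriIn T} (hc : IsChild t c) :
    c.r.val - c.l.val < t.r.val - t.l.val := by
  have h1 := t.hlm
  have h2 := t.hmr
  have h3 := c.hlm
  have h4 := c.hmr
  simp only [Fin.lt_def] at h1 h2 h3 h4
  rcases hc with ⟨e1, e2⟩ | ⟨e1, e2⟩ <;> rw [e1, e2] at * <;> omega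

theorem isAcyclic (h : IsChordTriangulation T) : (triGraph T).IsAcyclic := by
  -- The span of the long side drops from parent to child, so only the unique parent can have rank
  -- at least that of `v`.
  refine isAcyclic_of_rank (fun t => t.r.val - t.l.val) fun v x y hx hy hvx hvy => ?_
  have key : ∀ {z}, (triGraph T).Adj v z → v.r.val - v.l.val ≤ z.r.val - z.l.val → IsChild z v := by
    intro z hz hle
    rcases h.adj_iff.1 hz with hc | hc
    · exact absurd (rank_lt hc) (not_lt.2 hle)
    · exact hc
  exact h.parent_unique (key hx hvx) (key hy hvy)

/-- Passing to parents widens the span until the triangle on the base chord from `0` to `n - 1` is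
reached. -/
theorem connected (h : IsChordTriangulation T) (hn : 3 ≤ n) : (triGraph T).Connected := by
  obtain ⟨d, hd1, hd2, ad1, ad2⟩ := h.apex ⟨0, by omega⟩ ⟨n - 1, by omega⟩
    (h.base _ _ rfl (by simp only; omega)) (by simp only; omega)
  set root : TriIn T := ⟨_, d, _, hd1, hd2, ad1, ad2, h.base _ _ rfl (by simp only; omega)⟩
    with hroot
  have hreach : ∀ k, ∀ t : TriIn T, n - (t.r.val - t.l.val) = k →
    (triGraph T).Reachable t root := by
    intro k
    induction k using Nat.strong_induction_on with
    | _ k ih =>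
      intro t ht
      by_cases hc : 0 < t.l.val ∨ t.r.val + 1 < n
      · obtain ⟨p, hp⟩ := h.exists_parent t hc
        have h1 := rank_lt hp
        have h2 := p.r.isLt
        have h3 : (triGraph T).Adj t p := h.adj_iff.2 (Or.inr hp)
        exact h3.reachable.trans (ih _ (by omega) p rfl)
      · have h2 := t.r.isLt
        have : t = root := by
          apply h.eq_of_lr_eq
          · apply Fin.ext
            simp only [hroot]
            omega
          · apply Fin.ext
            simp only [hroot]
            omega
        rw [this]
  have : Nonempty (TriIn T) := ⟨root⟩
  exact ⟨fun t t' => (hreach _ t rfl).trans (hreach _ t' rfl).symm⟩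

theorem ncard_neighborSet_le (h : IsChordTriangulation T) (t : TriIn T) :
    ((triGraph T).neighborSet t).ncard ≤ 3 := by
  have hsub : (triGraph T).neighborSet t ⊆
      ({c | c.l = t.l ∧ c.r = t.m} ∪ {c | c.l = t.m ∧ c.r = t.r}) ∪ {p | IsChild p t} := by
    intro c hc
    rcases h.adj_iff.1 hc with hc | hc
    exacts [Or.inl hc, Or.inr hc]
  have h1 : ({c : TriIn T | c.l = t.l ∧ c.r = t.m}).ncard ≤ 1 :=
    (Set.ncard_le_one (Set.toFinite _)).2 fun a ha b hb =>
      h.eq_of_lr_eq (ha.1.trans hb.1.symm) (ha.2.trans hb.2.symm)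
  have h2 : ({c : TriIn T | c.l = t.m ∧ c.r = t.r}).ncard ≤ 1 :=
    (Set.ncard_le_one (Set.toFinite _)).2 fun a ha b hb =>
      h.eq_of_lr_eq (ha.1.trans hb.1.symm) (ha.2.trans hb.2.symm)
  have h3 : ({p : TriIn T | IsChild p t}).ncard ≤ 1 :=
    (Set.ncard_le_one (Set.toFinite _)).2 fun a ha b hb => h.parent_unique ha hb
  have h4 := (Set.ncard_le_ncard hsub (Set.toFinite _)).trans (Set.ncard_union_le _ _)
  have h5 := Set.ncard_union_le {c : TriIn T | c.l = t.l ∧ c.r = t.m}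
    {c : TriIn T | c.l = t.m ∧ c.r = t.r}
  omega

end IsChordTriangulation
end Chords
end PolygonTriangulation

/-! ### Bounded faces are triangles -/

namespace PolygonTriangulation
open Filter Topology

section Faces
variable {n : ℕ} {P : Polygon Plane n} {T : SimpleGraph (Fin n)}

theorem IsTriangulation.isChordTriangulation (hn : 3 ≤ n) (hP : IsSimple P)
    (hT : IsTriangulation P T) : IsChordTriangulation T where
  base a b ha hb := by
    have h := hT.adj_finRotate hn hP b
    have e : finRotate n b = a := Fin.ext (by rw [val_finRotate, if_pos hb, ha])
    rw [e] at h
    exact h.symm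
  apex _ _ hab hlt := hT.exists_apex hn hP hab hlt
  not_interleaved _ _ _ _ hab hcd h1 h2 h3 := hT.not_interleaved hn hP hab hcd h1 h2 h3

/-- The open triangle in the plane spanned by a triangle of the graph. -/
def TriIn.face (P : Polygon Plane n) (t : TriIn T) : Set Plane := openTri (P t.l) (P t.m) (P t.r)

/-- The sides in the plane of a triangle of the graph. -/
def TriIn.edges (P : Polygon Plane n) (t : TriIn T) : Multiset (Plane × Plane) :=
  triEdges (P t.l) (P t.m) (P t.r)

theorem TriIn.isDrawn_edges (t : TriIn T) : IsDrawn P T (t.edges P) := by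
  intro e he
  simp only [TriIn.edges, triEdges, Multiset.insert_eq_cons, Multiset.mem_cons,
    Multiset.mem_singleton] at he
  rcases he with rfl | rfl | rfl
  exacts [⟨_, _, t.alm, rfl⟩, ⟨_, _, t.amr, rfl⟩, ⟨_, _, t.alr.symm, rfl⟩]

theorem TriIn.segment_subset_trace (t : TriIn T) {x y : Fin n} (hx : t.IsVertex x)
    (hy : t.IsVertex y) (hxy : x ≠ y) : segment ℝ (P x) (P y) ⊆ trace (t.edges P) := by
  intro z hz
  rw [TriIn.edges, mem_trace_triEdges]
  have hz' := hz
  rw [segment_symm] at hz'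
  rcases hx with rfl | rfl | rfl <;> rcases hy with rfl | rfl | rfl <;> tauto

theorem TriIn.orient_ne_zero (hC : IsCrossingFreeIn P T) (t : TriIn T) :
    orient (P t.l) (P t.m) (P t.r) ≠ 0 := by
  have h1 := t.hlm
  have h2 := t.hmr
  refine orient_ne_zero_of_notMem (fun h => ?_) (fun h => ?_) fun h => ?_
  · rcases hC.vertex_mem _ _ _ t.amr h with e | e
    exacts [h1.ne e, (h1.trans h2).ne e]
  · rcases hC.vertex_mem _ _ _ t.alr h with e | e
    exacts [h1.ne' e, h2.ne e]
  · rcases hC.vertex_mem _ _ _ t.alm h with e | e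
    exacts [(h1.trans h2).ne' e, h2.ne' e]

theorem TriIn.face_subset_insideSet (t : TriIn T) : t.face P ⊆ insideSet (trace (t.edges P)) :=
  fun _ hz => mem_insideSet_of_wind_ne_zero (balanced_triEdges _ _ _)
    (notMem_trace_of_mem_openTri hz) (wind_triEdges_ne_zero hz)

/-- An edge meeting the open triangle would have both ends among its vertices, hence be one of its
sides, and these miss the open triangle. -/
theorem TriIn.face_subset_compl_drawing (hn : 3 ≤ n) (hP : IsSimple P)
    (hC : IsCrossingFreeIn P T) (t : TriIn T) : t.face P ⊆ (drawing P T)ᶜ := by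
  intro z hz hzd
  have hin := t.face_subset_insideSet hz
  have hD := t.isDrawn_edges (P := P)
  have hb := (hP.insideSet_subset hn (isClosed_trace _) (hD.trace_subset hC) hin).2
  rcases hzd with ⟨i, rfl⟩ | ⟨x, y, hxy, hzxy⟩
  · exact hb (vertex_mem_boundary i)
  · have key : ∀ {x y : Fin n}, T.Adj x y → z ∈ segment ℝ (P x) (P y) → t.IsVertex x := by
      intro x y hxy hzxy
      obtain ⟨e, he, hxe⟩ := hD.exists_end_eq hn hP hC hin hxy hzxy
      simp only [TriIn.edges, triEdges, Multiset.insert_eq_cons, Multiset.mem_cons,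
        Multiset.mem_singleton] at he
      unfold TriIn.IsVertex
      rcases he with rfl | rfl | rfl <;> rcases hxe with e | e <;> have e := hP.1 e <;> tauto
    exact hin.1 (t.segment_subset_trace (key hxy hzxy)
      (key hxy.symm (by rwa [segment_symm])) hxy.ne hzxy)

/-- The triangle is connected and open, and a connected set off the drawing cannot leave it because
its frontier is drawn. -/
theorem TriIn.connectedComponentIn_eq_face (hn : 3 ≤ n) (hP : IsSimple P)
    (hC : IsCrossingFreeIn P T) (t : TriIn T) {x : Plane} (hx : x ∈ t.face P) :
    connectedComponentIn (drawing P T)ᶜ x = t.face P := by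
  have hsub := t.face_subset_compl_drawing hn hP hC
  refine Set.Subset.antisymm ?_
    ((convex_openTri _ _ _).isPreconnected.subset_connectedComponentIn hx hsub)
  refine isPreconnected_connectedComponentIn.subset_of_closure_inter_subset (isOpen_openTri _ _ _)
    ⟨x, mem_connectedComponentIn (hsub hx), hx⟩ ?_
  rintro y ⟨hy, hyc⟩
  refine (closure_openTri_subset (t.orient_ne_zero hC) hy).resolve_right fun hyt => ?_
  exact connectedComponentIn_subset _ _ hyc (t.isDrawn_edges.trace_subset_drawing hyt)

theorem TriIn.isBoundedFace_face (hn : 3 ≤ n) (hP : IsSimple P) (hC : IsCrossingFreeIn P T)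
    (t : TriIn T) : IsBoundedFace P T (t.face P) := by
  have hx : (1 / 3 : ℝ) • (P t.l + P t.m + P t.r) ∈ t.face P :=
    centroid_mem_openTri (t.orient_ne_zero hC)
  refine ⟨?_, _, t.face_subset_compl_drawing hn hP hC hx,
    (t.connectedComponentIn_eq_face hn hP hC hx).symm⟩
  rw [← t.connectedComponentIn_eq_face hn hP hC hx]
  exact (t.face_subset_insideSet hx).2.subset (connectedComponentIn_mono _
    (Set.compl_subset_compl.2 t.isDrawn_edges.trace_subset_drawing))

theorem TriIn.mem_closure_face_iff (hn : 3 ≤ n) (hP : IsSimple P) (hC : IsCrossingFreeIn P T)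
    (t : TriIn T) {x : Fin n} : P x ∈ closure (t.face P) ↔ t.IsVertex x := by
  constructor
  · intro h
    rcases closure_openTri_subset (t.orient_ne_zero hC) h with h | h
    · exact absurd (Or.inl ⟨x, rfl⟩) (t.face_subset_compl_drawing hn hP hC h)
    · unfold TriIn.IsVertex
      rcases mem_trace_triEdges.1 h with h | h | h
      · have := hC.vertex_mem _ _ _ t.alm h
        tauto
      · have := hC.vertex_mem _ _ _ t.amr h
        tauto
      · have := hC.vertex_mem _ _ _ t.alr.symm h
        tauto
  · intro h
    refine mem_closure_openTri (t.orient_ne_zero hC) ?_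
    rcases h with rfl | rfl | rfl <;> simp

theorem TriIn.segment_subset_closure_face_iff (hn : 3 ≤ n) (hP : IsSimple P)
    (hC : IsCrossingFreeIn P T) (t : TriIn T) {x y : Fin n} :
    segment ℝ (P x) (P y) ⊆ closure (t.face P) ↔ t.IsVertex x ∧ t.IsVertex y := by
  rw [← t.mem_closure_face_iff hn hP hC, ← t.mem_closure_face_iff hn hP hC]
  exact ⟨fun h => ⟨h (left_mem_segment _ _ _), h (right_mem_segment _ _ _)⟩,
    fun h => (convex_openTri _ _ _).closure.segment_subset h.1 h.2⟩

theorem TriIn.eq_of_isVertex_iff {t t' : TriIn T} (h : ∀ x, t.IsVertex x ↔ t'.IsVertex x) :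
    t = t' := by
  have h1 := t.hlm
  have h2 := t.hmr
  have h3 := t'.hlm
  have h4 := t'.hmr
  have a1 := (h t.l).1 (Or.inl rfl)
  have a2 := (h t.m).1 (Or.inr (Or.inl rfl))
  have a3 := (h t.r).1 (Or.inr (Or.inr rfl))
  simp only [TriIn.IsVertex, Fin.ext_iff, Fin.lt_def] at *
  refine TriIn.ext' (Fin.ext ?_) (Fin.ext ?_) (Fin.ext ?_) <;> omega

theorem TriIn.face_injective (hn : 3 ≤ n) (hP : IsSimple P) (hC : IsCrossingFreeIn P T) :
    Function.Injective (TriIn.face P : TriIn T → Set Plane) := fun t t' h =>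
  TriIn.eq_of_isVertex_iff fun x => by
    rw [← t.mem_closure_face_iff hn hP hC, ← t'.mem_closure_face_iff hn hP hC, h]

/-- At the apex the winding splits into two smaller loops and a triangle, one of which must be
nonzero; nonzero winding of the triangle means that `x` is in it. -/
theorem IsTriangulation.exists_mem_face_of_wind_underLoop (hn : 3 ≤ n) (hP : IsSimple P)
    (hT : IsTriangulation P T) {x : Plane} (hx : x ∉ drawing P T) (k : ℕ) :
    ∀ a b : Fin n, b.val = a.val + k + 1 → T.Adj a b → wind (underLoop P a b) x ≠ 0 →
      ∃ t : TriIn T, x ∈ t.face P := by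
  have hseg : ∀ {a b : Fin n}, T.Adj a b → x ∉ segment ℝ (P a) (P b) :=
    fun hab h => hx (Or.inr ⟨_, _, hab, h⟩)
  induction k using Nat.strong_induction_on with
  | _ k ih =>
    intro a b hk hab hw
    rcases Nat.eq_zero_or_pos k with rfl | hpos
    · exact absurd (wind_underLoop_of_succ hk.symm (hseg hab)) hw
    obtain ⟨c, hac, hcb, aac, acb⟩ := hT.exists_apex hn hP hab (by omega)
    have hac' : a.val < c.val := hac
    have hcb' : c.val < b.val := hcb
    rw [wind_underLoop_eq_add hac.le hcb.le (hseg aac) (hseg acb)] at hw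
    by_cases h1 : wind (underLoop P a c) x = 0
    · by_cases h2 : wind (underLoop P c b) x = 0
      · rw [h1, h2, zero_add, zero_add] at hw
        let t : TriIn T := ⟨a, c, b, hac, hcb, aac, acb, hab⟩
        refine ⟨t, ?_⟩
        by_contra hxt
        exact hw (wind_triEdges_eq_zero (t.orient_ne_zero hT.prop) hxt
          fun h => hx (t.isDrawn_edges.trace_subset_drawing h))
      · exact ih (b.val - c.val - 1) (by omega) c b (by omega) acb h2
    · exact ih (c.val - a.val - 1) (by omega) a c (by omega) aac h1

theorem IsTriangulation.exists_face_eq (hn : 3 ≤ n) (hP : IsSimple P) (hT : IsTriangulation P T)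
    {F : Set Plane} (hF : IsBoundedFace P T F) : ∃ t : TriIn T, t.face P = F := by
  obtain ⟨hb, x, hx, rfl⟩ := hF
  have hC := hT.prop
  have hxb : x ∉ P.boundary ℝ := fun h => hx (hT.boundary_subset_drawing hn hP h)
  -- Otherwise the unbounded component of `x` off the boundary would miss the drawing altogether and
  -- be part of the bounded face.
  have hin : x ∈ inside P := by
    refine ⟨hxb, ?_⟩
    by_contra hunb
    refine hunb (hb.subset (isPreconnected_connectedComponentIn.subset_connectedComponentIn
      (mem_connectedComponentIn hxb) fun y hy hyd => ?_))
    rcases hC.drawing_subset_region hyd with hyb | hyi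
    · exact connectedComponentIn_subset _ _ hy hyb
    · exact hunb (connectedComponentIn_eq hy ▸ hyi.2)
  have hw := hP.wind_ne_zero hn hin
  rw [← wind_underLoop_zero_last (a := ⟨0, by omega⟩) (b := ⟨n - 1, by omega⟩) rfl
    (by simp only; omega)] at hw
  obtain ⟨t, ht⟩ := hT.exists_mem_face_of_wind_underLoop hn hP hx (n - 2) _ _
    (by simp only; omega) ((hT.isChordTriangulation hn hP).base _ _ rfl (by simp only; omega)) hw
  exact ⟨t, (t.connectedComponentIn_eq_face hn hP hC ht).symm⟩

theorem IsTriangulation.exists_iso_dualGraph (hn : 3 ≤ n) (hP : IsSimple P)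
    (hT : IsTriangulation P T) : Nonempty (triGraph T ≃g dualGraph P T) := by
  have hC := hT.prop
  let f : TriIn T → {F : Set Plane // IsBoundedFace P T F} :=
    fun t => ⟨t.face P, t.isBoundedFace_face hn hP hC⟩
  have hf : Function.Bijective f :=
    ⟨fun t t' h => TriIn.face_injective hn hP hC (congrArg Subtype.val h), fun F => by
      obtain ⟨t, ht⟩ := hT.exists_face_eq hn hP F.2
      exact ⟨t, Subtype.ext ht⟩⟩
  refine ⟨⟨Equiv.ofBijective f hf, fun {t t'} => ?_⟩⟩
  change (f t ≠ f t' ∧ ∃ a b, T.Adj a b ∧ segment ℝ (P a) (P b) ⊆ closure (t.face P) ∧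
    segment ℝ (P a) (P b) ⊆ closure (t'.face P)) ↔ _
  simp only [TriIn.segment_subset_closure_face_iff hn hP hC, hf.1.ne_iff, triGraph, and_assoc]

end Faces

/-! ### The bound on the dual diameter -/

section Diameter
variable {n : ℕ} {P : Polygon Plane n} {T : SimpleGraph (Fin n)}

/-- The number of vertices of a triangulated polygon is bounded in terms of the dual diameter. -/
theorem IsTriangulation.le_pow_dualDiameter (hn : 3 ≤ n) (hP : IsSimple P)
    (hT : IsTriangulation P T) :
    n ≤ 2 ^ (dualDiameter P T / 2 + 1) + 2 ^ (dualDiameter P T - dualDiameter P T / 2) := by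
  obtain ⟨e⟩ := hT.exists_iso_dualGraph hn hP
  have h := hT.isChordTriangulation hn hP
  have : Finite {F : Set Plane // IsBoundedFace P T F} := Finite.of_equiv _ e.toEquiv
  refine ((h.le_card hn).trans_eq (by rw [Nat.card_congr e.toEquiv])).trans
    (card_add_two_le_of_isAcyclic (G := dualGraph P T) (e.connected_iff.1 (h.connected hn))
      (e.isAcyclic_iff.1 h.isAcyclic) fun v => ?_)
  obtain ⟨t, rfl⟩ := e.surjective v
  refine le_trans (le_of_eq ?_) (h.ncard_neighborSet_le t)
  exact (Nat.card_congr (e.mapNeighborSet t)).symm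

theorem ceil_logb_eq {n m : ℕ} (hm : 1 ≤ m) (h1 : 3 * 2 ^ (m - 1) < n) (h2 : n ≤ 3 * 2 ^ m) :
    ⌈Real.logb 2 ((n : ℝ) / 3)⌉ = m := by
  have h1' : (3 : ℝ) * 2 ^ (m - 1) < n := by exact_mod_cast h1
  have h2' : (n : ℝ) ≤ 3 * 2 ^ m := by exact_mod_cast h2
  have hpos : (0 : ℝ) < n / 3 := by
    have : (0 : ℝ) < 3 * 2 ^ (m - 1) := by positivity
    linarith
  rw [Int.ceil_eq_iff]
  constructor
  · rw [Real.lt_logb_iff_rpow_lt one_lt_two hpos]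
    have e : ((m : ℤ) : ℝ) - 1 = ((m - 1 : ℕ) : ℝ) := by
      rw [Nat.cast_sub hm]
      simp
    rw [e, Real.rpow_natCast]
    linarith
  · rw [Real.logb_le_iff_le_rpow one_lt_two hpos, Int.cast_natCast, Real.rpow_natCast]
    linarith

theorem pow_half_add_pow_le {d k : ℕ} (h : d ≤ k) :
    2 ^ (d / 2 + 1) + 2 ^ (d - d / 2) ≤ 2 ^ (k / 2 + 1) + 2 ^ (k - k / 2) :=
  add_le_add (Nat.pow_le_pow_right two_pos (by omega)) (Nat.pow_le_pow_right two_pos (by omega))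

end Diameter
end PolygonTriangulation

theorem corollary2 (n m : ℕ) (hn : 3 ≤ n) (hm : 1 ≤ m)
    (hnm : n ∈ Finset.Icc (3 * 2 ^ (m - 1) + 1) (3 * 2 ^ m))
    (P : Polygon PolygonTriangulation.Plane n) (hP : PolygonTriangulation.IsSimple P)
    (T : SimpleGraph (Fin n)) (hT : PolygonTriangulation.IsTriangulation P T) :
    (n ∈ Finset.Icc (3 * 2 ^ (m - 1) + 1) (4 * 2 ^ (m - 1)) →
      2 * ⌈Real.logb 2 ((n : ℝ) / 3)⌉ - 1 ≤ (PolygonTriangulation.dualDiameter P T : ℤ)) ∧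
    (n ∈ Finset.Icc (4 * 2 ^ (m - 1) + 1) (3 * 2 ^ m) →
      2 * ⌈Real.logb 2 ((n : ℝ) / 3)⌉ ≤ (PolygonTriangulation.dualDiameter P T : ℤ)) := by
  rw [Finset.mem_Icc] at hnm
  rw [PolygonTriangulation.ceil_logb_eq hm hnm.1 hnm.2]
  have hle := hT.le_pow_dualDiameter hn hP
  set D := PolygonTriangulation.dualDiameter P T
  obtain ⟨k, rfl⟩ := Nat.exists_eq_add_of_le' hm
  simp only [Finset.mem_Icc, Nat.add_sub_cancel] at hnm ⊢
  refine ⟨fun _ => ?_, fun h => ?_⟩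
  · by_contra hlt
    -- With `k = m - 1`, diameter `2 * k` allows at most `2 ^ (k + 1) + 2 ^ k = 3 * 2 ^ k` polygon
    -- vertices.
    have hD := PolygonTriangulation.pow_half_add_pow_le (show D ≤ 2 * k by omega)
    rw [show 2 * k / 2 = k by omega, show 2 * k - k = k by omega, pow_succ] at hD
    omega
  · by_contra hlt
    -- Diameter `2 * k + 1` allows at most `2 ^ (k + 1) + 2 ^ (k + 1) = 4 * 2 ^ k`.
    have hD := PolygonTriangulation.pow_half_add_pow_le (show D ≤ 2 * k + 1 by omega)
    rw [show (2 * k + 1) / 2 = k by omega, show 2 * k + 1 - k = k + 1 by omega, pow_succ] at hD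
    omega
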